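/- Let $X^8=\{z\in\mathbb{C}^5 : z_1^2+\dots+z_5^2=1\}$, $z_j=x_j+iy_j$, $r^2=\sum_j|z_j|^2\ge 1$, with the linear action of $\mathrm{SO}(5)$, whose singular orbit is $S^4=\{r=1\}$; let $M=X^8\setminus S^4$. Equip $M$ with the Stenzel Calabi--Yau structure: the Kähler form $\omega=\tfrac i2\partial\bar\partial\,\mathcal{F}(r^2)$ with $\mathcal F'(s)=(4/3)^{1/4}(s+2)^{1/4}(s+1)^{-1/2}$, its metric $g$, the orientation of $\omega^4/4!$, and the holomorphic volume form $\Omega$ equal to $\frac{1}{z_i}dz_{i+1}\wedge dz_{i+2}\wedge dz_{i+3}\wedge dz_{i+4}$ (indices mod $5$) where $z_i\ne0$; put $\Phi=\tfrac12\omega^2+\mathrm{Re}\,\Omega$. For $r>1$ let $R_\pm=\sqrt{(r^2\pm1)/2}$ and $p_r=(R_+,iR_-,0,0,0)$. Let $\partial_r=\frac{r}{2R_+}\partial_{x_1}+\frac{r}{2R_-}\partial_{y_2}$ at $p_r$ and let $X_1,\dots,X_7$ be the tangent vectors at $p_r$ generated by $C_{12},C_{13},C_{14},C_{15},C_{23},C_{24},C_{25}\in\mathfrak{so}(5)$,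 where $C_{ij}=e_{ij}-e_{ji}$. Let $dr,\theta^1,\dots,\theta^7$ be the coframe at $p_r$ dual to $\partial_r,X_1,\dots,X_7$, and $\theta^{ij}=\theta^i\wedge\theta^j$. The forms $\theta^1$, $dr\wedge\theta^1$ and $\theta^{25}+\theta^{36}+\theta^{47}$ are stabilised by the isotropy group of $p_r$, and also denote the $\mathrm{SO}(5)$-invariant forms on $M$ that they define. Let $P_1=M\times\mathrm{U}(1)$ be the trivial bundle, with $\mathrm{SO}(5)$ acting on the first factor. Its connections are the smooth $i\mathbb R$-valued $1$-forms $A$ on $M$, with curvature $F_A=dA$; the gauge transformations are the smooth maps $u:M\to\mathrm U(1)$, acting by $A\mapsto A-u^{-1}du$. Let $\mathcal A_{\rm inv}(P_1)=\{i\alpha(r)\theta^1 : \alpha\in C^\infty((1,\infty),\mathbb R)\}$ be the space of invariant connections in temporal gauge. A connection is a $\mathrm{Spin}(7)$ instanton if $\star F_A=-\Phi\wedge F_A$, is Hermitian Yang--Mills (HYM) if $F_A\wedge\star\omega=0$ and $F_A\wedge\Omega=0$, and is irreducible if its holonomy group at every point is all of $\mathrm U(1)$. **Theorem.** For $K\in\mathbb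 R$ let $$A_K=\frac{iK}{(r^2+2)^{3/4}(r+1)^{3/2}(r-1)^{3/2}}\,\theta^1 .$$ 1. Each $A_K$ is a smooth $\mathrm{SO}(5)$-invariant connection in $\mathcal A_{\rm inv}(P_1)$; it is a $\mathrm{Spin}(7)$ instanton and it is HYM. Its curvature is $$F_{A_K}=iK\left(-\frac92\,\frac{r(r^2+1)}{(r^2+2)^{7/4}(r+1)^{5/2}(r-1)^{5/2}}\,dr\wedge\theta^1+\frac{\theta^{25}+\theta^{36}+\theta^{47}}{(r^2+2)^{3/4}(r+1)^{3/2}(r-1)^{3/2}}\right).$$ 2. $A_0=0$ is the trivial connection, and $A_K$ is irreducible if and only if $K\neq0$. 3. If $K\ne K'$, then $A_K$ and $A_{K'}$ are not gauge equivalent. 4. The $\mathrm{Spin}(7)$ instantons in $\mathcal A_{\rm inv}(P_1)$ are exactly the $A_K$, $K\in\mathbb R$. Moreover every $\mathrm{SO}(5)$-invariant $\mathrm{Spin}(7)$ instanton on $P_1$ is gauge equivalent to some $A_K$ through an $\mathrm{SO}(5)$-equivariant gauge transformation. -/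

import Mathlib

open Set Filter Topology
open scoped ContDiff

namespace Stenzel

noncomputable section

/-! ### The quadric minus its singular orbit -/

/-- The ambient space `ℂ⁵`; only its structure as a finite dimensional space matters. -/
abbrev Amb : Type := Fin 5 → ℂ

/-- The quadric `z₁² + ⋯ + z₅² = 1` minus its singular orbit `S⁴ = {|z| = 1}`. -/
def quadric : Set Amb := {z | ∑ j, z j ^ 2 = 1 ∧ 1 < ∑ j, ‖z j‖ ^ 2}

/-- The manifold `M = X⁸ ∖ S⁴`. -/
abbrev M : Type := quadric

/-- The tangent space of the quadric at `z`. -/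
def T (z : M) : Submodule ℝ Amb where
  carrier := {v | ∑ j, z.1 j * v j = 0}
  add_mem' {u v} hu hv := by
    simp only [mem_ofPred_eq] at *
    simp [mul_add, Finset.sum_add_distrib, hu, hv]
  zero_mem' := by simp
  smul_mem' c v hv := by
    simp only [mem_ofPred_eq] at *
    simp [mul_left_comm, ← Finset.mul_sum, hv]

theorem mem_T {z : M} {v : Amb} : v ∈ T z ↔ ∑ j, z.1 j * v j = 0 := Iff.rfl

/-- The complex structure of `M`. -/
def J (z : M) : T z →ₗ[ℝ] T z where
  toFun v := ⟨Complex.I • v.1, by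
    have h := v.2
    rw [mem_T] at h ⊢
    simp [mul_left_comm, ← Finset.mul_sum, h]⟩
  map_add' u v := by ext; simp [mul_add]
  map_smul' c v := by ext; simp; ring

/-- The radius function `r`, with `r² = |z₁|² + ⋯ + |z₅|²`. -/
def radius (z : M) : ℝ := √(∑ j, ‖z.1 j‖ ^ 2)

/-! ### Differential forms on `M` -/

/-- Complex valued alternating `k`-forms on the (real) tangent space of `M` at `z`. -/
abbrev Alt (z : M) (k : ℕ) : Type := (T z) [⋀^Fin k]→ₗ[ℝ] ℂ

/-- Complex valued `k`-forms on `M`, not necessarily smooth. -/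
abbrev Form (k : ℕ) : Type := ∀ z : M, Alt z k

/-- Restriction to `M` of a form on the ambient space. -/
def restrict {k : ℕ} (β : Amb → Amb [⋀^Fin k]→L[ℝ] ℂ) : Form k :=
  fun z => (β z.1).toAlternatingMap.compLinearMap (T z).subtype

/-- `β` is smooth on an ambient neighbourhood of `z`, where its restriction to `M` is `A`. -/
def IsLocalExtension {k : ℕ} (A : Form k) (z : M) (β : Amb → Amb [⋀^Fin k]→L[ℝ] ℂ) : Prop :=
  ∃ U : Set Amb, IsOpen U ∧ z.1 ∈ U ∧ ContDiffOn ℝ ∞ β U ∧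
    ∀ w : M, w.1 ∈ U → restrict β w = A w

/-- Smooth forms on the submanifold `M`. -/
def IsSmooth {k : ℕ} (A : Form k) : Prop := ∀ z : M, ∃ β, IsLocalExtension A z β

open Classical in
/-- The exterior derivative of a smooth form on `M`: the restriction to `M` of the exterior
derivative of any smooth local extension, see `d_eq`. -/
def d {k : ℕ} (A : Form k) : Form (k + 1) := fun z =>
  if h : ∃ β, IsLocalExtension A z β then restrict (extDeriv h.choose) z else 0

theorem d_eq {k : ℕ} {A : Form k} {z : M} {β : Amb → Amb [⋀^Fin k]→L[ℝ] ℂ}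
    (hβ : IsLocalExtension A z β) : d A z = restrict (extDeriv β) z := by
  classical
  -- a smooth retraction onto the quadric near `z`
  let q : Amb → ℂ := fun w => ∑ j, w j ^ 2
  let R : Amb → Amb := fun w => (q w ^ (-1 / 2 : ℂ)) • w
  have hq : ContDiff ℝ ∞ q := by fun_prop
  have hqz : q z.1 = 1 := z.2.1
  let S : Set Amb := {w | q w ∈ Complex.slitPlane}
  have hS : IsOpen S := Complex.isOpen_slitPlane.preimage hq.continuous
  have hzS : z.1 ∈ S := by simp [S, hqz]
  have hRS : ContDiffOn ℝ ∞ R S := by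
    intro w hw
    have h1 : ContDiffAt ℝ ∞ (fun x : ℂ => x ^ (-1 / 2 : ℂ)) (q w) := by
      have : AnalyticAt ℂ (fun x : ℂ => x ^ (-1 / 2 : ℂ)) (q w) :=
        analyticAt_id.cpow analyticAt_const hw
      exact this.contDiffAt.restrict_scalars ℝ
    exact ((h1.comp w hq.contDiffAt).smul contDiffAt_id).contDiffWithinAt
  have hRq : ∀ w ∈ S, ∑ j, R w j ^ 2 = 1 := by
    intro w hw
    have hne : q w ≠ 0 := Complex.slitPlane_ne_zero hw
    have : ∑ j, R w j ^ 2 = (q w ^ (-1 / 2 : ℂ)) ^ 2 * q w := by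
      simp [R, q, mul_pow, Finset.mul_sum]
    rw [this, ← Complex.cpow_nat_mul]
    norm_num [Complex.cpow_neg_one, hne]
  have hRz : R z.1 = z.1 := by simp [R, hqz]
  have hRd : ∀ w ∈ S, DifferentiableAt ℝ R w := fun w hw =>
    (hRS.contDiffAt (hS.mem_nhds hw)).differentiableAt (by simp)
  have hdot : ∀ w ∈ S, ∀ v, ∑ j, R w j * fderiv ℝ R w v j = 0 := by
    intro w hw v
    have h1 : HasFDerivAt (fun x => ∑ j, R x j ^ 2)
        (∑ j, (2 * R w j) • ((ContinuousLinearMap.proj (R := ℝ) (φ := fun _ : Fin 5 => ℂ) j) ∘L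
          fderiv ℝ R w)) w := by
      refine HasFDerivAt.fun_sum fun j _ => ?_
      have hj : HasFDerivAt (fun x => R x j)
          ((ContinuousLinearMap.proj (R := ℝ) (φ := fun _ : Fin 5 => ℂ) j) ∘L fderiv ℝ R w) w :=
        (hasFDerivAt_pi'.1 (hRd w hw).hasFDerivAt) j
      simpa using hj.pow 2
    have h2 : HasFDerivAt (fun x => ∑ j, R x j ^ 2) (0 : Amb →L[ℝ] ℂ) w := by
      refine (hasFDerivAt_const (1 : ℂ) w).congr_of_eventuallyEq ?_
      filter_upwards [hS.mem_nhds hw] with x hx using hRq x hx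
    have h3 := congrArg (fun L : Amb →L[ℝ] ℂ => L v) (h1.unique h2)
    simp [mul_assoc, ← Finset.mul_sum] at h3
    exact h3
  have hRid : ∀ v ∈ T z, fderiv ℝ R z.1 v = v := by
    intro v hv
    have h1 : HasFDerivAt q (∑ j, (2 * z.1 j) •
        (ContinuousLinearMap.proj (R := ℝ) (φ := fun _ : Fin 5 => ℂ) j)) z.1 := by
      refine HasFDerivAt.fun_sum fun j _ => ?_
      have hj : HasFDerivAt (fun x : Amb => x j)
          (ContinuousLinearMap.proj (R := ℝ) (φ := fun _ : Fin 5 => ℂ) j) z.1 :=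
        (ContinuousLinearMap.proj (R := ℝ) (φ := fun _ : Fin 5 => ℂ) j).hasFDerivAt
      simpa using hj.pow 2
    have h2 : HasDerivAt (fun x : ℂ => x ^ (-1 / 2 : ℂ))
        ((-1 / 2 : ℂ) * q z.1 ^ ((-1 / 2 : ℂ) - 1)) (q z.1) :=
      (Complex.hasStrictDerivAt_cpow_const hzS).hasDerivAt
    have h3 := h2.hasFDerivAt.restrictScalars ℝ |>.comp z.1 h1
    have h4 := h3.smul (hasFDerivAt_id (𝕜 := ℝ) z.1)
    have h5 : fderiv ℝ R z.1 = _ := h4.fderiv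
    rw [h5]
    have h6 : ∑ j, (2 * z.1 j) * v j = 0 := by
      have := mem_T.1 hv
      simp [mul_assoc, ← Finset.mul_sum, this]
    ext j
    simp [hqz, h6]
  -- both candidates agree with the exterior derivative of the pulled back form
  have key : ∀ β, IsLocalExtension A z β → ∀ v : Fin (k + 1) → T z,
      restrict (extDeriv β) z v = extDeriv (fun w =>
        (β (R w)).compContinuousLinearMap (fderiv ℝ R w)) z.1 (fun i => (v i).1) := by
    rintro β ⟨U, hU, hzU, hβ, -⟩ v
    have hb : DifferentiableAt ℝ β (R z.1) := by
      rw [hRz]; exact (hβ.contDiffAt (hU.mem_nhds hzU)).differentiableAt (by simp)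
    rw [extDeriv_pullback (r := ∞) hb (hRS.contDiffAt (hS.mem_nhds hzS))
      (by simp; exact WithTop.coe_le_coe.2 (le_top : (2 : ℕ∞) ≤ ⊤)), hRz]
    simp only [restrict, ContinuousAlternatingMap.compContinuousLinearMap_apply,
      AlternatingMap.compLinearMap_apply]
    have hv : (fun i => fderiv ℝ R z.1 (v i).1) = fun i => (v i).1 :=
      funext fun i => hRid _ (v i).2
    have := congrArg (extDeriv β z.1) hv
    exact this.symm
  have uniq : ∀ β₁ β₂, IsLocalExtension A z β₁ → IsLocalExtension A z β₂ →
      restrict (extDeriv β₁) z = restrict (extDeriv β₂) z := by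
    intro β₁ β₂ h₁ h₂
    ext v
    rw [key β₁ h₁, key β₂ h₂]
    obtain ⟨U₁, hU₁, hz₁, -, e₁⟩ := h₁
    obtain ⟨U₂, hU₂, hz₂, -, e₂⟩ := h₂
    have hRc : ContinuousAt R z.1 := (hRd _ hzS).continuousAt
    have hN : IsOpen {w : Amb | 1 < ∑ j, ‖w j‖ ^ 2} :=
      isOpen_lt continuous_const (by fun_prop)
    have n₁ : ∀ᶠ w in 𝓝 z.1, R w ∈ U₁ := hRc (by rw [hRz]; exact hU₁.mem_nhds hz₁)
    have n₂ : ∀ᶠ w in 𝓝 z.1, R w ∈ U₂ := hRc (by rw [hRz]; exact hU₂.mem_nhds hz₂)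
    have n₃ : ∀ᶠ w in 𝓝 z.1, R w ∈ {w : Amb | 1 < ∑ j, ‖w j‖ ^ 2} :=
      hRc (by rw [hRz]; exact hN.mem_nhds z.2.2)
    have he : (fun w => (β₁ (R w)).compContinuousLinearMap (fderiv ℝ R w)) =ᶠ[𝓝 z.1]
        fun w => (β₂ (R w)).compContinuousLinearMap (fderiv ℝ R w) := by
      filter_upwards [n₁, n₂, n₃, hS.mem_nhds hzS] with w h1 h2 h3 h4
      ext u
      let m : M := ⟨R w, hRq w h4, h3⟩
      have h5 := (e₁ m h1).trans (e₂ m h2).symm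
      exact congrArg (fun a : Alt m k => a fun i => ⟨fderiv ℝ R w (u i), hdot w h4 (u i)⟩) h5
    rw [he.extDeriv_eq]
  have hex : ∃ β, IsLocalExtension A z β := ⟨β, hβ⟩
  simp only [d, dif_pos hex]
  exact uniq _ _ hex.choose_spec hβ

/-- The wedge product, `(a ∧ b)(v) = (1/k!l!) ∑ sign σ a(v_σ(1), …) b(v_σ(k+1), …)`. -/
def wedge {z : M} {k l : ℕ} (a : Alt z k) (b : Alt z l) : Alt z (k + l) :=
  ((LinearMap.mul' ℝ ℂ).compAlternatingMap (a.domCoprod b)).domDomCongr finSumFinEquiv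

/-- A function on `M` as a `0`-form. -/
def zeroForm (f : M → ℂ) : Form 0 :=
  fun z => AlternatingMap.constOfIsEmpty ℝ (T z) (Fin 0) (f z)

/-! ### The action of `SO(5)` -/

/-- The group `SO(5)`. -/
abbrev SO5 : Type := Matrix.specialOrthogonalGroup (Fin 5) ℝ

/-- A real matrix acting on `ℂ⁵`. -/
def rot (g : Matrix (Fin 5) (Fin 5) ℝ) : Amb →ₗ[ℝ] Amb :=
  (Matrix.mulVecLin (g.map Complex.ofReal)).restrictScalars ℝ

theorem rot_dot (g : SO5) (u v : Amb) : ∑ j, rot g.1 u j * rot g.1 v j = ∑ j, u j * v j := by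
  have hg : g.1.transpose * g.1 = 1 := by
    have h := (Matrix.mem_specialOrthogonalGroup_iff.1 g.2).1
    exact (Matrix.mem_orthogonalGroup_iff' _ _).1 h
  have hc : (g.1.map Complex.ofReal).transpose * (g.1.map Complex.ofReal)
      = (1 : Matrix (Fin 5) (Fin 5) ℂ) := by
    have h := congrArg (fun m => m.map Complex.ofRealHom) hg
    simp only [Matrix.map_mul, Matrix.transpose_map] at h
    refine h.trans ?_
    simp
  change (Matrix.mulVec (g.1.map Complex.ofReal) u) ⬝ᵥ
    (Matrix.mulVec (g.1.map Complex.ofReal) v) = u ⬝ᵥ v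
  rw [Matrix.dotProduct_mulVec, ← Matrix.mulVec_transpose, Matrix.mulVec_mulVec, hc,
    Matrix.one_mulVec]

theorem rot_star (g : Matrix (Fin 5) (Fin 5) ℝ) (v : Amb) : rot g (star v) = star (rot g v) := by
  ext i
  simp [rot, Matrix.mulVec, dotProduct]

theorem rot_norm (g : SO5) (v : Amb) : ∑ j, ‖rot g.1 v j‖ ^ 2 = ∑ j, ‖v j‖ ^ 2 := by
  have h := rot_dot g v (star v)
  rw [rot_star] at h
  have key : ∀ w : Amb, ((∑ j, ‖w j‖ ^ 2 : ℝ) : ℂ) = ∑ j, w j * (star w) j := by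
    intro w
    simp [Complex.mul_conj, Complex.normSq_eq_norm_sq]
  apply Complex.ofReal_injective
  rw [key, key, h]

/-- The action of `SO(5)` on `M`. -/
def act (g : SO5) (z : M) : M := ⟨rot g.1 z.1, by
  refine ⟨?_, ?_⟩
  · have h := rot_dot g z.1 z.1
    simp only [← pow_two] at h
    rw [h]; exact z.2.1
  · rw [rot_norm]; exact z.2.2⟩

/-- The differential of the action of `g` at `z`. -/
def dAct (g : SO5) (z : M) : T z →ₗ[ℝ] T (act g z) where
  toFun v := ⟨rot g.1 v.1, by rw [mem_T]; exact (rot_dot g z.1 v.1).trans v.2⟩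
  map_add' u v := by ext; simp
  map_smul' c v := by ext; simp

/-- The pullback of a form by `g`. -/
def pullback {k : ℕ} (g : SO5) (A : Form k) : Form k :=
  fun z => (A (act g z)).compLinearMap (dAct g z)

/-- `SO(5)`-invariance of a form. -/
def IsInvariant {k : ℕ} (A : Form k) : Prop := ∀ g : SO5, pullback g A = A

/-! ### The Stenzel Calabi-Yau structure -/

/-- The `1`-form `dᶜf = -df ∘ i` of a function on `ℂ⁵`; thus `(i/2)∂∂̄f = (1/4) d dᶜ f`. -/
def dc (f : Amb → ℝ) (z : Amb) : Amb [⋀^Fin 1]→L[ℝ] ℂ :=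
  ContinuousAlternatingMap.ofSubsingleton ℝ Amb ℂ (0 : Fin 1)
    (Complex.ofRealCLM ∘L (-(fderiv ℝ f z)) ∘L (Complex.I • ContinuousLinearMap.id ℝ Amb))

/-- The profile `𝓕` of the Stenzel Kähler potential, normalised by `𝓕(1) = 0`:
`𝓕'(s) = (4/3)^(1/4) (s+2)^(1/4) (s+1)^(-1/2)`. -/
def profile (s : ℝ) : ℝ :=
  ∫ t in (1 : ℝ)..s, (4 / 3 : ℝ) ^ (1 / 4 : ℝ) * (t + 2) ^ (1 / 4 : ℝ) * (t + 1) ^ (-1 / 2 : ℝ)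

/-- The Kähler form `ω = (i/2)∂∂̄ 𝓕(r²)` of the Stenzel metric. -/
def kahler : Form 2 :=
  restrict fun z => (1 / 4 : ℝ) • extDeriv (dc fun w => profile (∑ j, ‖w j‖ ^ 2)) z

/-- The Stenzel metric `g(u, v) = ω(u, Jv)`. -/
def metric (z : M) (u v : T z) : ℝ := (kahler z ![u, J z v]).re

/-- The volume form `ω⁴/4!`. -/
def vol (z : M) : Alt z 8 :=
  (1 / 24 : ℝ) • wedge (wedge (wedge (kahler z) (kahler z)) (kahler z)) (kahler z)

/-- The holomorphic volume form `Ω(v₁, …, v₄) = det(z, v₁, …, v₄)`. On the quadric it equals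
`(1/zᵢ) dzᵢ₊₁ ∧ dzᵢ₊₂ ∧ dzᵢ₊₃ ∧ dzᵢ₊₄` (indices mod 5) wherever `zᵢ ≠ 0`, see `Omega_eq`. -/
def Omega : Form 4 := fun z =>
  { toFun := fun v => Matrix.det (Matrix.of (Fin.cons z.1 (fun a => (v a).1) : Fin 5 → Amb))
    map_update_add' := by
      intro _ v a x y
      have key : ∀ x : T z, (Fin.cons z.1 (fun b => (Function.update v a x b).1) : Fin 5 → Amb)
          = Matrix.updateRow (Matrix.of (Fin.cons z.1 (fun b => (v b).1) : Fin 5 → Amb))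
            a.succ x.1 := by
        intro x
        ext i j
        refine Fin.cases ?_ (fun b => ?_) i
        · simp [Matrix.updateRow_apply, (Fin.succ_ne_zero a).symm]
        · by_cases h : b = a
          · subst h; simp
          · simp [Matrix.updateRow_apply, h]
      have e : (‹DecidableEq (Fin 4)› : DecidableEq (Fin 4)) = instDecidableEqFin 4 :=
        Subsingleton.elim _ _
      subst e
      simp only [key]
      exact Matrix.det_updateRow_add _ _ _ _
    map_update_smul' := by
      intro _ v a c x
      have key : ∀ x : T z, (Fin.cons z.1 (fun b => (Function.update v a x b).1) : Fin 5 → Amb)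
          = Matrix.updateRow (Matrix.of (Fin.cons z.1 (fun b => (v b).1) : Fin 5 → Amb))
            a.succ x.1 := by
        intro x
        ext i j
        refine Fin.cases ?_ (fun b => ?_) i
        · simp [Matrix.updateRow_apply, (Fin.succ_ne_zero a).symm]
        · by_cases h : b = a
          · subst h; simp
          · simp [Matrix.updateRow_apply, h]
      have e : (‹DecidableEq (Fin 4)› : DecidableEq (Fin 4)) = instDecidableEqFin 4 :=
        Subsingleton.elim _ _
      subst e
      simp only [key]
      have h : ((c • x : T z).1 : Amb) = (c : ℂ) • x.1 := by ext j; simp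
      rw [h]
      exact Matrix.det_updateRow_smul _ _ _ _
    map_eq_zero_of_eq' := by
      intro v a b hv hab
      refine Matrix.det_zero_of_row_eq (i := a.succ) (j := b.succ)
        (fun h => hab (Fin.succ_injective _ h)) ?_
      ext j
      simp [hv] }

theorem Omega_apply (z : M) (v : Fin 4 → T z) : Omega z v =
    Matrix.det (Matrix.of (Fin.cons z.1 (fun a => (v a).1) : Fin 5 → Amb)) := rfl

theorem Omega_eq (z : M) (v : Fin 4 → T z) (i : Fin 5) :
    z.1 i * Omega z v =
      Matrix.det (Matrix.of fun a b : Fin 4 => (v a).1 (i + 1 + b.castSucc)) := by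
  set N : Matrix (Fin 5) (Fin 5) ℂ :=
    Matrix.of (Fin.cons z.1 (fun a => (v a).1) : Fin 5 → Amb) with hN
  have h1 : N.mulVec z.1 = Pi.single 0 1 := by
    ext a
    refine Fin.cases ?_ (fun a => ?_) a
    · have := z.2.1
      simpa [hN, Matrix.mulVec, dotProduct, pow_two] using this
    · have := mem_T.1 (v a).2
      simpa [hN, Matrix.mulVec, dotProduct, mul_comm] using this
  have h2 : N.det • z.1 = N.adjugate.mulVec (Pi.single 0 1) := by
    rw [← h1, Matrix.mulVec_mulVec, Matrix.adjugate_mul, Matrix.smul_mulVec, Matrix.one_mulVec]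
  have h3 := congrFun h2 i
  have h4 : Omega z v = N.det := by
    rw [Omega_apply]
  rw [h4, mul_comm]
  rw [Matrix.mulVec_single_one] at h3
  change N.det * z.1 i = N.adjugate i 0 at h3
  rw [h3, Matrix.adjugate_fin_succ_eq_det_submatrix]
  have h5 : N.submatrix (Fin.succAbove 0) i.succAbove =
      Matrix.of fun a b => (v a).1 (i.succAbove b) := by
    ext a b; simp [hN]
  rw [h5]
  have h6 : ∀ (i : Fin 5) (b : Fin 4),
      i.succAbove (((finRotate 4) ^ (i : ℕ)) b) = i + 1 + b.castSucc := by decide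
  have h7 := Matrix.det_permute' ((finRotate 4) ^ (i : ℕ))
    (Matrix.of fun a b : Fin 4 => (v a).1 (i.succAbove b))
  have h8 : (Matrix.of fun a b : Fin 4 => (v a).1 (i.succAbove b)).submatrix id
      ((finRotate 4) ^ (i : ℕ)) = Matrix.of fun a b : Fin 4 => (v a).1 (i + 1 + b.castSucc) := by
    ext a b
    simp [h6]
  rw [← h8, h7]
  rw [map_pow, sign_finRotate]
  congr 1
  simp [pow_succ]

/-- The real part of a complex valued form. -/
def rePart {z : M} {k : ℕ} (a : Alt z k) : Alt z k :=
  (Complex.ofRealCLM.toLinearMap ∘ₗ Complex.reLm).compAlternatingMap a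

/-- The Cayley calibration `Φ = ω²/2 + Re Ω`. -/
def cayley (z : M) : Alt z 4 :=
  (1 / 2 : ℝ) • wedge (kahler z) (kahler z) + rePart (Omega z)

/-- `χ = ⋆ψ` for the Stenzel metric and the orientation of `ω⁴/4!`: for every orthonormal frame
`e₁, …, e₈`, which is positive or negative according to `vol(e₁, …, e₈) = ±1`, one has
`χ(e_{k+1}, …, e₈) = vol(e₁, …, e₈) ψ(e₁, …, e_k)`. -/
def IsHodgeStar {z : M} {k l : ℕ} (hkl : k + l = 8) (ψ : Alt z k) (χ : Alt z l) : Prop :=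
  ∀ e : Fin 8 → T z, (∀ i j, metric z (e i) (e j) = if i = j then 1 else 0) →
    χ (fun i => e (Fin.cast hkl (Fin.natAdd k i))) =
      vol z e * ψ (fun i => e (Fin.cast hkl (Fin.castAdd l i)))

/-! ### `U(1)`-connections on the trivial bundle `P₁ = M × U(1)` -/

/-- Connections on `M × U(1)`: smooth `1`-forms on `M` with values in `𝔲(1) = iℝ`. -/
def IsConnection (A : Form 1) : Prop := IsSmooth A ∧ ∀ z v, (A z v).re = 0

/-- The `Spin(7)` instanton equation `⋆F_A = -Φ ∧ F_A`, with `F_A = dA`. -/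
def IsSpin7Instanton (A : Form 1) : Prop :=
  ∀ z, IsHodgeStar (k := 2) (l := 6) rfl (d A z) (-(wedge (cayley z) (d A z)))

/-- The Hermitian Yang-Mills equations `F_A ∧ ⋆ω = 0` and `F_A ∧ Ω = 0`. -/
def IsHYM (A : Form 1) : Prop :=
  ∀ z, (∃ χ : Alt z 6, IsHodgeStar (k := 2) (l := 6) rfl (kahler z) χ ∧
    wedge (d A z) χ = 0) ∧ wedge (d A z) (Omega z) = 0

/-- `u : M → U(1)` is a smooth gauge transformation carrying `A` to `B = A - u⁻¹du`. -/
def IsGaugeTransformation (u : M → Circle) (A B : Form 1) : Prop :=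
  IsSmooth (zeroForm fun z => (u z : ℂ)) ∧
    ∀ z, B z = A z - ((u z)⁻¹ : ℂ) • d (zeroForm fun w => (u w : ℂ)) z

/-- Gauge equivalence. -/
def GaugeEquivalent (A B : Form 1) : Prop := ∃ u, IsGaugeTransformation u A B

/-- Gauge equivalence through an `SO(5)`-equivariant gauge transformation. -/
def EquivariantlyGaugeEquivalent (A B : Form 1) : Prop :=
  ∃ u, (∀ (g : SO5) z, u (act g z) = u z) ∧ IsGaugeTransformation u A B

/-- `t ↦ (γ t, u t)`, `0 ≤ t ≤ 1`, is a piecewise smooth path in `M × U(1)` which is horizontal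
for `A`, that is `u' = -A(γ')u`. -/
def IsHorizontal (A : Form 1) (γ : ℝ → M) (u : ℝ → Circle) : Prop :=
  ∃ (n : ℕ) (t : Fin (n + 1) → ℝ), StrictMono t ∧ t 0 = 0 ∧ t (Fin.last n) = 1 ∧
    ∀ i : Fin n,
      ContDiffOn ℝ ∞ (fun s => (γ s : Amb)) (Icc (t i.castSucc) (t i.succ)) ∧
      ContDiffOn ℝ ∞ (fun s => (u s : ℂ)) (Icc (t i.castSucc) (t i.succ)) ∧
      ∀ s ∈ Ioo (t i.castSucc) (t i.succ), ∃ v : T (γ s),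
        HasDerivAt (fun s => (γ s : Amb)) v.1 s ∧
        HasDerivAt (fun s => (u s : ℂ)) (-(A (γ s) ![v]) * u s) s

/-- The holonomy of `A` at `z`: the elements of `U(1)` that arise by parallel transport along
piecewise smooth loops at `z`. -/
def holonomy (A : Form 1) (z : M) : Set Circle :=
  {h | ∃ γ u, IsHorizontal A γ u ∧ γ 0 = z ∧ γ 1 = z ∧ u 0 = 1 ∧ u 1 = h}

/-- A connection is irreducible if its holonomy is the whole structure group. -/
def IsIrreducible (A : Form 1) : Prop := ∀ z, holonomy A z = univ

/-! ### The invariant coframe -/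

/-- `R₊` on the orbit of radius `r`. -/
def Rp (r : ℝ) : ℝ := √((r ^ 2 + 1) / 2)

/-- `R₋` on the orbit of radius `r`. -/
def Rm (r : ℝ) : ℝ := √((r ^ 2 - 1) / 2)

theorem Rp_sq (r : ℝ) : Rp r ^ 2 = (r ^ 2 + 1) / 2 := Real.sq_sqrt (by positivity)

theorem Rm_sq {r : ℝ} (hr : 1 < r) : Rm r ^ 2 = (r ^ 2 - 1) / 2 :=
  Real.sq_sqrt (by nlinarith)

theorem Rp_pos (r : ℝ) : 0 < Rp r := Real.sqrt_pos.2 (by positivity)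

theorem Rm_pos {r : ℝ} (hr : 1 < r) : 0 < Rm r := Real.sqrt_pos.2 (by nlinarith)

/-- The reference point `p_r = (R₊, iR₋, 0, 0, 0)`. -/
def p (r : Ioi (1 : ℝ)) : M := ⟨![(Rp r : ℂ), Complex.I * Rm r, 0, 0, 0], by
  have h1 := Rp_sq r.1
  have h2 := Rm_sq r.2
  have hr : (1 : ℝ) < r.1 := r.2
  refine ⟨?_, ?_⟩
  · simp only [Fin.sum_univ_five]
    simp [mul_pow]
    norm_cast
    rw [h1, h2]; ring
  · simp only [Fin.sum_univ_five]
    simp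
    rw [h1, h2]; nlinarith⟩

/-- `C_{ij} = e_{ij} - e_{ji}` in `𝔰𝔬(5)`. -/
def C (i j : Fin 5) : Matrix (Fin 5) (Fin 5) ℝ := Matrix.single i j 1 - Matrix.single j i 1

/-- The elements `X₁ = C₁₂, X₂ = C₁₃, X₃ = C₁₄, X₄ = C₁₅, X₅ = C₂₃, X₆ = C₂₄, X₇ = C₂₅`. -/
def X : Fin 7 → Matrix (Fin 5) (Fin 5) ℝ :=
  ![C 0 1, C 0 2, C 0 3, C 0 4, C 1 2, C 1 3, C 1 4]

theorem rot_C (i j : Fin 5) (z : Amb) :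
    rot (C i j) z = Pi.single i (z j) - Pi.single j (z i) := by
  have h : ∀ i j : Fin 5, (Matrix.single i j (1 : ℝ)).map Complex.ofReal
      = Matrix.single i j (1 : ℂ) := by
    intro i j
    ext a b
    simp only [Matrix.map_apply, Matrix.single_apply]
    split_ifs <;> simp
  have h2 : (C i j).map Complex.ofReal = Matrix.single i j (1 : ℂ) - Matrix.single j i 1 := by
    rw [← h, ← h]
    ext a b
    simp [C]
  change Matrix.mulVec ((C i j).map Complex.ofReal) z = _
  rw [h2, Matrix.sub_mulVec, Matrix.single_mulVec, Matrix.single_mulVec]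
  ext k
  simp [Function.update_apply, Pi.single_apply]

/-- The frame `∂_r, X₁, …, X₇` at `p_r`. -/
def frame (r : Ioi (1 : ℝ)) : Fin 8 → Amb :=
  Fin.cons ![((r / (2 * Rp r) : ℝ) : ℂ), Complex.I * ((r / (2 * Rm r) : ℝ) : ℂ), 0, 0, 0]
    fun i => rot (X i) (p r).1

/-- The dual coframe `dr, θ¹, …, θ⁷` at `p_r`, see `coframe_frame`. -/
def coframeFun (r : Ioi (1 : ℝ)) (i : Fin 8) (v : Amb) : ℝ :=
  (![2 * Rp r / r * (v 0).re, (v 0).im / Rm r, -(v 2).re / Rp r, -(v 3).re / Rp r,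
    -(v 4).re / Rp r, -(v 2).im / Rm r, -(v 3).im / Rm r, -(v 4).im / Rm r] : Fin 8 → ℝ) i

theorem frame_mem (r : Ioi (1 : ℝ)) (i : Fin 8) : frame r i ∈ T (p r) := by
  have h1 : (Rp r : ℂ) ≠ 0 := by exact_mod_cast (Rp_pos r.1).ne'
  have h2 : (Rm r : ℂ) ≠ 0 := by exact_mod_cast (Rm_pos r.2).ne'
  rw [mem_T]
  refine Fin.cases ?_ (fun i => ?_) i
  · simp only [frame, p, Fin.sum_univ_five, Fin.cons_zero]
    simp
    field_simp
    simp
  · simp only [frame, Fin.cons_succ]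
    fin_cases i <;> simp [X, rot_C, p, Fin.sum_univ_five, Pi.single_apply, mul_comm]

theorem coframe_frame (r : Ioi (1 : ℝ)) (i j : Fin 8) :
    coframeFun r i (frame r j) = if i = j then 1 else 0 := by
  have h1 := (Rp_pos r.1).ne'
  have h2 := (Rm_pos r.2).ne'
  have hr : (r : ℝ) ≠ 0 := (zero_lt_one.trans r.2).ne'
  refine Fin.cases ?_ (fun j => ?_) j
  · simp only [frame, Fin.cons_zero]
    fin_cases i <;> simp [coframeFun, Complex.div_re, Complex.div_im]
    field_simp
  · simp only [frame, Fin.cons_succ]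
    fin_cases j <;> simp only [X] <;> fin_cases i <;>
      simp [coframeFun, rot_C, p, h1, h2]

/-- The coframe `dr, θ¹, …, θ⁷` as `1`-forms on the tangent space at `p_r`. -/
def coframe (r : Ioi (1 : ℝ)) (i : Fin 8) : Alt (p r) 1 :=
  AlternatingMap.ofSubsingleton ℝ (T (p r)) ℂ (0 : Fin 1)
    { toFun := fun v => (coframeFun r i v.1 : ℂ)
      map_add' := by
        intro u v
        rw [← Complex.ofReal_add]; congr 1
        fin_cases i <;> simp [coframeFun] <;> ring
      map_smul' := by
        intro c v
        simp only [RingHom.id_apply, Complex.real_smul]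
        rw [← Complex.ofReal_mul]; congr 1
        fin_cases i <;> simp [coframeFun] <;> ring }

/-- The invariant `1`-form `θ¹ = (∑ xⱼ dyⱼ) / (R₊R₋)` on `M`; it is the `SO(5)`-invariant form
that restricts to `θ¹` at the reference points, see `theta_p`. -/
def theta : Form 1 := fun z =>
  AlternatingMap.ofSubsingleton ℝ (T z) ℂ (0 : Fin 1)
    { toFun := fun v =>
        (((∑ j, (z.1 j).re * (v.1 j).im) / (Rp (radius z) * Rm (radius z)) : ℝ) : ℂ)
      map_add' := by
        intro u v
        rw [← Complex.ofReal_add]; congr 1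
        simp [mul_add, Finset.sum_add_distrib, add_div]
      map_smul' := by
        intro c v
        simp only [RingHom.id_apply, Complex.real_smul]
        rw [← Complex.ofReal_mul]; congr 1
        simp [mul_left_comm, ← Finset.mul_sum, mul_div_assoc] }

theorem radius_act (g : SO5) (z : M) : radius (act g z) = radius z := by
  simp only [radius, act, rot_norm]

theorem radius_p (r : Ioi (1 : ℝ)) : radius (p r) = r := by
  have h1 := Rp_sq r.1
  have h2 := Rm_sq r.2
  have hr : (1 : ℝ) < r.1 := r.2
  rw [radius, Real.sqrt_eq_iff_mul_self_eq_of_pos (by linarith)]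
  simp only [p, Fin.sum_univ_five]
  simp
  rw [h1, h2]; ring

theorem theta_p (g : SO5) (r : Ioi (1 : ℝ)) : pullback g theta (p r) = coframe r 1 := by
  have key : ∀ z v : Amb, ∑ j, (rot g.1 z j).re * (rot g.1 v j).im = ∑ j, (z j).re * (v j).im := by
    intro z v
    have h := rot_dot g (z + star z) v
    rw [map_add, rot_star] at h
    have h' := congrArg Complex.im h
    simp only [Complex.im_sum] at h'
    simpa [← two_mul, mul_assoc, ← Finset.mul_sum] using h'
  have hp := (Rp_pos r.1).ne'
  ext v
  have hv : ∑ j, (rot g.1 (p r).1 j).re * (rot g.1 (v 0).1 j).im =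
      ∑ j, ((p r).1 j).re * ((v 0).1 j).im := key _ _
  have h1 : pullback g theta (p r) v =
      (((∑ j, (rot g.1 (p r).1 j).re * (rot g.1 (v 0).1 j).im) /
        (Rp (radius (act g (p r))) * Rm (radius (act g (p r)))) : ℝ) : ℂ) := rfl
  have h2 : coframe r 1 v = ((((v 0).1 0).im / Rm r : ℝ) : ℂ) := rfl
  rw [h1, h2, hv, radius_act, radius_p]
  congr 1
  simp only [p, Fin.sum_univ_five]
  simp
  field_simp

/-- The connections `iα(r)θ¹` with `α` smooth on `(1, ∞)`: the invariant connections on `P₁` in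
temporal gauge. -/
def Ainv : Set (Form 1) :=
  {A | ∃ α : ℝ → ℝ, ContDiffOn ℝ ∞ α (Ioi 1) ∧
    ∀ z, A z = (Complex.I * (α (radius z) : ℂ)) • theta z}

/-- `α_K(r) = K / ((r²+2)^(3/4) (r+1)^(3/2) (r-1)^(3/2))`. -/
def alphaK (K r : ℝ) : ℝ :=
  K / ((r ^ 2 + 2) ^ (3 / 4 : ℝ) * (r + 1) ^ (3 / 2 : ℝ) * (r - 1) ^ (3 / 2 : ℝ))

/-- The connections `A_K`. -/
def AK (K : ℝ) : Form 1 := fun z => (Complex.I * (alphaK K (radius z) : ℂ)) • theta z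

end

end Stenzel

open Stenzel

/-!
Every `SO(5)`-orbit in `M` meets the curve of reference points `p_r` exactly once, and an invariant
`1`-form is determined by its values there. The diagonal sign matrices that fix `p_r` kill its
components along the last three coordinates, so an invariant connection has the shape
`A = i (k(r²) d(r²) + h(r²) ∑ xⱼ dyⱼ)` with smooth real functions `k` and `h`
(`IsInvariant.exists_profile`); the connections in temporal gauge are those with `k = 0`. As
`∑ xⱼ dyⱼ` and `d(r²)` make sense on all of `ℂ⁵`, exterior derivatives are computed on the ambient
space (`IsRadial.d_apply`); the term with `k` is closed and does not contribute.

The Kähler form is itself the derivative of a radial form, with `h = 𝓕'`. Hence an explicit unitary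
basis `f₁, Jf₁, …` of the tangent space at `p_r` diagonalises `ω` and the curvatures of all radial
connections at once: `F = x ω + y f¹²` with `f¹² = f₁* ∧ (Jf₁)*` (`exists_isUnitary`). Such an `F`
is of type `(1, 1)`, so `F ∧ Ω = 0` and `F ∧ Re Ω = 0`, and in coefficients
`ω³ = 6 ⋆ω` and `ω² ∧ f¹² = 2 ⋆(ω - f¹²)`. Therefore `⋆F = -Φ ∧ F` says `y = -4x`
(`IsUnitary.isHodgeStar_cayley_iff`), which also gives `F ∧ ⋆ω = 0`. Written out, `y = -4x` is a
linear first order equation for `h`. With the integrating factor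
`R₊R₋ (r²+2)^(3/4) (r²-1)^(3/2)` its solutions are the profiles of the `A_K` (`ode_iff`).

A general invariant instanton is brought into temporal gauge by `exp(iΨ(r²))` with `Ψ' = k`.

For the holonomy, the complex circle `(cos ζ, sin ζ, 0, 0, 0)`, `ζ = φ + iτ`, lies in the quadric
with `r² = cosh 2τ`, every point of `M` lies on a translate of it, and `θ¹` restricts to `-dφ`. A
radial segment followed by a full circle and the segment back has holonomy
`exp(2πi K / ((r²+2)^(3/4) (r²-1)^(3/2)))`; the exponent takes all values of the sign of `K`, so the
holonomy is all of `U(1)` when `K ≠ 0`. Likewise some circle separates the holonomies of `A_K` and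
`A_K'` when `K ≠ K'`, and holonomy around a loop is gauge invariant.
-/

namespace Stenzel

noncomputable section

/-! ### The wedge product with a `2`-form -/

section Wedge

variable {z : M}

theorem alt_two_add_left (b : Alt z 2) (x x' y : T z) :
    b ![x + x', y] = b ![x, y] + b ![x', y] := by
  have e : ∀ t, Function.update ![x, y] 0 t = ![t, y] := fun t => by
    ext1 i; fin_cases i <;> rfl
  simpa only [e] using b.map_update_add ![x, y] 0 x x'

theorem alt_two_add_right (b : Alt z 2) (x y y' : T z) :
    b ![x, y + y'] = b ![x, y] + b ![x, y'] := by
  have e : ∀ t, Function.update ![x, y] 1 t = ![x, t] := fun t => by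
    ext1 i; fin_cases i <;> rfl
  simpa only [e] using b.map_update_add ![x, y] 1 y y'

theorem alt_two_smul_left (b : Alt z 2) (c : ℝ) (x y : T z) :
    b ![c • x, y] = c * b ![x, y] := by
  have e : ∀ t, Function.update ![x, y] 0 t = ![t, y] := fun t => by
    ext1 i; fin_cases i <;> rfl
  simpa only [e, Complex.real_smul] using b.map_update_smul ![x, y] 0 c x

theorem alt_two_smul_right (b : Alt z 2) (c : ℝ) (x y : T z) :
    b ![x, c • y] = c * b ![x, y] := by
  have e : ∀ t, Function.update ![x, y] 1 t = ![x, t] := fun t => by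
    ext1 i; fin_cases i <;> rfl
  simpa only [e, Complex.real_smul] using b.map_update_smul ![x, y] 1 c y

/-- The permutation `0 ↦ i`, `1 ↦ i.succAbove j` that is increasing on the other indices. -/
theorem exists_perm_pair {k : ℕ} (i : Fin (k + 2)) (j : Fin (k + 1)) :
    ∃ σ : Equiv.Perm (Fin (k + 2)), σ 0 = i ∧ σ 1 = i.succAbove j ∧
      (∀ m : Fin k, σ m.succ.succ = i.succAbove (j.succAbove m)) ∧
      Equiv.Perm.sign σ = (-1) ^ ((i : ℕ) + j) := by
  refine ⟨i.cycleRange.symm * Equiv.Perm.decomposeFin.symm (0, j.cycleRange.symm), ?_, ?_, ?_, ?_⟩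
  · simp
  · rw [Equiv.Perm.mul_apply, Equiv.Perm.decomposeFin_symm_apply_one]
    simp
  · intro m
    rw [Equiv.Perm.mul_apply, Equiv.Perm.decomposeFin_symm_apply_succ]
    simp
  · rw [Equiv.Perm.sign_mul, Equiv.Perm.decomposeFin.symm_sign, Equiv.Perm.sign_symm,
      Equiv.Perm.sign_symm, Fin.sign_cycleRange, Fin.sign_cycleRange]
    simp [pow_add]

/-- `k! l! (a ∧ b)` as a sum over all permutations. -/
theorem factorial_mul_wedge {k l : ℕ} (a : Alt z k) (b : Alt z l) (v : Fin (k + l) → T z) :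
    ((k.factorial * l.factorial : ℕ) : ℂ) * wedge a b v =
      ∑ σ : Equiv.Perm (Fin (k + l)), (Equiv.Perm.sign σ : ℤ) *
        (a (fun i => v (σ (Fin.castAdd l i))) * b (fun i => v (σ (Fin.natAdd k i)))) := by
  have h := congrArg (fun w => LinearMap.mul' ℝ ℂ (w (fun i => v (finSumFinEquiv i))))
    (MultilinearMap.domCoprod_alternization_eq a b)
  simp only [Fintype.card_fin] at h
  have h2 : LinearMap.mul' ℝ ℂ (((k.factorial * l.factorial) • a.domCoprod b)
      (fun i => v (finSumFinEquiv i))) = ((k.factorial * l.factorial : ℕ) : ℂ) * wedge a b v := by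
    rw [AlternatingMap.smul_apply, map_nsmul, nsmul_eq_mul]
    rfl
  rw [← h2, ← h, MultilinearMap.alternatization_apply, map_sum]
  refine Fintype.sum_equiv (Equiv.permCongr finSumFinEquiv) _ _ fun σ => ?_
  rw [Equiv.Perm.sign_permCongr]
  simp only [MultilinearMap.domDomCongr_apply, MultilinearMap.domCoprod_apply]
  rw [Units.smul_def, map_zsmul, zsmul_eq_mul]
  simp

/-- Graded commutativity with a `2`-form, in the form of a cyclic relabelling. -/
theorem factorial_mul_wedge_two {k : ℕ} (a : Alt z k) (b : Alt z 2) (v : Fin (k + 2) → T z) :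
    ((k.factorial * 2 : ℕ) : ℂ) * wedge a b v =
      ∑ σ : Equiv.Perm (Fin (k + 2)), (Equiv.Perm.sign σ : ℤ) *
        (b ![v (σ 0), v (σ 1)] * a (fun i => v (σ i.succ.succ))) := by
  have h := factorial_mul_wedge a b v
  simp only [Nat.factorial_two] at h
  rw [h]
  set ρ : Equiv.Perm (Fin (k + 2)) := finRotate (k + 2) ^ 2 with hρ
  have hs : Equiv.Perm.sign ρ = 1 := by
    rw [hρ, map_pow, Int.units_sq]
  have hr : ∀ i, ρ i = i + 1 + 1 := by
    intro i
    rw [hρ, pow_two, Equiv.Perm.mul_apply, finRotate_apply, finRotate_apply]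
  have h1 : ∀ i : Fin k, ρ (Fin.castAdd 2 i) = i.succ.succ := by
    intro i
    rw [hr]
    ext
    rw [Fin.val_add_one_of_lt, Fin.val_add_one_of_lt]
    · simp
    · rw [Fin.lt_def]; simp
    · rw [Fin.lt_def, Fin.val_add_one_of_lt]
      · simp
      · rw [Fin.lt_def]; simp
  have h2 : ∀ i : Fin 2, ρ (Fin.natAdd k i) = Fin.castLE (by omega) i := by
    intro i
    rw [hr]
    ext
    simp only [Fin.val_add, Fin.val_natAdd, Fin.val_castLE, Fin.val_one]
    fin_cases i
    · simp
    · simp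
  refine (Fintype.sum_equiv (Equiv.mulRight ρ) _ _ fun σ => ?_).symm
  rw [Equiv.coe_mulRight, Equiv.Perm.sign_mul, hs, mul_one]
  simp only [Equiv.Perm.mul_apply, h1, h2]
  rw [mul_comm (b _)]
  congr 3
  ext1 i
  fin_cases i <;> rfl

/-- The shuffle formula for the wedge product with a `2`-form. -/
theorem two_mul_wedge_two {k : ℕ} (a : Alt z k) (b : Alt z 2) (v : Fin (k + 2) → T z) :
    2 * wedge a b v = ∑ i : Fin (k + 2), ∑ j : Fin (k + 1), (-1 : ℂ) ^ ((i : ℕ) + j) *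
      (b ![v i, v (i.succAbove j)] * a (fun m => v (i.succAbove (j.succAbove m)))) := by
  -- the right hand side is an alternating map `E`
  let f : T z →ₗ[ℝ] T z →ₗ[ℝ] Alt z k := LinearMap.mk₂ ℝ (fun x y => b ![x, y] • a)
    (fun x x' y => by rw [alt_two_add_left, add_smul])
    (fun c x y => by rw [alt_two_smul_left, ← Complex.real_smul, smul_assoc])
    (fun x y y' => by rw [alt_two_add_right, add_smul])
    (fun c x y => by rw [alt_two_smul_right, ← Complex.real_smul, smul_assoc])
  let E : Alt z (k + 2) := AlternatingMap.alternatizeUncurryFin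
    (AlternatingMap.alternatizeUncurryFinLM ∘ₗ f)
  have hE : ∀ v, E v = ∑ i : Fin (k + 2), ∑ j : Fin (k + 1), (-1 : ℂ) ^ ((i : ℕ) + j) *
      (b ![v i, v (i.succAbove j)] * a (fun m => v (i.succAbove (j.succAbove m)))) := by
    intro v
    rw [AlternatingMap.alternatizeUncurryFin_apply]
    refine Finset.sum_congr rfl fun i _ => ?_
    change (-1) ^ (i : ℕ) • (AlternatingMap.alternatizeUncurryFin (f (v i))) (i.removeNth v) = _
    rw [AlternatingMap.alternatizeUncurryFin_apply, Finset.smul_sum]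
    refine Finset.sum_congr rfl fun j _ => ?_
    change (-1) ^ (i : ℕ) • (-1) ^ (j : ℕ) • (b ![v i, v (i.succAbove j)] *
      a (fun m => v (i.succAbove (j.succAbove m)))) = _
    simp [pow_add, mul_assoc]
  rw [← hE]
  -- average over all permutations of the arguments
  have h1 : (((k + 2).factorial : ℕ) : ℂ) * E v =
      ∑ σ : Equiv.Perm (Fin (k + 2)), (Equiv.Perm.sign σ : ℤ) * E (fun i => v (σ i)) := by
    have : ∀ σ : Equiv.Perm (Fin (k + 2)),
        ((Equiv.Perm.sign σ : ℤ) : ℂ) * E (fun i => v (σ i)) = E v := by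
      intro σ
      have h := E.map_perm v σ
      change E (fun i => v (σ i)) = _ at h
      rw [h, Units.smul_def, zsmul_eq_mul, ← mul_assoc, ← Int.cast_mul]
      simp
    rw [Finset.sum_congr rfl fun σ _ => this σ]
    simp [Fintype.card_perm]
  have h2 : (((k + 2).factorial : ℕ) : ℂ) * E v =
      ∑ i : Fin (k + 2), ∑ j : Fin (k + 1), ((k.factorial * 2 : ℕ) : ℂ) * wedge a b v := by
    rw [h1]
    simp only [hE, Finset.mul_sum]
    rw [Finset.sum_comm]
    refine Finset.sum_congr rfl fun i _ => ?_
    rw [Finset.sum_comm]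
    refine Finset.sum_congr rfl fun j _ => ?_
    obtain ⟨ρ, h0, h1, hm, hs⟩ := exists_perm_pair i j
    rw [factorial_mul_wedge_two]
    refine Fintype.sum_equiv (Equiv.mulRight ρ) _ _ fun σ => ?_
    rw [Equiv.coe_mulRight, Equiv.Perm.sign_mul, hs]
    simp only [Equiv.Perm.mul_apply, h0, h1, hm]
    push_cast
    ring
  have h3 : (((k + 2).factorial : ℕ) : ℂ) ≠ 0 := by exact_mod_cast Nat.factorial_ne_zero _
  refine mul_left_cancel₀ h3 ?_
  rw [h2]
  simp [Nat.factorial_succ]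
  ring

/-- Wedging with a `2`-form on the left vanishes when it does on the right. -/
theorem wedge_two_left_eq_zero {l : ℕ} (a : Alt z 2) (b : Alt z l) (h : wedge b a = 0) :
    wedge a b = 0 := by
  ext v
  have h1 := factorial_mul_wedge a b v
  have hn : ((Nat.factorial 2 * l.factorial : ℕ) : ℂ) ≠ 0 := by
    exact_mod_cast mul_ne_zero (Nat.factorial_ne_zero _) (Nat.factorial_ne_zero _)
  refine (mul_eq_zero.1 ?_).resolve_left hn
  rw [h1]
  have h2 := factorial_mul_wedge_two b a (fun i => v (Fin.cast (add_comm l 2) i))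
  rw [h] at h2
  rw [AlternatingMap.zero_apply, mul_zero] at h2
  rw [h2]
  refine Fintype.sum_equiv (Equiv.permCongr (finCongr (add_comm 2 l))) _ _ fun σ => ?_
  rw [Equiv.Perm.sign_permCongr]
  simp only [Equiv.permCongr_apply]
  congr 2
  · congr 1
    ext i
    fin_cases i <;> rfl
  · congr 1
    ext1 i
    refine congrArg v (Fin.ext ?_)
    simp only [finCongr_symm, finCongr_apply, Fin.val_cast]
    refine congrArg (fun m => ((σ m : Fin (2 + l)) : ℕ)) (Fin.ext ?_)
    simp
    omega

theorem wedge_one_one (a b : Alt z 1) (u v : T z) :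
    wedge a b ![u, v] = a ![u] * b ![v] - a ![v] * b ![u] := by
  have h := factorial_mul_wedge a b ![u, v]
  simp only [Nat.factorial_one, mul_one, Nat.cast_one, one_mul] at h
  rw [h]
  change ∑ σ : Equiv.Perm (Fin 2), _ = _
  rw [show (Finset.univ : Finset (Equiv.Perm (Fin 2))) = {1, Equiv.swap 0 1} by decide]
  rw [Finset.sum_pair (by decide), Equiv.Perm.sign_swap (by decide)]
  simp only [Equiv.Perm.sign_one, Equiv.Perm.one_apply, Units.val_one, Int.cast_one, one_mul,
    Units.val_neg, Int.cast_neg, neg_mul, ← sub_eq_add_neg]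
  congr 2
  all_goals
    congr 1
    ext1 i
    fin_cases i
    rfl

end Wedge

/-! ### Forms evaluated on a unitary frame -/

/-- The coefficients of the standard Kähler form `f¹² + f³⁴ + f⁵⁶ + f⁷⁸` (indices from `0`). -/
def stdOm (i j : Fin 8) : ℤ :=
  if (i : ℕ) / 2 = j / 2 then (if i < j then 1 else if j < i then -1 else 0) else 0

/-- The coefficients of `f¹²` (indices from `0`). -/
def stdRho (i j : Fin 8) : ℤ :=
  if i = 0 ∧ j = 1 then 1 else if i = 1 ∧ j = 0 then -1 else 0

/-- The coefficients of twice the wedge product of a `k`-form with coefficients `A` and a `2`-form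
with coefficients `B`. The zero entries of `B` are skipped so that the kernel evaluates it fast. -/
def shuffle {k : ℕ} (A : (Fin k → Fin 8) → ℤ) (B : Fin 8 → Fin 8 → ℤ)
    (s : Fin (k + 2) → Fin 8) : ℤ :=
  ∑ i : Fin (k + 2), ∑ j : Fin (k + 1), (-1) ^ ((i : ℕ) + j) *
    (if B (s i) (s (i.succAbove j)) = 0 then 0 else
      B (s i) (s (i.succAbove j)) * A (fun m => s (i.succAbove (j.succAbove m))))

theorem shuffle_eq {k : ℕ} (A : (Fin k → Fin 8) → ℤ) (B : Fin 8 → Fin 8 → ℤ)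
    (s : Fin (k + 2) → Fin 8) : shuffle A B s =
      ∑ i : Fin (k + 2), ∑ j : Fin (k + 1), (-1) ^ ((i : ℕ) + j) *
        (B (s i) (s (i.succAbove j)) * A (fun m => s (i.succAbove (j.succAbove m)))) := by
  refine Finset.sum_congr rfl fun i _ => Finset.sum_congr rfl fun j _ => ?_
  split_ifs with h
  · simp [h]
  · rfl

/-- The coefficients of `2ω²`. -/
def stdOm2 : (Fin 4 → Fin 8) → ℤ := shuffle (k := 2) (fun s => stdOm (s 0) (s 1)) stdOm

/-- The coefficients of `4ω³`. -/
def stdOm3 : (Fin 6 → Fin 8) → ℤ := shuffle (k := 4) stdOm2 stdOm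

/-- The coefficients of `4ω² ∧ f¹²`. -/
def stdOm2Rho : (Fin 6 → Fin 8) → ℤ := shuffle (k := 4) stdOm2 stdRho

/-- The increasing enumeration of the indices other than `i` and `i.succAbove j`. -/
def others (i : Fin 8) (j : Fin 7) : Fin 6 → Fin 8 := fun m => i.succAbove (j.succAbove m)

/-- In coefficients: `ω³ = 6 ⋆ω`. -/
theorem stdOm3_others : ∀ (i : Fin 8) (j : Fin 7),
    (-1) ^ ((i : ℕ) + j) * stdOm3 (others i j) = 24 * stdOm i (i.succAbove j) := by
  decide +kernel

/-- In coefficients: `ω² ∧ f¹² = 2 ⋆(ω - f¹²)`. -/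
theorem stdOm2Rho_others : ∀ (i : Fin 8) (j : Fin 7),
    (-1) ^ ((i : ℕ) + j) * stdOm2Rho (others i j) =
      8 * (stdOm i (i.succAbove j) - stdRho i (i.succAbove j)) := by
  decide +kernel

section Wedge

variable {z : M}

theorem two_mul_wedge_frame {k : ℕ} {f : Fin 8 → T z} {a : Alt z k} {b : Alt z 2} {c x y : ℂ}
    {A : (Fin k → Fin 8) → ℤ} {B B' : Fin 8 → Fin 8 → ℤ}
    (ha : ∀ s : Fin k → Fin 8, a (fun i => f (s i)) = c * A s)
    (hb : ∀ i j, b ![f i, f j] = x * B i j + y * B' i j) (s : Fin (k + 2) → Fin 8) :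
    2 * wedge a b (fun i => f (s i)) = c * (x * shuffle A B s + y * shuffle A B' s) := by
  rw [two_mul_wedge_two, shuffle_eq, shuffle_eq]
  push_cast
  simp only [Finset.mul_sum, ← Finset.sum_add_distrib]
  refine Finset.sum_congr rfl fun i _ => Finset.sum_congr rfl fun j _ => ?_
  rw [hb, ha (fun m => s (i.succAbove (j.succAbove m)))]
  ring

theorem wedge_add_left {k l : ℕ} (a a' : Alt z k) (b : Alt z l) :
    wedge (a + a') b = wedge a b + wedge a' b := by
  have h : (a + a').domCoprod b = a.domCoprod b + a'.domCoprod b := by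
    have := map_add (AlternatingMap.domCoprod' (R' := ℝ) (ιa := Fin k) (ιb := Fin l)
      (Mᵢ := T z) (N₁ := ℂ) (N₂ := ℂ)) (a ⊗ₜ b) (a' ⊗ₜ b)
    rwa [← TensorProduct.add_tmul] at this
  ext v
  simp [wedge, h]

theorem wedge_smul_left {k l : ℕ} (c : ℝ) (a : Alt z k) (b : Alt z l) :
    wedge (c • a) b = c • wedge a b := by
  have h : (c • a).domCoprod b = c • a.domCoprod b := by
    have := map_smul (AlternatingMap.domCoprod' (R' := ℝ) (ιa := Fin k) (ιb := Fin l)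
      (Mᵢ := T z) (N₁ := ℂ) (N₂ := ℂ)) c (a ⊗ₜ b)
    rwa [TensorProduct.smul_tmul'] at this
  ext v
  simp [wedge, h]

/-- `8`-forms on `M` are determined by their value on a basis. -/
theorem topForm_mul (b : Module.Basis (Fin 8) ℝ (T z)) (α β : Alt z 8) (e : Fin 8 → T z) :
    β b * α e = α b * β e := by
  have h : β b • α = α b • β := by
    refine Module.Basis.ext_alternating b fun s hs => ?_
    let σ : Equiv.Perm (Fin 8) := Equiv.ofBijective s (Finite.injective_iff_bijective.1 hs)
    have h1 := α.map_perm b σ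
    have h2 := β.map_perm b σ
    change α (fun i => b (s i)) = _ at h1
    change β (fun i => b (s i)) = _ at h2
    simp only [AlternatingMap.smul_apply]
    rw [h1, h2, smul_eq_mul, smul_eq_mul, mul_smul_comm, mul_smul_comm, mul_comm]
  simpa using congrArg (fun α : Alt z 8 => α e) h

end Wedge

/-! ### Unitary frames and the Hodge star -/

/-- The index of `±J fᵢ` in a unitary frame `f₁, Jf₁, f₃, Jf₃, …`. -/
def jIndex : Fin 8 → Fin 8 := ![1, 0, 3, 2, 5, 4, 7, 6]

/-- The sign in `J fᵢ = ± f_{jIndex i}`. -/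
def jSign : Fin 8 → ℤ := ![1, -1, 1, -1, 1, -1, 1, -1]

/-- A unitary basis `f₁, Jf₁, f₃, Jf₃, …` of the tangent space, normalised by the Kähler form. -/
structure IsUnitary {z : M} (b : Module.Basis (Fin 8) ℝ (T z)) : Prop where
  kahler : ∀ i j, kahler z ![b i, b j] = stdOm i j
  J : ∀ i, J z (b i) = (jSign i : ℝ) • b (jIndex i)

section Metric

variable {z : M}

theorem metric_add_left (u u' v : T z) : metric z (u + u') v = metric z u v + metric z u' v := by
  simp [metric, alt_two_add_left]

theorem metric_smul_left (c : ℝ) (u v : T z) : metric z (c • u) v = c * metric z u v := by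
  simp [metric, alt_two_smul_left]

theorem metric_add_right (u v v' : T z) : metric z u (v + v') = metric z u v + metric z u v' := by
  simp [metric, alt_two_add_right]

theorem metric_smul_right (c : ℝ) (u v : T z) : metric z u (c • v) = c * metric z u v := by
  simp [metric, alt_two_smul_right]

/-- The `1`-form `g(u, ·)`. -/
def flat (u : T z) : Alt z 1 :=
  AlternatingMap.ofSubsingleton ℝ (T z) ℂ (0 : Fin 1)
    { toFun := fun v => (metric z u v : ℂ)
      map_add' := by intro v v'; rw [metric_add_right, Complex.ofReal_add]
      map_smul' := by intro c v; rw [metric_smul_right]; simp }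

theorem IsUnitary.metric {b : Module.Basis (Fin 8) ℝ (T z)} (hb : IsUnitary b) (i j : Fin 8) :
    metric z (b i) (b j) = if i = j then 1 else 0 := by
  have h : ∀ i j, jSign j * stdOm i (jIndex j) = if i = j then 1 else 0 := by decide
  rw [Stenzel.metric, hb.J, alt_two_smul_right, hb.kahler]
  have := congrArg (fun n : ℤ => (n : ℝ)) (h i j)
  push_cast at this
  rw [← this]
  simp

theorem IsUnitary.repr {b : Module.Basis (Fin 8) ℝ (T z)} (hb : IsUnitary b) (u : T z) (i : Fin 8) :
    Stenzel.metric z u (b i) = b.repr u i := by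
  let L : T z →ₗ[ℝ] ℝ :=
    { toFun := fun u => Stenzel.metric z u (b i)
      map_add' := fun u u' => metric_add_left _ _ _
      map_smul' := fun c u => metric_smul_left _ _ _ }
  have : L = b.coord i := by
    refine b.ext fun j => ?_
    simp [L, hb.metric, Finsupp.single_apply]
  exact congrArg (fun L : T z →ₗ[ℝ] ℝ => L u) this

/-- A `2`-form in terms of its coefficients in a unitary basis. -/
theorem IsUnitary.sum_two {b : Module.Basis (Fin 8) ℝ (T z)} (hb : IsUnitary b) (ψ : Alt z 2)
    (u v : T z) : ψ ![u, v] = ∑ i, ∑ j,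
      (Stenzel.metric z u (b i) : ℂ) * Stenzel.metric z v (b j) * ψ ![b i, b j] := by
  let L (v : T z) : T z →ₗ[ℝ] ℂ :=
    { toFun := fun u => ψ ![u, v]
      map_add' := fun u u' => alt_two_add_left _ _ _ _
      map_smul' := fun c u => by simpa using alt_two_smul_left _ _ _ _ }
  let R (u : T z) : T z →ₗ[ℝ] ℂ :=
    { toFun := fun v => ψ ![u, v]
      map_add' := fun v v' => alt_two_add_right _ _ _ _
      map_smul' := fun c v => by simpa using alt_two_smul_right _ _ _ _ }
  have hR : ∀ u, ψ ![u, v] = ∑ j, (Stenzel.metric z v (b j) : ℂ) * ψ ![u, b j] := by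
    intro u
    change R u v = _
    conv_lhs => rw [← b.sum_repr v]
    rw [map_sum]
    simp only [map_smul, hb.repr, Complex.real_smul]
    rfl
  have hL : ∀ j, ψ ![u, b j] = ∑ i, (Stenzel.metric z u (b i) : ℂ) * ψ ![b i, b j] := by
    intro j
    change L (b j) u = _
    conv_lhs => rw [← b.sum_repr u]
    rw [map_sum]
    simp only [map_smul, hb.repr, Complex.real_smul]
    rfl
  rw [hR, Finset.sum_comm]
  refine Finset.sum_congr rfl fun j _ => ?_
  rw [hL, Finset.mul_sum]
  refine Finset.sum_congr rfl fun i _ => ?_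
  ring

theorem sum_succAbove_of_diag {n : ℕ} {R : Type*} [AddCommMonoid R] (F : Fin (n + 1) → Fin (n + 1) → R)
    (h : ∀ i, F i i = 0) : ∑ i, ∑ j : Fin n, F i (i.succAbove j) = ∑ i, ∑ j, F i j := by
  refine Finset.sum_congr rfl fun i _ => ?_
  rw [Fin.sum_univ_succAbove _ i, h, zero_add]

theorem alt_two_self (ψ : Alt z 2) (u : T z) : ψ ![u, u] = 0 :=
  ψ.map_eq_zero_of_eq ![u, u] (i := 0) (j := 1) rfl (by decide)

theorem alt_two_swap (ψ : Alt z 2) (u v : T z) : ψ ![u, v] = -ψ ![v, u] := by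
  have h := alt_two_self ψ (u + v)
  rw [alt_two_add_left, alt_two_add_right, alt_two_add_right, alt_two_self, alt_two_self] at h
  linear_combination h

/-- The Hodge star of a `2`-form can be checked on the coefficients in one unitary basis. For an
orthonormal frame `e`, both sides are the coefficient of `g(e₁, ·) ∧ g(e₂, ·) ∧ χ` relative to the
volume form, which does not depend on the basis used to compute it. -/
theorem IsUnitary.isHodgeStar {b : Module.Basis (Fin 8) ℝ (T z)} (hb : IsUnitary b)
    (hvol : vol z b = 1) {ψ : Alt z 2} {χ : Alt z 6}
    (h : ∀ (i : Fin 8) (j : Fin 7), (-1 : ℂ) ^ ((i : ℕ) + j) * χ (fun m => b (others i j m)) =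
      ψ ![b i, b (i.succAbove j)]) :
    IsHodgeStar (k := 2) (l := 6) rfl ψ χ := by
  intro e he
  let φ : Alt z 2 := wedge (flat (e 0)) (flat (e 1))
  have hφ : ∀ u v, φ ![u, v] = Stenzel.metric z (e 0) u * Stenzel.metric z (e 1) v -
      Stenzel.metric z (e 0) v * Stenzel.metric z (e 1) u := by
    intro u v
    exact wedge_one_one _ _ _ _
  have h1 : 2 * wedge χ φ b = 2 * ψ ![e 0, e 1] := by
    have h2 : 2 * wedge χ φ b =
        ∑ i, ∑ j : Fin 7, φ ![b i, b (i.succAbove j)] * ψ ![b i, b (i.succAbove j)] := by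
      rw [two_mul_wedge_two]
      refine Finset.sum_congr rfl fun i _ => Finset.sum_congr rfl fun j _ => ?_
      rw [← h i j]
      change _ * (_ * χ (fun m => b (others i j m))) = _
      ring
    rw [h2, sum_succAbove_of_diag (fun i j => φ ![b i, b j] * ψ ![b i, b j])
      (fun i => by rw [alt_two_self, zero_mul])]
    rw [two_mul]
    conv_rhs => rw [hb.sum_two ψ (e 0) (e 1)]
    conv_rhs =>
      enter [2]
      rw [Finset.sum_comm]
    rw [← Finset.sum_add_distrib]
    refine Finset.sum_congr rfl fun i _ => ?_
    rw [← Finset.sum_add_distrib]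
    refine Finset.sum_congr rfl fun j _ => ?_
    rw [hφ, alt_two_swap ψ (b j) (b i)]
    ring
  have h3 : 2 * wedge χ φ e = 2 * χ (fun m => e m.succ.succ) := by
    rw [two_mul_wedge_two]
    have h4 : ∀ i j, φ ![e i, e j] = stdRho i j := by
      intro i j
      rw [hφ, he, he, he, he]
      revert i j
      have : ∀ i j : Fin 8, ((if 0 = i then 1 else 0) * (if 1 = j then 1 else 0) -
        (if 0 = j then 1 else 0) * (if 1 = i then 1 else 0) : ℤ) = stdRho i j := by decide
      intro i j
      rw [← this]
      split_ifs <;> simp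
    have h5 : ∀ (i : Fin 8) (j : Fin 7),
        (j = 0 ∧ (i = 0 ∨ i = 1)) ∨ stdRho i (i.succAbove j) = 0 := by decide
    have h6 : ∀ (i : Fin 8) (j : Fin 7), (-1 : ℂ) ^ ((i : ℕ) + j) *
        (φ ![e i, e (i.succAbove j)] * χ (fun m => e (i.succAbove (j.succAbove m)))) =
        if j = 0 then (if i = 0 ∨ i = 1 then χ (fun m => e m.succ.succ) else 0) else 0 := by
      intro i j
      rw [h4]
      rcases h5 i j with ⟨rfl, rfl | rfl⟩ | h
      · simp [stdRho]
      · have : ∀ m : Fin 6, (1 : Fin 8).succAbove m.succ = m.succ.succ := by decide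
        simp [stdRho, this]
      · have : ¬ (j = 0 ∧ (i = 0 ∨ i = 1)) := by
          revert h; revert i j; decide
        rw [h]
        split_ifs with h7 h8
        · exact absurd ⟨h7, h8⟩ this
        all_goals simp
    simp only [h6, Finset.sum_ite_eq', Finset.mem_univ, if_true]
    simp [Fin.sum_univ_eight]
    ring
  have h5 := topForm_mul b (wedge χ φ) (vol z) e
  rw [hvol, one_mul, mul_left_cancel₀ two_ne_zero h3, mul_left_cancel₀ two_ne_zero h1] at h5
  have h6 : (fun i : Fin 2 => e (Fin.cast (rfl : 2 + 6 = 8) (Fin.castAdd 6 i))) = ![e 0, e 1] := by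
    ext1 i; fin_cases i <;> rfl
  have h7 : (fun i : Fin 6 => e (Fin.cast (rfl : 2 + 6 = 8) (Fin.natAdd 2 i))) =
      fun m => e m.succ.succ := by
    ext1 i; congr 1; ext; simp; omega
  rw [h6, h7, h5, mul_comm]

end Metric

/-! ### The instanton equations in a unitary frame -/

section Instanton

variable {z : M} {b : Module.Basis (Fin 8) ℝ (T z)}

theorem alt_two_apply (a : Alt z 2) (v : Fin 2 → T z) : a v = a ![v 0, v 1] := by
  congr 1; ext1 i; fin_cases i <;> rfl

theorem two_mul_wedge_others (χ : Alt z 6) (F : Alt z 2) : 2 * wedge χ F b =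
    ∑ i : Fin 8, ∑ j : Fin 7, (-1 : ℂ) ^ ((i : ℕ) + j) *
      (F ![b i, b (i.succAbove j)] * χ (fun m => b (others i j m))) :=
  two_mul_wedge_two χ F b

theorem IsHodgeStar.apply_others {ψ : Alt z 2} {χ : Alt z 6}
    (h : IsHodgeStar (k := 2) (l := 6) rfl ψ χ) {e : Fin 8 → T z}
    (he : ∀ i j, metric z (e i) (e j) = if i = j then 1 else 0) :
    χ (fun m => e (others 0 0 m)) = Stenzel.vol z e * ψ ![e 0, e 1] := by
  have h1 := h e he
  have h2 : (fun i : Fin 6 => e (Fin.cast (rfl : 2 + 6 = 8) (Fin.natAdd 2 i))) =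
      fun m => e (others 0 0 m) := by
    ext1 i; fin_cases i <;> rfl
  rw [alt_two_apply, h2] at h1
  exact h1

theorem IsUnitary.kahler_sq (hb : IsUnitary b) (s : Fin 4 → Fin 8) :
    wedge (Stenzel.kahler z) (Stenzel.kahler z) (fun i => b (s i)) = (1 / 2 : ℂ) * stdOm2 s := by
  have h := two_mul_wedge_frame (f := b) (a := Stenzel.kahler z) (b := Stenzel.kahler z) (c := 1)
    (x := 1) (y := 0) (A := fun s => stdOm (s 0) (s 1)) (B := stdOm) (B' := stdOm)
    (fun s => by rw [alt_two_apply, hb.kahler, one_mul]) (fun i j => by simp [hb.kahler]) s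
  rw [stdOm2]
  linear_combination h / 2

theorem IsUnitary.kahler_cube (hb : IsUnitary b) (s : Fin 6 → Fin 8) :
    wedge (wedge (Stenzel.kahler z) (Stenzel.kahler z)) (Stenzel.kahler z) (fun i => b (s i)) =
      (1 / 4 : ℂ) * stdOm3 s := by
  have h := two_mul_wedge_frame (f := b) (b := Stenzel.kahler z) (x := 1) (y := 0) (B := stdOm) (B' := stdOm)
    hb.kahler_sq (fun i j => by simp [hb.kahler]) s
  rw [stdOm3]
  linear_combination h / 2

theorem sum_stdOm_mul_stdOm :
    ∑ i : Fin 8, ∑ j : Fin 7, stdOm i (i.succAbove j) * stdOm i (i.succAbove j) = 8 := by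
  decide

theorem sum_stdRho_mul_stdOm :
    ∑ i : Fin 8, ∑ j : Fin 7, stdRho i (i.succAbove j) * stdOm i (i.succAbove j) = 2 := by
  decide

/-- `ω³ ∧ F` for a `2`-form `F` that is diagonal in a unitary frame. -/
theorem IsUnitary.wedge_kahler_cube (hb : IsUnitary b) {F : Alt z 2} {x y : ℂ}
    (hF : ∀ i j, F ![b i, b j] = x * stdOm i j + y * stdRho i j) :
    wedge (wedge (wedge (Stenzel.kahler z) (Stenzel.kahler z)) (Stenzel.kahler z)) F b =
      6 * (4 * x + y) := by
  have h : 2 * wedge (wedge (wedge (Stenzel.kahler z) (Stenzel.kahler z)) (Stenzel.kahler z)) F b =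
      6 * (x * (∑ i : Fin 8, ∑ j : Fin 7, stdOm i (i.succAbove j) * stdOm i (i.succAbove j) : ℤ) +
        y * (∑ i : Fin 8, ∑ j : Fin 7, stdRho i (i.succAbove j) * stdOm i (i.succAbove j) : ℤ)) := by
    rw [two_mul_wedge_others]
    push_cast
    simp only [Finset.mul_sum, ← Finset.sum_add_distrib]
    refine Finset.sum_congr rfl fun i _ => Finset.sum_congr rfl fun j _ => ?_
    have h1 := hb.kahler_cube (others i j)
    have h2 := congrArg (fun n : ℤ => (n : ℂ)) (stdOm3_others i j)
    push_cast at h2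
    rw [h1, hF]
    linear_combination (x * stdOm i (i.succAbove j) + y * stdRho i (i.succAbove j)) / 4 * h2
  rw [sum_stdOm_mul_stdOm, sum_stdRho_mul_stdOm] at h
  push_cast at h
  linear_combination h / 2

theorem IsUnitary.vol (hb : IsUnitary b) : Stenzel.vol z b = 1 := by
  have h := hb.wedge_kahler_cube (F := Stenzel.kahler z) (x := 1) (y := 0)
    (fun i j => by simp [hb.kahler])
  rw [Stenzel.vol, AlternatingMap.smul_apply, h, Complex.real_smul]
  norm_num

/-- A `4`-form that vanishes on pairs `fᵢ, Jfᵢ` has zero wedge product with a `2`-form that only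
pairs such vectors: six distinct vectors of the frame contain two such pairs. -/
theorem wedge_eq_zero_of_pairs {a : Alt z 4} {F : Alt z 2}
    (ha : ∀ s : Fin 4 → Fin 8, ∀ k l, k ≠ l → (s k : ℕ) / 2 = (s l : ℕ) / 2 →
      a (fun m => b (s m)) = 0)
    (hF : ∀ i j : Fin 8, (i : ℕ) / 2 ≠ (j : ℕ) / 2 → F ![b i, b j] = 0) :
    wedge a F = 0 := by
  refine Module.Basis.ext_alternating b fun s hs => ?_
  rw [AlternatingMap.zero_apply]
  refine (mul_eq_zero.1 ?_).resolve_left (two_ne_zero (α := ℂ))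
  rw [two_mul_wedge_two (k := 4)]
  refine Finset.sum_eq_zero fun i _ => Finset.sum_eq_zero fun j _ => ?_
  by_cases hij : (s i : ℕ) / 2 = (s (i.succAbove j) : ℕ) / 2
  · -- the remaining four vectors lie in the other three planes
    have hr : ∀ i j : Fin 8, i ≠ j → (i : ℕ) / 2 = (j : ℕ) / 2 →
        ∀ k, k ≠ i → k ≠ j → (k : ℕ) / 2 ∈ (Finset.range 4).erase ((i : ℕ) / 2) := by decide
    have hmem : ∀ m : Fin 4, (s (i.succAbove (j.succAbove m)) : ℕ) / 2 ∈
        (Finset.range 4).erase ((s i : ℕ) / 2) := fun m =>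
      hr _ _ (fun h => Fin.succAbove_ne i j (hs h).symm) hij _
        (fun h => Fin.succAbove_ne i _ (hs h))
        (fun h => Fin.succAbove_ne j m (Fin.succAbove_right_injective (hs h)))
    have hi : (s i : ℕ) / 2 ∈ Finset.range 4 := by
      have := (s i).2
      rw [Finset.mem_range]; omega
    obtain ⟨k, -, l, -, hkl, h⟩ := Finset.exists_ne_map_eq_of_card_lt_of_maps_to
      (s := (Finset.univ : Finset (Fin 4))) (t := (Finset.range 4).erase ((s i : ℕ) / 2))
      (by rw [Finset.card_erase_of_mem hi]; simp) (fun m _ => hmem m)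
    rw [ha (fun m => s (i.succAbove (j.succAbove m))) k l hkl h, mul_zero, mul_zero]
  · rw [hF _ _ hij, zero_mul, mul_zero]

/-- The holomorphic volume form is complex multilinear, so it vanishes on pairs `fᵢ, Jfᵢ`. -/
theorem IsUnitary.Omega_pair (hb : IsUnitary b) (s : Fin 4 → Fin 8) (k l : Fin 4) (hkl : k ≠ l)
    (h : (s k : ℕ) / 2 = (s l : ℕ) / 2) : Omega z (fun m => b (s m)) = 0 := by
  by_cases hs : s k = s l
  · exact (Omega z).map_eq_zero_of_eq _ (congrArg b hs) hkl
  have h1 : ∀ i j : Fin 8, i ≠ j → (i : ℕ) / 2 = (j : ℕ) / 2 → jIndex i = j := by decide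
  have h2 : ∀ i : Fin 8, jSign i * jSign i = 1 := by decide
  have h3 := hb.J (s k)
  rw [h1 _ _ hs h] at h3
  have h4 : (b (s l)).1 = ((jSign (s k) : ℂ) * Complex.I) • (b (s k)).1 := by
    have h5 := congrArg (fun u : T z => (jSign (s k) : ℝ) • u.1) h3
    have h6 : ((jSign (s k) : ℝ) * (jSign (s k) : ℝ)) = 1 := by exact_mod_cast h2 (s k)
    simp only [Submodule.coe_smul, smul_smul, h6, one_smul] at h5
    have h6 : (Stenzel.J z (b (s k))).1 = Complex.I • (b (s k)).1 := rfl
    rw [← h5, h6]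
    ext m
    simp [mul_assoc]
  rw [Omega_apply]
  set N : Matrix (Fin 5) (Fin 5) ℂ :=
    Matrix.of (Fin.cons z.1 (fun a => (b (s a)).1) : Fin 5 → Amb) with hN
  have h7 : N = N.updateRow l.succ (((jSign (s k) : ℂ) * Complex.I) • N k.succ) := by
    have : ((jSign (s k) : ℂ) * Complex.I) • N k.succ = N l.succ := h4.symm
    rw [this, Matrix.updateRow_eq_self]
  rw [h7, Matrix.det_updateRow_smul, Matrix.det_zero_of_row_eq (i := l.succ) (j := k.succ)
    (fun h => hkl (Fin.succ_injective _ h).symm), mul_zero]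
  rw [Matrix.updateRow_self, Matrix.updateRow_ne (fun h => hkl (Fin.succ_injective _ h))]

theorem diag_pairs {F : Alt z 2} {x y : ℂ}
    (hF : ∀ i j, F ![b i, b j] = x * stdOm i j + y * stdRho i j) (i j : Fin 8)
    (hij : (i : ℕ) / 2 ≠ (j : ℕ) / 2) : F ![b i, b j] = 0 := by
  have h : ∀ i j : Fin 8, (i : ℕ) / 2 ≠ (j : ℕ) / 2 → stdOm i j = 0 ∧ stdRho i j = 0 := by decide
  rw [hF, (h i j hij).1, (h i j hij).2]
  simp

/-- `F ∧ Ω = 0` for a form of type `(1, 1)`. -/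
theorem IsUnitary.wedge_Omega (hb : IsUnitary b) {F : Alt z 2} {x y : ℂ}
    (hF : ∀ i j, F ![b i, b j] = x * stdOm i j + y * stdRho i j) : wedge F (Omega z) = 0 :=
  wedge_two_left_eq_zero _ _ (wedge_eq_zero_of_pairs hb.Omega_pair (diag_pairs hF))

theorem IsUnitary.wedge_cayley (hb : IsUnitary b) {F : Alt z 2} {x y : ℂ}
    (hF : ∀ i j, F ![b i, b j] = x * stdOm i j + y * stdRho i j) (s : Fin 6 → Fin 8) :
    wedge (cayley z) F (fun i => b (s i)) = (1 / 8 : ℂ) * (x * stdOm3 s + y * stdOm2Rho s) := by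
  have h0 : wedge (rePart (Omega z)) F = 0 := by
    refine wedge_eq_zero_of_pairs (b := b) (fun s k l hkl h => ?_) (diag_pairs hF)
    change ((Complex.re (Omega z (fun m => b (s m))) : ℝ) : ℂ) = 0
    rw [hb.Omega_pair s k l hkl h]
    simp
  have h := two_mul_wedge_frame (f := b) hb.kahler_sq hF s
  rw [cayley, wedge_add_left, h0, add_zero, wedge_smul_left, AlternatingMap.smul_apply,
    Complex.real_smul, stdOm3, stdOm2Rho]
  push_cast
  linear_combination h / 4

/-- The `Spin(7)` instanton equation for a `2`-form `F = x ω + y f¹²`. -/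
theorem IsUnitary.isHodgeStar_cayley_iff (hb : IsUnitary b) {F : Alt z 2} {x y : ℂ}
    (hF : ∀ i j, F ![b i, b j] = x * stdOm i j + y * stdRho i j) :
    IsHodgeStar (k := 2) (l := 6) rfl F (-(wedge (cayley z) F)) ↔ y = -4 * x := by
  have hW := hb.wedge_cayley hF
  generalize (wedge (cayley z) F : Alt z 6) = W at hW ⊢
  constructor
  · intro h
    have h1 := h.apply_others hb.metric
    rw [hb.vol, one_mul, AlternatingMap.neg_apply] at h1
    have h2 : stdOm3 (others 0 0) = 24 := by decide
    have h3 : stdOm2Rho (others 0 0) = 0 := by decide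
    rw [hW, hF, h2, h3] at h1
    simp [stdOm, stdRho] at h1
    linear_combination -h1
  · rintro rfl
    refine hb.isHodgeStar hb.vol fun i j => ?_
    rw [AlternatingMap.neg_apply, hW, hF]
    have h1 := congrArg (fun n : ℤ => (n : ℂ)) (stdOm3_others i j)
    have h2 := congrArg (fun n : ℤ => (n : ℂ)) (stdOm2Rho_others i j)
    push_cast at h1 h2
    linear_combination -x / 8 * h1 + x / 2 * h2

/-- `⋆ω = ω³/6`. -/
theorem IsUnitary.isHodgeStar_kahler (hb : IsUnitary b) :
    IsHodgeStar (k := 2) (l := 6) rfl (Stenzel.kahler z) ((1 / 6 : ℝ) •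
      wedge (wedge (Stenzel.kahler z) (Stenzel.kahler z)) (Stenzel.kahler z)) := by
  refine hb.isHodgeStar hb.vol fun i j => ?_
  rw [AlternatingMap.smul_apply, hb.kahler_cube, hb.kahler, Complex.real_smul]
  have h1 := congrArg (fun n : ℤ => (n : ℂ)) (stdOm3_others i j)
  push_cast at h1 ⊢
  linear_combination h1 / 24

/-- `F ∧ ⋆ω = 0` for a `2`-form `F = x (ω - 4 f¹²)`. -/
theorem IsUnitary.wedge_star_kahler (hb : IsUnitary b) {F : Alt z 2} {x : ℂ}
    (hF : ∀ i j, F ![b i, b j] = x * stdOm i j + -4 * x * stdRho i j) :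
    wedge F ((1 / 6 : ℝ) •
      wedge (wedge (Stenzel.kahler z) (Stenzel.kahler z)) (Stenzel.kahler z)) = 0 := by
  refine wedge_two_left_eq_zero _ _ ?_
  rw [wedge_smul_left]
  ext v
  have h := topForm_mul b
    (wedge (wedge (wedge (Stenzel.kahler z) (Stenzel.kahler z)) (Stenzel.kahler z)) F)
    (Stenzel.vol z) v
  rw [hb.vol, hb.wedge_kahler_cube hF] at h
  rw [AlternatingMap.smul_apply, AlternatingMap.zero_apply, ← one_mul
    ((wedge (wedge (wedge (Stenzel.kahler z) (Stenzel.kahler z)) (Stenzel.kahler z)) F) v), h]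
  simp

end Instanton

/-! ### Calculus of `1`-forms on `M` -/

/-- The pairing `∑ Re wⱼ Im vⱼ`. -/
def reIm : Amb →L[ℝ] Amb →L[ℝ] ℂ :=
  ∑ j, (Complex.reCLM ∘L ContinuousLinearMap.proj (R := ℝ) (φ := fun _ : Fin 5 => ℂ) j).smulRight
    (Complex.ofRealCLM ∘L Complex.imCLM ∘L
      ContinuousLinearMap.proj (R := ℝ) (φ := fun _ : Fin 5 => ℂ) j)

theorem reIm_apply (w v : Amb) : reIm w v = ((∑ j, (w j).re * (v j).im : ℝ) : ℂ) := by
  simp [reIm]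

/-- The Euclidean inner product on `ℂ⁵`. -/
def eucl : Amb →L[ℝ] Amb →L[ℝ] ℂ :=
  ∑ j, ((Complex.reCLM ∘L ContinuousLinearMap.proj (R := ℝ) (φ := fun _ : Fin 5 => ℂ) j).smulRight
      (Complex.ofRealCLM ∘L Complex.reCLM ∘L
        ContinuousLinearMap.proj (R := ℝ) (φ := fun _ : Fin 5 => ℂ) j) +
    (Complex.imCLM ∘L ContinuousLinearMap.proj (R := ℝ) (φ := fun _ : Fin 5 => ℂ) j).smulRight
      (Complex.ofRealCLM ∘L Complex.imCLM ∘L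
        ContinuousLinearMap.proj (R := ℝ) (φ := fun _ : Fin 5 => ℂ) j))

theorem eucl_apply (w v : Amb) :
    eucl w v = ((∑ j, ((w j).re * (v j).re + (w j).im * (v j).im) : ℝ) : ℂ) := by
  simp [eucl]

theorem eucl_comm (w v : Amb) : eucl w v = eucl v w := by
  simp only [eucl_apply, mul_comm]

/-- The function `r²` on the ambient space. -/
def normSq (w : Amb) : ℝ := ∑ j, ‖w j‖ ^ 2

theorem one_lt_normSq (z : M) : 1 < normSq z.1 := z.2.2

theorem radius_sq (z : M) : radius z ^ 2 = normSq z.1 :=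
  Real.sq_sqrt (zero_le_one.trans (one_lt_normSq z).le)

theorem one_lt_radius (z : M) : 1 < radius z := by
  have h := one_lt_normSq z
  rw [← radius_sq] at h
  have h0 : 0 ≤ radius z := Real.sqrt_nonneg _
  nlinarith

theorem contDiff_normSq : ContDiff ℝ ∞ normSq := by
  have : normSq = fun w : Amb => ∑ j, ((w j).re ^ 2 + (w j).im ^ 2) := by
    ext w
    refine Finset.sum_congr rfl fun j _ => ?_
    rw [← Complex.normSq_eq_norm_sq, Complex.normSq_apply]
    ring
  rw [this]
  have h1 : ∀ j : Fin 5, ContDiff ℝ ∞ fun w : Amb => (w j).re := fun j =>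
    (Complex.reCLM ∘L ContinuousLinearMap.proj (R := ℝ) (φ := fun _ : Fin 5 => ℂ) j).contDiff
  have h2 : ∀ j : Fin 5, ContDiff ℝ ∞ fun w : Amb => (w j).im := fun j =>
    (Complex.imCLM ∘L ContinuousLinearMap.proj (R := ℝ) (φ := fun _ : Fin 5 => ℂ) j).contDiff
  exact ContDiff.sum fun j _ => ((h1 j).pow 2).add ((h2 j).pow 2)

/-- The derivative of `r²`. -/
def dNormSq (w : Amb) : Amb →L[ℝ] ℝ := Complex.reCLM ∘L ((2 : ℝ) • eucl w)

theorem ofReal_dNormSq (w v : Amb) : (dNormSq w v : ℂ) = 2 * eucl w v := by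
  simp [dNormSq, eucl_apply]

theorem hasFDerivAt_normSq (w : Amb) : HasFDerivAt normSq (dNormSq w) w := by
  have : normSq = fun w : Amb => (eucl w w).re := by
    ext w
    simp only [normSq, ← Complex.normSq_eq_norm_sq, Complex.normSq_apply, eucl_apply,
      Complex.ofReal_re]
  rw [this]
  have h := (eucl.hasFDerivAt (x := w)).clm_apply (hasFDerivAt_id (𝕜 := ℝ) w)
  refine (Complex.reCLM.hasFDerivAt.comp w h).congr_fderiv ?_
  ext v
  simp [dNormSq, eucl_comm v w, two_mul]

/-- The region `r > 1` of the ambient space. -/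
def outer : Set Amb := {w | 1 < normSq w}

theorem isOpen_outer : IsOpen outer := isOpen_lt continuous_const contDiff_normSq.continuous

theorem coe_mem_outer (z : M) : z.1 ∈ outer := one_lt_normSq z

/-- A functional as an alternating form of degree one. -/
def functionalForm : (Amb →L[ℝ] ℂ) →L[ℝ] Amb [⋀^Fin 1]→L[ℝ] ℂ :=
  (ContinuousAlternatingMap.ofSubsingletonLIE (𝕜 := ℝ) (E := Amb) (F := ℂ)
    (0 : Fin 1)).toContinuousLinearEquiv.toContinuousLinearMap

/-- A `1`-form on the ambient space given by its functionals. -/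
def oneForm (L : Amb → Amb →L[ℝ] ℂ) (w : Amb) : Amb [⋀^Fin 1]→L[ℝ] ℂ :=
  functionalForm (L w)

theorem extDeriv_oneForm {L : Amb → Amb →L[ℝ] ℂ} {L' : Amb →L[ℝ] Amb →L[ℝ] ℂ} {w : Amb}
    (h : HasFDerivAt L L' w) (u v : Amb) :
    extDeriv (oneForm L) w ![u, v] = L' u v - L' v u := by
  have h1 : DifferentiableAt ℝ (oneForm L) w :=
    (functionalForm.hasFDerivAt.comp w h).differentiableAt
  have h2 : ∀ c : Fin 1 → Amb, fderiv ℝ (fun x => oneForm L x c) w = L'.flip (c 0) := by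
    intro c
    have h3 : HasFDerivAt (fun x => oneForm L x c) _ w :=
      h.clm_apply (hasFDerivAt_const (c 0) w)
    rw [h3.fderiv]
    ext v
    simp
  rw [extDeriv_apply h1, Fin.sum_univ_two]
  simp only [h2]
  simp [sub_eq_add_neg, Fin.removeNth]

/-- The functional `k(r²) d(r²) + h(r²) ∑ xⱼ dyⱼ`. -/
def radialForm (k h : ℝ → ℂ) (w : Amb) : Amb →L[ℝ] ℂ :=
  (2 * k (normSq w)) • eucl w + h (normSq w) • reIm w

theorem contDiffOn_radialForm {k h : ℝ → ℂ} (hk : ContDiffOn ℝ ∞ k (Ioi 1))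
    (hh : ContDiffOn ℝ ∞ h (Ioi 1)) : ContDiffOn ℝ ∞ (radialForm k h) outer := by
  have h1 : ContDiffOn ℝ ∞ (fun w => k (normSq w)) outer :=
    hk.comp contDiff_normSq.contDiffOn fun w hw => hw
  have h2 : ContDiffOn ℝ ∞ (fun w => h (normSq w)) outer :=
    hh.comp contDiff_normSq.contDiffOn fun w hw => hw
  exact ((contDiffOn_const.mul h1).smul eucl.contDiff.contDiffOn).add
    (h2.smul reIm.contDiff.contDiffOn)

theorem hasFDerivAt_radialForm {k h : ℝ → ℂ} {k' h' : ℂ} {w : Amb}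
    (hk : HasDerivAt k k' (normSq w)) (hh : HasDerivAt h h' (normSq w)) :
    ∃ L' : Amb →L[ℝ] Amb →L[ℝ] ℂ, HasFDerivAt (radialForm k h) L' w ∧ ∀ u v, L' u v =
      4 * k' * (eucl w u * eucl w v) + 2 * k (normSq w) * eucl u v +
        2 * h' * (eucl w u * reIm w v) + h (normSq w) * reIm u v := by
  have hk1 : HasFDerivAt (fun w => 2 * k (normSq w)) _ w :=
    (hk.hasFDerivAt.comp w (hasFDerivAt_normSq w)).const_mul 2
  have hh1 : HasFDerivAt (fun w => h (normSq w)) _ w :=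
    hh.hasFDerivAt.comp w (hasFDerivAt_normSq w)
  have he : HasFDerivAt (fun w => eucl w) eucl w := eucl.hasFDerivAt
  have hr : HasFDerivAt (fun w => reIm w) reIm w := reIm.hasFDerivAt
  refine ⟨_, (hk1.smul he).add (hh1.smul hr), fun u v => ?_⟩
  simp [ofReal_dNormSq]
  ring

/-- `A = k(r²) d(r²) + h(r²) ∑ xⱼ dyⱼ` with smooth `k` and `h`. -/
def IsRadial (A : Form 1) (k h : ℝ → ℂ) : Prop :=
  ContDiffOn ℝ ∞ k (Ioi 1) ∧ ContDiffOn ℝ ∞ h (Ioi 1) ∧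
    ∀ (z : M) (v : T z), A z ![v] =
      2 * k (normSq z.1) * eucl z.1 v.1 + h (normSq z.1) * reIm z.1 v.1

theorem alt_one_ext {z : M} {a b : Alt z 1} (h : ∀ v, a ![v] = b ![v]) : a = b := by
  ext v
  rw [show v = ![v 0] by ext1 i; fin_cases i; rfl]
  exact h _

theorem alt_two_ext {z : M} {a b : Alt z 2} (h : ∀ u v, a ![u, v] = b ![u, v]) : a = b := by
  ext v
  rw [alt_two_apply a, alt_two_apply b]
  exact h _ _

theorem IsRadial.isLocalExtension {A : Form 1} {k h : ℝ → ℂ} (hA : IsRadial A k h) (z : M) :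
    IsLocalExtension A z (oneForm (radialForm k h)) := by
  refine ⟨outer, isOpen_outer, coe_mem_outer z, ?_, fun w _ => ?_⟩
  · exact functionalForm.contDiff.comp_contDiffOn
        (contDiffOn_radialForm hA.1 hA.2.1)
  · refine alt_one_ext fun v => ?_
    rw [hA.2.2]
    change radialForm k h w.1 v.1 = _
    simp [radialForm]

theorem IsRadial.isSmooth {A : Form 1} {k h : ℝ → ℂ} (hA : IsRadial A k h) : IsSmooth A :=
  fun z => ⟨_, hA.isLocalExtension z⟩

/-- The exterior derivative of a radial form; the term `k(r²) d(r²)` is closed. -/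
theorem IsRadial.d_apply {A : Form 1} {k h : ℝ → ℂ} (hA : IsRadial A k h) (z : M) (u v : T z) :
    d A z ![u, v] =
      2 * deriv h (normSq z.1) *
        (eucl z.1 u.1 * reIm z.1 v.1 - eucl z.1 v.1 * reIm z.1 u.1) +
      h (normSq z.1) * (reIm u.1 v.1 - reIm v.1 u.1) := by
  have hd : ∀ {f : ℝ → ℂ}, ContDiffOn ℝ ∞ f (Ioi 1) → HasDerivAt f (deriv f (normSq z.1))
      (normSq z.1) := fun hf =>
    ((hf.contDiffAt (Ioi_mem_nhds (one_lt_normSq z))).differentiableAt (by simp)).hasDerivAt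
  obtain ⟨L', hL, hL'⟩ := hasFDerivAt_radialForm (hd hA.1) (hd hA.2.1)
  rw [d_eq (hA.isLocalExtension z)]
  have h1 : restrict (extDeriv (oneForm (radialForm k h))) z ![u, v] =
      extDeriv (oneForm (radialForm k h)) z.1 ![u.1, v.1] := by
    exact congrArg (extDeriv (oneForm (radialForm k h)) z.1)
      (funext fun i => by fin_cases i <;> rfl)
  rw [h1, extDeriv_oneForm hL, hL', hL', eucl_comm v.1 u.1]
  ring

/-- Tangent vectors satisfy `x · dx = y · dy` and `x · dy = -y · dx`. -/
theorem tangent_re_im (z : M) (v : T z) :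
    ∑ j, (z.1 j).re * (v.1 j).re = ∑ j, (z.1 j).im * (v.1 j).im ∧
    ∑ j, (z.1 j).im * (v.1 j).re = -∑ j, (z.1 j).re * (v.1 j).im := by
  have h := mem_T.1 v.2
  have h1 := congrArg Complex.re h
  have h2 := congrArg Complex.im h
  simp only [Complex.re_sum, Complex.im_sum, Complex.mul_re, Complex.mul_im, Complex.zero_re,
    Complex.zero_im, Finset.sum_sub_distrib, Finset.sum_add_distrib] at h1 h2
  exact ⟨by linarith, by linarith⟩

/-! ### The Kähler form -/

/-- The derivative `𝓕'` of the profile. -/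
def dProfile (s : ℝ) : ℝ :=
  (4 / 3 : ℝ) ^ (1 / 4 : ℝ) * (s + 2) ^ (1 / 4 : ℝ) * (s + 1) ^ (-1 / 2 : ℝ)

theorem dProfile_pos {s : ℝ} (hs : 1 < s) : 0 < dProfile s := by
  have h1 : 0 < s + 2 := by linarith
  have h2 : 0 < s + 1 := by linarith
  unfold dProfile
  positivity

theorem hasDerivAt_dProfile {s : ℝ} (hs : 1 < s) : HasDerivAt dProfile
    (dProfile s * (1 / (4 * (s + 2)) - 1 / (2 * (s + 1)))) s := by
  have h1 : 0 < s + 2 := by linarith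
  have h2 : 0 < s + 1 := by linarith
  have h3 := (((hasDerivAt_id s).add_const 2).rpow_const (p := 1 / 4) (Or.inl h1.ne')).const_mul
    ((4 / 3 : ℝ) ^ (1 / 4 : ℝ))
  have h4 := ((hasDerivAt_id s).add_const 1).rpow_const (p := -1 / 2) (Or.inl h2.ne')
  refine (h3.mul h4).congr_deriv ?_
  simp only [id, dProfile]
  rw [Real.rpow_sub_one h1.ne', Real.rpow_sub_one h2.ne']
  field_simp
  ring

theorem contDiffOn_dProfile : ContDiffOn ℝ ∞ dProfile (Ioi 1) := by
  intro s hs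
  have hs' : 1 < s := hs
  have h1 : s + 2 ≠ 0 := by linarith
  have h2 : s + 1 ≠ 0 := by linarith
  exact ((contDiffAt_const.mul ((contDiffAt_id.add contDiffAt_const).rpow_const_of_ne h1)).mul
    ((contDiffAt_id.add contDiffAt_const).rpow_const_of_ne h2)).contDiffWithinAt

theorem hasDerivAt_profile {s : ℝ} (hs : 1 < s) : HasDerivAt profile (dProfile s) s := by
  have hc : ContinuousOn dProfile (Ioi (-1 / 2)) := by
    intro t ht
    have ht' : -1 / 2 < t := ht
    have h1 : t + 2 ≠ 0 := by linarith
    have h2 : t + 1 ≠ 0 := by linarith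
    refine ContinuousAt.continuousWithinAt ?_
    unfold dProfile
    refine ContinuousAt.mul (ContinuousAt.mul continuousAt_const ?_) ?_
    · exact (continuousAt_id.add continuousAt_const).rpow_const (Or.inl h1)
    · exact (continuousAt_id.add continuousAt_const).rpow_const (Or.inl h2)
  have hsub : uIcc 1 s ⊆ Ioi (-1 / 2) := by
    rw [uIcc_of_le hs.le]
    intro t ht
    have := ht.1
    simp only [mem_Ioi]; linarith
  refine intervalIntegral.integral_hasDerivAt_right (hc.mono hsub).intervalIntegrable ?_ ?_
  · exact hc.stronglyMeasurableAtFilter isOpen_Ioi s (by simp only [mem_Ioi]; linarith)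
  · exact hc.continuousAt (Ioi_mem_nhds (by linarith))

theorem contDiffOn_of_hasDerivAt {F : Type*} [NormedAddCommGroup F] [NormedSpace ℝ F]
    {f f' : ℝ → F} {a : ℝ} (h : ∀ s, a < s → HasDerivAt f (f' s) s)
    (h' : ContDiffOn ℝ ∞ f' (Ioi a)) : ContDiffOn ℝ ∞ f (Ioi a) := by
  rw [contDiffOn_infty_iff_deriv_of_isOpen isOpen_Ioi]
  exact ⟨fun s hs => (h s hs).differentiableAt.differentiableWithinAt,
    h'.congr fun s hs => (h s hs).deriv⟩

/-- The primitive `dᶜ𝓕(r²)/4` of the Kähler form, restricted to `M`. -/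
def kahlerPrimitive : Form 1 := restrict ((1 / 4 : ℝ) • dc fun w => profile (normSq w))

theorem isRadial_kahlerPrimitive :
    IsRadial kahlerPrimitive (fun _ => 0) (fun s => dProfile s) := by
  refine ⟨contDiffOn_const, Complex.ofRealCLM.contDiff.comp_contDiffOn contDiffOn_dProfile,
    fun z v => ?_⟩
  have h1 := (hasDerivAt_profile (one_lt_normSq z)).hasFDerivAt.comp z.1 (hasFDerivAt_normSq z.1)
  have h2 : kahlerPrimitive z ![v] =
      (1 / 4 : ℝ) • (((-(fderiv ℝ (fun w => profile (normSq w)) z.1) (Complex.I • v.1) : ℝ)) : ℂ) :=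
    rfl
  have h3 : fderiv ℝ (fun w => profile (normSq w)) z.1 = _ := h1.fderiv
  rw [h2, h3, reIm_apply]
  simp only [ContinuousLinearMap.comp_apply, dNormSq, _root_.smul_apply, eucl_apply]
  have h4 := (tangent_re_im z v).2
  simp [Finset.sum_add_distrib, Finset.sum_neg_distrib]
  norm_cast
  rw [h4]
  push_cast
  ring

theorem kahler_eq_d : kahler = d kahlerPrimitive := by
  funext z
  have h1 : ContDiffOn ℝ ∞ (fun w => profile (normSq w)) outer :=
    (contDiffOn_of_hasDerivAt (fun s hs => hasDerivAt_profile hs) contDiffOn_dProfile).comp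
      contDiff_normSq.contDiffOn fun w hw => hw
  have h2 : ContDiffOn ℝ ∞ (fun w => fderiv ℝ (fun w => profile (normSq w)) w) outer :=
    h1.fderiv_of_isOpen isOpen_outer (by simp)
  have h3 : ContDiffOn ℝ ∞ (dc fun w => profile (normSq w)) outer := by
    refine functionalForm.contDiff.comp_contDiffOn ?_
    exact contDiffOn_const.clm_comp (h2.neg.clm_comp contDiffOn_const)
  have h4 : IsLocalExtension kahlerPrimitive z ((1 / 4 : ℝ) • dc fun w => profile (normSq w)) :=
    ⟨outer, isOpen_outer, coe_mem_outer z, contDiffOn_const.smul h3, fun w _ => rfl⟩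
  rw [d_eq h4]
  simp only [restrict, extDeriv_smul]
  rfl

/-! ### Invariance under `SO(5)` -/

theorem reIm_rot (g : SO5) (u v : Amb) : reIm (rot g.1 u) (rot g.1 v) = reIm u v := by
  have h := rot_dot g (u + star u) v
  rw [map_add, rot_star] at h
  have h' := congrArg Complex.im h
  simp only [Complex.im_sum] at h'
  rw [reIm_apply, reIm_apply]
  congr 1
  simpa [← two_mul, mul_assoc, ← Finset.mul_sum] using h'

theorem eucl_rot (g : SO5) (u v : Amb) : eucl (rot g.1 u) (rot g.1 v) = eucl u v := by
  have h := rot_dot g (star u) v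
  rw [rot_star] at h
  have h' := congrArg Complex.re h
  simp only [Complex.re_sum] at h'
  rw [eucl_apply, eucl_apply]
  congr 1
  simpa using h'

theorem normSq_rot (g : SO5) (w : Amb) : normSq (rot g.1 w) = normSq w := rot_norm g w

theorem rot_mul (g h : SO5) (v : Amb) : rot (g * h).1 v = rot g.1 (rot h.1 v) := by
  have : ((g * h).1.map Complex.ofReal) = (g.1.map Complex.ofReal) * (h.1.map Complex.ofReal) := by
    have h1 := Matrix.map_mul (L := (g.1 : Matrix (Fin 5) (Fin 5) ℝ))
      (M := (h.1 : Matrix (Fin 5) (Fin 5) ℝ)) (f := Complex.ofRealHom)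
    exact h1
  change Matrix.mulVec ((g * h).1.map Complex.ofReal) v = Matrix.mulVec (g.1.map Complex.ofReal)
    (Matrix.mulVec (h.1.map Complex.ofReal) v)
  rw [this, Matrix.mulVec_mulVec]

theorem rot_one (v : Amb) : rot (1 : SO5).1 v = v := by
  have : ((1 : SO5).1.map Complex.ofReal) = (1 : Matrix (Fin 5) (Fin 5) ℂ) :=
    Matrix.map_one _ Complex.ofReal_zero Complex.ofReal_one
  change Matrix.mulVec _ v = v
  rw [this, Matrix.one_mulVec]

theorem dAct_bijective (g : SO5) (z : M) : Function.Bijective (dAct g z) := by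
  constructor
  · intro u v h
    have h1 : rot g.1 u.1 = rot g.1 v.1 := congrArg Subtype.val h
    have h2 := congrArg (rot (g⁻¹).1) h1
    rw [← rot_mul, ← rot_mul, inv_mul_cancel, rot_one, rot_one] at h2
    exact Subtype.ext h2
  · intro v
    have h1 : rot g.1 (rot (g⁻¹).1 v.1) = v.1 := by rw [← rot_mul, mul_inv_cancel, rot_one]
    refine ⟨⟨rot (g⁻¹).1 v.1, ?_⟩, Subtype.ext h1⟩
    have h2 := mem_T.1 v.2
    rw [mem_T, ← rot_dot g, h1]
    exact h2

/-- The differential of the action as an isomorphism of tangent spaces. -/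
def dActEquiv (g : SO5) (z : M) : T z ≃ₗ[ℝ] T (act g z) :=
  LinearEquiv.ofBijective (dAct g z) (dAct_bijective g z)

theorem IsRadial.isInvariant {A : Form 1} {k h : ℝ → ℂ} (hA : IsRadial A k h) : IsInvariant A := by
  intro g
  funext z
  refine alt_one_ext fun v => ?_
  have h1 : pullback g A z ![v] = A (act g z) ![dAct g z v] := by
    exact congrArg (A (act g z)) (funext fun i => by fin_cases i; rfl)
  rw [h1, hA.2.2, hA.2.2]
  change 2 * k (normSq (rot g.1 z.1)) * eucl (rot g.1 z.1) (rot g.1 v.1) +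
    h (normSq (rot g.1 z.1)) * reIm (rot g.1 z.1) (rot g.1 v.1) = _
  rw [normSq_rot, eucl_rot, reIm_rot]

theorem IsRadial.d_act {A : Form 1} {k h : ℝ → ℂ} (hA : IsRadial A k h) (g : SO5) (z : M)
    (u v : T z) : d A (act g z) ![dActEquiv g z u, dActEquiv g z v] = d A z ![u, v] := by
  rw [hA.d_apply, hA.d_apply]
  change 2 * deriv h (normSq (rot g.1 z.1)) *
    (eucl (rot g.1 z.1) (rot g.1 u.1) * reIm (rot g.1 z.1) (rot g.1 v.1) -
      eucl (rot g.1 z.1) (rot g.1 v.1) * reIm (rot g.1 z.1) (rot g.1 u.1)) +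
    h (normSq (rot g.1 z.1)) * (reIm (rot g.1 u.1) (rot g.1 v.1) -
      reIm (rot g.1 v.1) (rot g.1 u.1)) = _
  simp only [normSq_rot, eucl_rot, reIm_rot]

/-- `SO(5)` acts transitively on the level sets of `r`. -/
theorem exists_eq_act_p (z : M) : ∃ g : SO5, z = act g (p ⟨radius z, one_lt_radius z⟩) := by
  set a := Rp (radius z) with ha
  set b := Rm (radius z) with hb
  have ha0 : 0 < a := Rp_pos _
  have hb0 : 0 < b := Rm_pos (one_lt_radius z)
  have h1 : ∑ j, ((z.1 j).re ^ 2 + (z.1 j).im ^ 2) = radius z ^ 2 := by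
    rw [radius_sq, normSq]
    refine Finset.sum_congr rfl fun j _ => ?_
    rw [← Complex.normSq_eq_norm_sq, Complex.normSq_apply]
    ring
  have hq := z.2.1
  have h2 := congrArg Complex.re hq
  have h3 := congrArg Complex.im hq
  simp only [Complex.re_sum, Complex.im_sum, pow_two, Complex.mul_re, Complex.mul_im,
    Complex.one_re, Complex.one_im, Finset.sum_sub_distrib, Finset.sum_add_distrib] at h1 h2 h3
  have hx : ∑ j, (z.1 j).re * (z.1 j).re = a * a := by
    rw [← pow_two, ha, Rp_sq]; linarith
  have hy : ∑ j, (z.1 j).im * (z.1 j).im = b * b := by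
    rw [← pow_two, hb, Rm_sq (one_lt_radius z)]; linarith
  have hxy : ∑ j, (z.1 j).re * (z.1 j).im = 0 := by
    have : ∑ j, (z.1 j).im * (z.1 j).re = ∑ j, (z.1 j).re * (z.1 j).im :=
      Finset.sum_congr rfl fun j _ => mul_comm _ _
    linarith
  let V : Fin 5 → EuclideanSpace ℝ (Fin 5) := fun i =>
    if i = 0 then WithLp.toLp 2 (fun j => (z.1 j).re / a) else
      WithLp.toLp 2 (fun j => (z.1 j).im / b)
  have hV : Orthonormal ℝ (({0, 1} : Set (Fin 5)).domRestrict V) := by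
    have hin : ∀ (f g : Fin 5 → ℝ), inner ℝ (WithLp.toLp 2 f : EuclideanSpace ℝ (Fin 5))
        (WithLp.toLp 2 g) = ∑ j, f j * g j := by
      intro f g
      simp [PiLp.inner_apply, mul_comm]
    have i1 : ∑ j, (z.1 j).re / a * ((z.1 j).re / a) = 1 := by
      simp only [div_mul_div_comm, ← Finset.sum_div, hx]
      field_simp
    have i2 : ∑ j, (z.1 j).im / b * ((z.1 j).im / b) = 1 := by
      simp only [div_mul_div_comm, ← Finset.sum_div, hy]
      field_simp
    have i3 : ∑ j, (z.1 j).re / a * ((z.1 j).im / b) = 0 := by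
      simp only [div_mul_div_comm, ← Finset.sum_div, hxy, zero_div]
    rw [orthonormal_iff_ite]
    rintro ⟨i, rfl | rfl⟩ ⟨j, rfl | rfl⟩
    · exact (hin _ _).trans (i1.trans (if_pos rfl).symm)
    · exact (hin _ _).trans (i3.trans
        (if_neg fun h => zero_ne_one (α := Fin 5) (congrArg Subtype.val h)).symm)
    · exact (hin _ _).trans ((Finset.sum_congr rfl fun j _ => mul_comm _ _).trans
        (i3.trans
        (if_neg fun h => one_ne_zero (α := Fin 5) (congrArg Subtype.val h)).symm))
    · exact (hin _ _).trans (i2.trans (if_pos rfl).symm)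
  obtain ⟨B, hB⟩ := hV.exists_orthonormalBasis_extension_of_card_eq (by simp)
  let G : Matrix (Fin 5) (Fin 5) ℝ := fun i j => B j i
  have hG : G.transpose * G = 1 := by
    ext i j
    have h := orthonormal_iff_ite.1 B.orthonormal i j
    rw [Matrix.mul_apply, Matrix.one_apply, ← h]
    simp only [PiLp.inner_apply, Matrix.transpose_apply]
    exact Finset.sum_congr rfl fun k _ => mul_comm (B i k) (B j k)
  have hdet : G.det = 1 ∨ G.det = -1 := by
    have h := congrArg Matrix.det hG
    rw [Matrix.det_mul, Matrix.det_transpose, Matrix.det_one] at h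
    exact mul_self_eq_one_iff.1 h
  -- the sign of the last column makes the determinant positive
  let D : Matrix (Fin 5) (Fin 5) ℝ := Matrix.diagonal ![1, 1, 1, 1, G.det]
  have hDD : D.transpose * D = 1 := by
    rw [Matrix.diagonal_transpose, Matrix.diagonal_mul_diagonal, ← Matrix.diagonal_one]
    congr 1
    ext i
    fin_cases i <;> simp
    rcases hdet with h | h <;> rw [h] <;> norm_num
  have hg : G * D ∈ Matrix.specialOrthogonalGroup (Fin 5) ℝ := by
    rw [Matrix.mem_specialOrthogonalGroup_iff, Matrix.mem_orthogonalGroup_iff']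
    refine ⟨?_, ?_⟩
    · change (G * D).transpose * (G * D) = 1
      rw [Matrix.transpose_mul, Matrix.mul_assoc, ← Matrix.mul_assoc G.transpose, hG,
        Matrix.one_mul, hDD]
    · rw [Matrix.det_mul, Matrix.det_diagonal]
      simp [Fin.prod_univ_five]
      rcases hdet with h | h <;> rw [h] <;> norm_num
  refine ⟨⟨G * D, hg⟩, Subtype.ext ?_⟩
  have h0 : ∀ i, (G * D) i 0 = (z.1 i).re / a := by
    intro i
    have : B 0 = _ := hB 0 (by simp)
    rw [Matrix.mul_diagonal]
    change B 0 i * 1 = _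
    rw [this, mul_one]
    rfl
  have h1 : ∀ i, (G * D) i 1 = (z.1 i).im / b := by
    intro i
    have : B 1 = _ := hB 1 (by simp)
    rw [Matrix.mul_diagonal]
    change B 1 i * 1 = _
    rw [this, mul_one]
    rfl
  ext i
  change z.1 i = Matrix.mulVec ((G * D).map Complex.ofReal) _ i
  simp only [Matrix.mulVec, dotProduct, Fin.sum_univ_five, Matrix.map_apply, h0, h1, p]
  rw [← ha, ← hb]
  have ha1 : (a : ℂ) ≠ 0 := by exact_mod_cast ha0.ne'
  have hb1 : (b : ℂ) ≠ 0 := by exact_mod_cast hb0.ne'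
  simp
  field_simp
  exact (Complex.re_add_im _).symm

/-! ### A unitary frame at the reference points -/

/-- The squared length of the vector `(R₋, iR₊, 0, 0, 0)` at the point of radius `√s`. -/
def radialWeight (s : ℝ) : ℝ := dProfile s * (3 * (s + 1) ^ 2 / (4 * (s + 2)))

theorem radialWeight_pos {s : ℝ} (hs : 1 < s) : 0 < radialWeight s := by
  have h1 := dProfile_pos hs
  have h2 : 0 < s + 1 := by linarith
  have h3 : 0 < s + 2 := by linarith
  unfold radialWeight
  positivity

theorem radialWeight_eq {s : ℝ} (hs : 1 < s) :
    radialWeight s = deriv dProfile s * (s ^ 2 - 1) + dProfile s * s := by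
  have h2 : s + 1 ≠ 0 := by linarith
  have h3 : s + 2 ≠ 0 := by linarith
  rw [(hasDerivAt_dProfile hs).deriv, radialWeight]
  field_simp
  ring

/-- A unitary frame at `p_r`. -/
def unitVec (r : Ioi (1 : ℝ)) : Fin 8 → Amb :=
  let ν : ℝ := (√(radialWeight (r ^ 2)))⁻¹
  let κ : ℂ := ((√(dProfile (r ^ 2)))⁻¹ : ℝ)
  ![![(ν * Rm r : ℝ), Complex.I * (ν * Rp r : ℝ), 0, 0, 0],
    ![Complex.I * (ν * Rm r : ℝ), -(ν * Rp r : ℝ), 0, 0, 0],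
    ![0, 0, κ, 0, 0], ![0, 0, Complex.I * κ, 0, 0],
    ![0, 0, 0, κ, 0], ![0, 0, 0, Complex.I * κ, 0],
    ![0, 0, 0, 0, κ], ![0, 0, 0, 0, Complex.I * κ]]

theorem unitVec_mem (r : Ioi (1 : ℝ)) (i : Fin 8) : unitVec r i ∈ T (p r) := by
  rw [mem_T]
  fin_cases i <;> simp [unitVec, p, Fin.sum_univ_five]
  · linear_combination (((√(radialWeight (r ^ 2)) : ℝ) : ℂ)⁻¹ * Rp r * Rm r) * Complex.I_mul_I
  · ring

/-- The coordinates of a tangent vector in the frame `unitVec`. -/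
def unitCoord (r : Ioi (1 : ℝ)) (v : Amb) : Fin 8 → ℝ :=
  let N : ℝ := √(radialWeight (r ^ 2)) / Rm r
  let c : ℝ := √(dProfile (r ^ 2))
  ![N * (v 0).re, N * (v 0).im, c * (v 2).re, c * (v 2).im, c * (v 3).re, c * (v 3).im,
    c * (v 4).re, c * (v 4).im]

theorem normSq_p (r : Ioi (1 : ℝ)) : normSq (p r).1 = (r : ℝ) ^ 2 := by
  rw [← radius_sq, radius_p]

theorem one_lt_sq (r : Ioi (1 : ℝ)) : 1 < (r : ℝ) ^ 2 := by
  rw [← normSq_p]; exact one_lt_normSq _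

theorem sqrt_radialWeight_ne (r : Ioi (1 : ℝ)) : √(radialWeight ((r : ℝ) ^ 2)) ≠ 0 :=
  (Real.sqrt_pos.2 (radialWeight_pos (one_lt_sq r))).ne'

theorem sqrt_dProfile_ne (r : Ioi (1 : ℝ)) : √(dProfile ((r : ℝ) ^ 2)) ≠ 0 :=
  (Real.sqrt_pos.2 (dProfile_pos (one_lt_sq r))).ne'

theorem tangent_p (r : Ioi (1 : ℝ)) (v : T (p r)) :
    Rm r * (v.1 1).re = -(Rp r * (v.1 0).im) ∧ Rm r * (v.1 1).im = Rp r * (v.1 0).re := by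
  have h := mem_T.1 v.2
  simp [p, Fin.sum_univ_five] at h
  have h1 := congrArg Complex.re h
  have h2 := congrArg Complex.im h
  simp at h1 h2
  exact ⟨by linarith, by linarith⟩

theorem eucl_p (r : Ioi (1 : ℝ)) (v : T (p r)) :
    eucl (p r).1 v.1 = ((2 * Rp r * (v.1 0).re : ℝ) : ℂ) := by
  have := (tangent_p r v).2
  rw [eucl_apply]
  congr 1
  simp [p, Fin.sum_univ_five]
  linarith

theorem reIm_p (r : Ioi (1 : ℝ)) (v : T (p r)) :
    reIm (p r).1 v.1 = ((Rp r * (v.1 0).im : ℝ) : ℂ) := by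
  rw [reIm_apply]
  congr 1
  simp [p, Fin.sum_univ_five]

/-- The frame `unitVec` as a basis of the tangent space. -/
def unitBasis (r : Ioi (1 : ℝ)) : Module.Basis (Fin 8) ℝ (T (p r)) :=
  Module.Basis.ofEquivFun
    { toFun := fun v => unitCoord r v.1
      invFun := fun c => ∑ i, c i • ⟨unitVec r i, unitVec_mem r i⟩
      map_add' := fun u v => by
        ext i; fin_cases i <;> simp [unitCoord] <;> ring
      map_smul' := fun c v => by
        ext i; fin_cases i <;> simp [unitCoord] <;> ring
      left_inv := fun v => by
        have hN := sqrt_radialWeight_ne r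
        have hc := sqrt_dProfile_ne r
        have hb := (Rm_pos r.2).ne'
        obtain ⟨h1, h2⟩ := tangent_p r v
        refine Subtype.ext (funext fun j => ?_)
        simp only [Fin.sum_univ_eight]
        fin_cases j <;> apply Complex.ext <;> simp [unitCoord, unitVec] <;> field_simp
        · linarith
        · linarith
      right_inv := fun c => by
        have hN := sqrt_radialWeight_ne r
        have hc := sqrt_dProfile_ne r
        have hb := (Rm_pos r.2).ne'
        simp only [Fin.sum_univ_eight]
        ext i
        fin_cases i <;> simp [unitCoord, unitVec] <;> field_simp }

theorem coe_unitBasis (r : Ioi (1 : ℝ)) (i : Fin 8) : (unitBasis r i).1 = unitVec r i := by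
  rw [unitBasis, Module.Basis.coe_ofEquivFun]
  simp [Pi.single_apply, ite_smul]

theorem eucl_unitVec (r : Ioi (1 : ℝ)) (i : Fin 8) : eucl (p r).1 (unitVec r i) =
    if i = 0 then ((2 * Rp r * Rm r * (√(radialWeight (r ^ 2)))⁻¹ : ℝ) : ℂ) else 0 := by
  rw [eucl_apply]
  fin_cases i <;> simp [unitVec, p, Fin.sum_univ_five]
  ring

theorem reIm_unitVec (r : Ioi (1 : ℝ)) (i : Fin 8) : reIm (p r).1 (unitVec r i) =
    if i = 1 then ((Rp r * Rm r * (√(radialWeight (r ^ 2)))⁻¹ : ℝ) : ℂ) else 0 := by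
  rw [reIm_apply]
  fin_cases i <;> simp [unitVec, p, Fin.sum_univ_five]
  ring

theorem reIm_unitVec_unitVec (r : Ioi (1 : ℝ)) (i j : Fin 8) :
    reIm (unitVec r i) (unitVec r j) - reIm (unitVec r j) (unitVec r i) =
      (dProfile (r ^ 2))⁻¹ * stdOm i j +
        ((r : ℝ) ^ 2 * (radialWeight (r ^ 2))⁻¹ - (dProfile (r ^ 2))⁻¹) * stdRho i j := by
  have hk : (dProfile ((r : ℝ) ^ 2))⁻¹ = (√(dProfile (r ^ 2)))⁻¹ * (√(dProfile (r ^ 2)))⁻¹ := by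
    rw [← mul_inv, Real.mul_self_sqrt (dProfile_pos (one_lt_sq r)).le]
  have hn : (radialWeight ((r : ℝ) ^ 2))⁻¹ =
      (√(radialWeight (r ^ 2)))⁻¹ * (√(radialWeight (r ^ 2)))⁻¹ := by
    rw [← mul_inv, Real.mul_self_sqrt (radialWeight_pos (one_lt_sq r)).le]
  have hr : (r : ℝ) ^ 2 = Rp r ^ 2 + Rm r ^ 2 := by
    rw [Rp_sq, Rm_sq r.2]; ring
  have key : ∑ m, (unitVec r i m).re * (unitVec r j m).im -
      ∑ m, (unitVec r j m).re * (unitVec r i m).im = (dProfile (r ^ 2))⁻¹ * stdOm i j +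
        ((r : ℝ) ^ 2 * (radialWeight (r ^ 2))⁻¹ - (dProfile (r ^ 2))⁻¹) * stdRho i j := by
    rw [hk, hn]
    generalize hν : (√(radialWeight ((r : ℝ) ^ 2)))⁻¹ = ν
    generalize hκ : (√(dProfile ((r : ℝ) ^ 2)))⁻¹ = κ
    simp only [unitVec, hν, hκ]
    rw [hr]
    fin_cases i <;> fin_cases j <;> simp [Fin.sum_univ_five, stdOm, stdRho] <;> ring
  rw [reIm_apply, reIm_apply]
  exact_mod_cast congrArg (fun t : ℝ => (t : ℂ)) key

/-- The curvature of a radial connection in the unitary frame at `p_r`. -/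
theorem IsRadial.d_unitBasis {A : Form 1} {k h : ℝ → ℂ} (hA : IsRadial A k h) (r : Ioi (1 : ℝ))
    (i j : Fin 8) : d A (p r) ![unitBasis r i, unitBasis r j] =
      h (r ^ 2) / dProfile (r ^ 2) * stdOm i j +
      ((deriv h (r ^ 2) * (((r : ℝ) ^ 2) ^ 2 - 1) + h (r ^ 2) * (r : ℝ) ^ 2) / radialWeight (r ^ 2) -
        h (r ^ 2) / dProfile (r ^ 2)) * stdRho i j := by
  rw [hA.d_apply, normSq_p]
  simp only [coe_unitBasis]
  rw [reIm_unitVec_unitVec, eucl_unitVec, eucl_unitVec, reIm_unitVec, reIm_unitVec]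
  have h1 : ∀ i j : Fin 8, ((if i = 0 then 1 else 0) * (if j = 1 then 1 else 0) -
      (if j = 0 then 1 else 0) * (if i = 1 then 1 else 0) : ℤ) = stdRho i j := by decide
  have h2 : (2 * Rp r * Rm r * (√(radialWeight (r ^ 2)))⁻¹) *
      (Rp r * Rm r * (√(radialWeight (r ^ 2)))⁻¹) =
      (((r : ℝ) ^ 2) ^ 2 - 1) / 2 * (radialWeight (r ^ 2))⁻¹ := by
    have h3 : (radialWeight ((r : ℝ) ^ 2))⁻¹ =
        (√(radialWeight (r ^ 2)))⁻¹ * (√(radialWeight (r ^ 2)))⁻¹ := by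
      rw [← mul_inv, Real.mul_self_sqrt (radialWeight_pos (one_lt_sq r)).le]
    rw [h3]
    have h4 := Rp_sq r.1
    have h5 := Rm_sq r.2
    calc _ = 2 * Rp r ^ 2 * Rm r ^ 2 *
        ((√(radialWeight (r ^ 2)))⁻¹ * (√(radialWeight (r ^ 2)))⁻¹) := by ring
      _ = _ := by rw [h4, h5]; ring
  have h3 : ∀ (q : Prop) [Decidable q] (x : ℂ), (if q then x else 0) = x * (if q then 1 else 0 : ℤ) := by
    intro q _ x; split_ifs <;> simp
  rw [h3 (i = 0), h3 (j = 0), h3 (i = 1), h3 (j = 1), ← h1]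
  have h4 := congrArg (fun t : ℝ => (t : ℂ)) h2
  push_cast at h4 ⊢
  generalize ((if i = 0 then 1 else 0 : ℂ)) = a1 at *
  generalize ((if j = 0 then 1 else 0 : ℂ)) = a2 at *
  generalize ((if i = 1 then 1 else 0 : ℂ)) = a3 at *
  generalize ((if j = 1 then 1 else 0 : ℂ)) = a4 at *
  linear_combination 2 * deriv h (r ^ 2) * (a1 * a4 - a2 * a3) * h4

theorem isRadial_kahler_coeff (s : ℝ) (hs : 1 < s) :
    (deriv (fun s => (dProfile s : ℂ)) s * (s ^ 2 - 1) + dProfile s * s) / radialWeight s -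
      (dProfile s : ℂ) / dProfile s = 0 := by
  have h1 : deriv (fun s => (dProfile s : ℂ)) s = (deriv dProfile s : ℝ) := by
    have h2 := (hasDerivAt_dProfile hs)
    rw [h2.deriv]
    exact h2.ofReal_comp.deriv
  have h3 : (radialWeight s : ℂ) ≠ 0 := by exact_mod_cast (radialWeight_pos hs).ne'
  have h4 : (dProfile s : ℂ) ≠ 0 := by exact_mod_cast (dProfile_pos hs).ne'
  rw [h1, div_self h4]
  have h5 : ((deriv dProfile s : ℝ) * ((s : ℂ) ^ 2 - 1) + dProfile s * s) = radialWeight s := by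
    rw [radialWeight_eq hs]; push_cast; ring
  rw [h5, div_self h3, sub_self]

theorem isUnitary_unitBasis (r : Ioi (1 : ℝ)) : IsUnitary (unitBasis r) := by
  constructor
  · intro i j
    rw [kahler_eq_d, isRadial_kahlerPrimitive.d_unitBasis]
    have h1 := isRadial_kahler_coeff _ (one_lt_sq r)
    have h4 : (dProfile ((r : ℝ) ^ 2) : ℂ) ≠ 0 := by
      exact_mod_cast (dProfile_pos (one_lt_sq r)).ne'
    push_cast at h1 ⊢
    rw [h1, div_self h4]
    simp
  · intro i
    refine Subtype.ext ?_
    change Complex.I • (unitBasis r i).1 = (jSign i : ℝ) • (unitBasis r (jIndex i)).1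
    rw [coe_unitBasis, coe_unitBasis]
    ext m
    fin_cases i <;> fin_cases m <;> simp [unitVec, jSign, jIndex, ← mul_assoc]

/-! ### The instanton equation for radial connections -/

/-- The curvature `dA` of a connection, typed as a `2`-form. -/
def curvature (A : Form 1) : Form 2 := d A

set_option maxRecDepth 20000 in
/-- Both sides differ only in writing the degree of the curvature as `1 + 1` or as `2`. -/
theorem isSpin7Instanton_iff_curvature (A : Form 1) : IsSpin7Instanton A ↔ ∀ z,
    IsHodgeStar (k := 2) (l := 6) rfl (curvature A z) (-(wedge (cayley z) (curvature A z))) :=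
  Iff.rfl

/-- Every tangent space has a unitary basis which diagonalises the curvature of all radial
connections at once. -/
theorem exists_isUnitary (z : M) : ∃ b : Module.Basis (Fin 8) ℝ (T z), IsUnitary b ∧
    ∀ (A : Form 1) (k h : ℝ → ℂ), IsRadial A k h → ∀ i j, curvature A z ![b i, b j] =
      h (normSq z.1) / dProfile (normSq z.1) * stdOm i j +
      ((deriv h (normSq z.1) * ((normSq z.1 : ℂ) ^ 2 - 1) + h (normSq z.1) * normSq z.1) /
        radialWeight (normSq z.1) - h (normSq z.1) / dProfile (normSq z.1)) * stdRho i j := by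
  obtain ⟨g, hg⟩ := exists_eq_act_p z
  generalize (⟨radius z, one_lt_radius z⟩ : Ioi (1 : ℝ)) = r at hg
  subst hg
  have hn : normSq (act g (p r)).1 = (r : ℝ) ^ 2 := by
    rw [← radius_sq, radius_act, radius_p]
  have hb : ∀ i, (unitBasis r).map (dActEquiv g (p r)) i = dActEquiv g (p r) (unitBasis r i) :=
    fun i => rfl
  refine ⟨(unitBasis r).map (dActEquiv g (p r)), ⟨fun i j => ?_, fun i => ?_⟩,
    fun A k h hA i j => ?_⟩
  · rw [hb, hb, kahler_eq_d, isRadial_kahlerPrimitive.d_act, ← kahler_eq_d,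
      (isUnitary_unitBasis r).kahler]
  · rw [hb, hb]
    have h1 : J (act g (p r)) (dActEquiv g (p r) (unitBasis r i)) =
        dActEquiv g (p r) (J (p r) (unitBasis r i)) := by
      refine Subtype.ext ?_
      exact (Matrix.mulVec_smul (g.1.map Complex.ofReal) Complex.I (unitBasis r i).1).symm
    rw [h1, (isUnitary_unitBasis r).J, map_smul]
  · rw [hb, hb, curvature, hA.d_act, hA.d_unitBasis, hn]
    push_cast
    rfl

/-- A radial connection is a `Spin(7)` instanton if and only if its profile `h` satisfies a linear
first order equation. -/
theorem IsRadial.isSpin7Instanton_iff {A : Form 1} {k h : ℝ → ℂ} (hA : IsRadial A k h) :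
    IsSpin7Instanton A ↔ ∀ s : ℝ, 1 < s → deriv h s * ((s : ℂ) ^ 2 - 1) + h s * s =
      -(9 * (s + 1) ^ 2 / (4 * (s + 2))) * h s := by
  have key : ∀ s : ℝ, 1 < s →
      ((deriv h s * ((s : ℂ) ^ 2 - 1) + h s * s) / radialWeight s - h s / dProfile s =
        -4 * (h s / dProfile s) ↔ deriv h s * ((s : ℂ) ^ 2 - 1) + h s * s =
      -(9 * (s + 1) ^ 2 / (4 * (s + 2))) * h s) := by
    intro s hs
    have h4 : (dProfile s : ℂ) ≠ 0 := by exact_mod_cast (dProfile_pos hs).ne'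
    have h3 : (radialWeight s : ℂ) ≠ 0 := by exact_mod_cast (radialWeight_pos hs).ne'
    have h5 : (s + 2 : ℂ) ≠ 0 := by exact_mod_cast (by linarith : s + 2 ≠ 0)
    have h6 : (radialWeight s : ℂ) = dProfile s * (3 * (s + 1) ^ 2 / (4 * (s + 2))) := by
      rw [radialWeight]; push_cast; ring
    rw [sub_eq_iff_eq_add, div_eq_iff h3, h6]
    have h7 : (-4 * (h s / dProfile s) + h s / dProfile s) *
        (dProfile s * (3 * (s + 1) ^ 2 / (4 * (s + 2)))) =
        -(9 * (s + 1) ^ 2 / (4 * (s + 2))) * h s := by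
      field_simp
      ring
    rw [h7]
  rw [isSpin7Instanton_iff_curvature]
  constructor
  · intro hI s hs
    have hs1 : 1 < √s := by rw [Real.lt_sqrt zero_le_one]; simpa using hs
    have h1 := hI (p ⟨√s, hs1⟩)
    obtain ⟨b, hb, hd⟩ := exists_isUnitary (p ⟨√s, hs1⟩)
    have h2 := (hb.isHodgeStar_cayley_iff (hd A k h hA)).1 h1
    have h3 : normSq (p ⟨√s, hs1⟩).1 = s := by
      rw [normSq_p]; exact Real.sq_sqrt (by linarith)
    rw [h3] at h2
    exact (key s hs).1 h2
  · intro hs z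
    obtain ⟨b, hb, hd⟩ := exists_isUnitary z
    exact (hb.isHodgeStar_cayley_iff (hd A k h hA)).2
      ((key _ (one_lt_normSq z)).2 (hs _ (one_lt_normSq z)))

/-- Radial `Spin(7)` instantons are Hermitian Yang-Mills. -/
theorem IsRadial.isHYM {A : Form 1} {k h : ℝ → ℂ} (hA : IsRadial A k h)
    (hI : IsSpin7Instanton A) : IsHYM A := by
  rw [isSpin7Instanton_iff_curvature] at hI
  intro z
  obtain ⟨b, hb, hd⟩ := exists_isUnitary z
  have h1 := hd A k h hA
  have h2 := (hb.isHodgeStar_cayley_iff h1).1 (hI z)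
  have h3 := hb.wedge_Omega h1
  rw [h2] at h1
  exact ⟨⟨_, hb.isHodgeStar_kahler, hb.wedge_star_kahler h1⟩, h3⟩

/-! ### Invariant connections in temporal gauge -/

theorem theta_apply (z : M) (v : T z) :
    theta z ![v] = reIm z.1 v.1 / ((Rp (radius z) * Rm (radius z) : ℝ) : ℂ) := by
  rw [reIm_apply, ← Complex.ofReal_div]
  rfl

/-- `R₊R₋` as a function of `s = r²`. -/
def radiiProd (s : ℝ) : ℝ := Rp (√s) * Rm (√s)

theorem one_lt_sqrt {s : ℝ} (hs : 1 < s) : 1 < √s := by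
  rw [Real.lt_sqrt zero_le_one]; simpa using hs

theorem radiiProd_pos {s : ℝ} (hs : 1 < s) : 0 < radiiProd s :=
  mul_pos (Rp_pos _) (Rm_pos (one_lt_sqrt hs))

theorem radiiProd_sq {s : ℝ} (hs : 1 < s) : radiiProd s ^ 2 = (s ^ 2 - 1) / 4 := by
  rw [radiiProd, mul_pow, Rp_sq, Rm_sq (one_lt_sqrt hs), Real.sq_sqrt (by linarith)]
  ring

theorem contDiffOn_radiiProd : ContDiffOn ℝ ∞ radiiProd (Ioi 1) := by
  have h : ContDiffOn ℝ ∞ (fun s : ℝ => √((s ^ 2 - 1) / 4)) (Ioi 1) := by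
    intro s hs
    have hs' : 1 < s := hs
    refine ContDiffAt.contDiffWithinAt (ContDiffAt.sqrt ?_ ?_)
    · exact ((contDiffAt_id.pow 2).sub contDiffAt_const).div_const 4
    · have : 0 < (s ^ 2 - 1) / 4 := by nlinarith
      exact this.ne'
  refine h.congr fun s hs => ?_
  rw [← radiiProd_sq hs, Real.sqrt_sq (radiiProd_pos hs).le]

theorem hasDerivAt_radiiProd {s : ℝ} (hs : 1 < s) :
    HasDerivAt radiiProd (radiiProd s * (s / (s ^ 2 - 1))) s := by
  have h1 : HasDerivAt radiiProd (deriv radiiProd s) s :=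
    ((contDiffOn_radiiProd.contDiffAt (Ioi_mem_nhds hs)).differentiableAt (by simp)).hasDerivAt
  have h2 : HasDerivAt (fun s => radiiProd s ^ 2) (2 * s / 4) s := by
    have h3 : HasDerivAt (fun s : ℝ => (s ^ 2 - 1) / 4) (2 * s / 4) s := by
      simpa using (((hasDerivAt_id s).pow 2).sub_const 1).div_const 4
    refine h3.congr_of_eventuallyEq ?_
    filter_upwards [Ioi_mem_nhds hs] with t ht using radiiProd_sq ht
  have h3 := (h1.pow 2).unique h2
  have h4 := radiiProd_pos hs
  have h5 := radiiProd_sq hs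
  have h6 : s ^ 2 - 1 ≠ 0 := by nlinarith
  have h7 : deriv radiiProd s = radiiProd s * (s / (s ^ 2 - 1)) := by
    rw [show s ^ 2 - 1 = 4 * radiiProd s ^ 2 by rw [h5]; ring]
    field_simp
    simp at h3
    linarith
  rwa [h7] at h1

/-- The denominator of `α_K` as a function of `s = r²`. -/
def alphaDenom (s : ℝ) : ℝ := (s + 2) ^ (3 / 4 : ℝ) * (s - 1) ^ (3 / 2 : ℝ)

theorem alphaDenom_pos {s : ℝ} (hs : 1 < s) : 0 < alphaDenom s := by
  have h1 : 0 < s + 2 := by linarith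
  have h2 : 0 < s - 1 := by linarith
  unfold alphaDenom
  positivity

theorem alphaDenom_sq {r : ℝ} (hr : 1 < r) :
    (r ^ 2 + 2) ^ (3 / 4 : ℝ) * (r + 1) ^ (3 / 2 : ℝ) * (r - 1) ^ (3 / 2 : ℝ) =
      alphaDenom (r ^ 2) := by
  rw [alphaDenom, mul_assoc, ← Real.mul_rpow (by linarith) (by linarith)]
  congr 2
  ring

theorem alphaK_eq (K : ℝ) {r : ℝ} (hr : 1 < r) : alphaK K r = K / alphaDenom (r ^ 2) := by
  rw [alphaK, alphaDenom_sq hr]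

theorem hasDerivAt_alphaDenom {s : ℝ} (hs : 1 < s) : HasDerivAt alphaDenom
    (alphaDenom s * (9 * (s + 1) / (4 * ((s + 2) * (s - 1))))) s := by
  have h1 : 0 < s + 2 := by linarith
  have h2 : 0 < s - 1 := by linarith
  have h3 := ((hasDerivAt_id s).add_const 2).rpow_const (p := 3 / 4) (Or.inl h1.ne')
  have h4 := ((hasDerivAt_id s).sub_const 1).rpow_const (p := 3 / 2) (Or.inl h2.ne')
  refine (h3.mul h4).congr_deriv ?_
  simp only [id, alphaDenom]
  rw [Real.rpow_sub_one h1.ne', Real.rpow_sub_one h2.ne']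
  field_simp
  ring

theorem contDiffOn_alphaDenom : ContDiffOn ℝ ∞ alphaDenom (Ioi 1) := by
  intro s hs
  have hs' : 1 < s := hs
  have h1 : s + 2 ≠ 0 := by linarith
  have h2 : s - 1 ≠ 0 := by linarith
  exact (((contDiffAt_id.add contDiffAt_const).rpow_const_of_ne h1).mul
    ((contDiffAt_id.sub contDiffAt_const).rpow_const_of_ne h2)).contDiffWithinAt

/-- The instanton equation for a profile `h`, solved by an integrating factor. -/
theorem ode_iff {h : ℝ → ℝ} (hh : DifferentiableOn ℝ h (Ioi 1)) :
    (∀ s : ℝ, 1 < s →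
      deriv h s * (s ^ 2 - 1) + h s * s = -(9 * (s + 1) ^ 2 / (4 * (s + 2))) * h s) ↔
    ∃ K : ℝ, ∀ s : ℝ, 1 < s → h s * (radiiProd s * alphaDenom s) = K := by
  have hd : ∀ s : ℝ, 1 < s → HasDerivAt (fun s => h s * (radiiProd s * alphaDenom s))
      (radiiProd s * alphaDenom s / (s ^ 2 - 1) * (deriv h s * (s ^ 2 - 1) + h s * s +
        9 * (s + 1) ^ 2 / (4 * (s + 2)) * h s)) s := by
    intro s hs
    have h1 := (hh.differentiableAt (Ioi_mem_nhds hs)).hasDerivAt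
    refine (h1.mul ((hasDerivAt_radiiProd hs).mul (hasDerivAt_alphaDenom hs))).congr_deriv ?_
    have h2 : s + 1 ≠ 0 := by linarith
    have h3 : s - 1 ≠ 0 := by linarith
    have h4 : s + 2 ≠ 0 := by linarith
    rw [show s ^ 2 - 1 = (s + 1) * (s - 1) by ring]
    simp only [Pi.mul_apply]
    field_simp
    ring
  constructor
  · intro he
    have h1 := isOpen_Ioi.exists_is_const_of_deriv_eq_zero (𝕜 := ℝ) (s := Ioi (1 : ℝ))
      (f := fun s => h s * (radiiProd s * alphaDenom s)) isPreconnected_Ioi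
      (fun s hs => (hd s hs).differentiableAt.differentiableWithinAt)
      (fun s hs => by rw [(hd s hs).deriv, he s hs]; simp)
    exact h1
  · rintro ⟨K, hK⟩ s hs
    have h1 : HasDerivAt (fun s => h s * (radiiProd s * alphaDenom s)) 0 s := by
      refine (hasDerivAt_const s K).congr_of_eventuallyEq ?_
      filter_upwards [Ioi_mem_nhds hs] with t ht using hK t ht
    have h2 := (hd s hs).unique h1
    have h3 : radiiProd s * alphaDenom s / (s ^ 2 - 1) ≠ 0 := by
      have h4 : s ^ 2 - 1 ≠ 0 := by nlinarith
      have := (radiiProd_pos hs).ne'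
      have := (alphaDenom_pos hs).ne'
      positivity
    have h4 := (mul_eq_zero.1 h2).resolve_left h3
    linarith

/-- `A = i h(r²) ∑ xⱼ dyⱼ` with a smooth real function `h`. -/
def IsTemporal (A : Form 1) (h : ℝ → ℝ) : Prop :=
  ContDiffOn ℝ ∞ h (Ioi 1) ∧ ∀ z v, A z ![v] = Complex.I * h (normSq z.1) * reIm z.1 v.1

theorem IsTemporal.isRadial {A : Form 1} {h : ℝ → ℝ} (hA : IsTemporal A h) :
    IsRadial A (fun _ => 0) (fun s => Complex.I * h s) :=
  ⟨contDiffOn_const, contDiffOn_const.mul (Complex.ofRealCLM.contDiff.comp_contDiffOn hA.1),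
    fun z v => by rw [hA.2]; ring⟩

theorem IsTemporal.deriv_profile {A : Form 1} {h : ℝ → ℝ} (hA : IsTemporal A h) {s : ℝ} (hs : 1 < s) :
    deriv (fun s => Complex.I * (h s : ℂ)) s = Complex.I * (deriv h s : ℝ) := by
  have h1 := ((hA.1.contDiffAt (Ioi_mem_nhds hs)).differentiableAt (by simp)).hasDerivAt
  exact (h1.ofReal_comp.const_mul Complex.I).deriv

/-- In temporal gauge the `Spin(7)` instantons form a one parameter family. -/
theorem IsTemporal.isSpin7Instanton_iff {A : Form 1} {h : ℝ → ℝ} (hA : IsTemporal A h) :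
    IsSpin7Instanton A ↔ ∃ K : ℝ, ∀ s : ℝ, 1 < s → h s * (radiiProd s * alphaDenom s) = K := by
  rw [hA.isRadial.isSpin7Instanton_iff, ← ode_iff (hA.1.differentiableOn (by simp))]
  refine forall_congr' fun s => forall_congr' fun hs => ?_
  rw [hA.deriv_profile hs]
  have h1 : Complex.I * (deriv h s : ℝ) * ((s : ℂ) ^ 2 - 1) + Complex.I * h s * s =
      Complex.I * ((deriv h s * (s ^ 2 - 1) + h s * s : ℝ) : ℂ) := by
    push_cast; ring
  have h2 : -(9 * ((s : ℂ) + 1) ^ 2 / (4 * (s + 2))) * (Complex.I * h s) =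
      Complex.I * ((-(9 * (s + 1) ^ 2 / (4 * (s + 2))) * h s : ℝ) : ℂ) := by
    push_cast; ring
  rw [h1, h2, mul_right_inj' Complex.I_ne_zero, Complex.ofReal_inj]

theorem IsTemporal.isConnection {A : Form 1} {h : ℝ → ℝ} (hA : IsTemporal A h) :
    IsConnection A := by
  refine ⟨hA.isRadial.isSmooth, fun z v => ?_⟩
  rw [show v = ![v 0] by ext1 i; fin_cases i; rfl, hA.2, reIm_apply]
  simp

/-- The profile of a connection in `Ainv`. -/
theorem isTemporal_of_smul_theta {A : Form 1} {α : ℝ → ℝ} (hα : ContDiffOn ℝ ∞ α (Ioi 1))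
    (hA : ∀ z, A z = (Complex.I * (α (radius z) : ℂ)) • theta z) :
    IsTemporal A fun s => α (√s) / radiiProd s := by
  refine ⟨?_, fun z v => ?_⟩
  · have h1 : ContDiffOn ℝ ∞ (fun s : ℝ => √s) (Ioi 1) := fun s hs =>
      (contDiffAt_id.sqrt (ne_of_gt (zero_lt_one.trans hs))).contDiffWithinAt
    exact (hα.comp h1 fun s hs => one_lt_sqrt hs).div contDiffOn_radiiProd
      fun s hs => (radiiProd_pos hs).ne'
  · rw [hA, AlternatingMap.smul_apply, theta_apply, smul_eq_mul]
    change _ = Complex.I * ((α (radius z) / (Rp (radius z) * Rm (radius z)) : ℝ) : ℂ) * _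
    push_cast
    ring

theorem contDiffOn_alphaK (K : ℝ) : ContDiffOn ℝ ∞ (alphaK K) (Ioi 1) := by
  have h1 : ContDiffOn ℝ ∞ (fun r : ℝ => K / alphaDenom (r ^ 2)) (Ioi 1) := by
    have hm : ∀ r ∈ Ioi (1 : ℝ), r ^ 2 ∈ Ioi (1 : ℝ) := fun r hr => by
      have : 1 < r := hr
      simp only [mem_Ioi]; nlinarith
    exact contDiffOn_const.div (contDiffOn_alphaDenom.comp (contDiffOn_id.pow 2) hm)
      fun r hr => (alphaDenom_pos (hm r hr)).ne'
  exact h1.congr fun r hr => alphaK_eq K hr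

theorem isTemporal_AK (K : ℝ) : IsTemporal (AK K) fun s => alphaK K (√s) / radiiProd s :=
  isTemporal_of_smul_theta (contDiffOn_alphaK K) fun _ => rfl

theorem AK_mem_Ainv (K : ℝ) : AK K ∈ Ainv := ⟨_, contDiffOn_alphaK K, fun _ => rfl⟩

theorem AK_profile (K : ℝ) {s : ℝ} (hs : 1 < s) :
    alphaK K (√s) / radiiProd s * (radiiProd s * alphaDenom s) = K := by
  have h1 := (radiiProd_pos hs).ne'
  have h2 := (alphaDenom_pos hs).ne'
  rw [alphaK_eq K (one_lt_sqrt hs), Real.sq_sqrt (by linarith)]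
  field_simp

theorem isSpin7Instanton_AK (K : ℝ) : IsSpin7Instanton (AK K) :=
  (isTemporal_AK K).isSpin7Instanton_iff.2 ⟨K, fun _ hs => AK_profile K hs⟩

theorem IsTemporal.eq_AK {A : Form 1} {h : ℝ → ℝ} (hA : IsTemporal A h)
    (hI : IsSpin7Instanton A) : ∃ K, A = AK K := by
  obtain ⟨K, hK⟩ := hA.isSpin7Instanton_iff.1 hI
  refine ⟨K, funext fun z => alt_one_ext fun v => ?_⟩
  have h1 : h (normSq z.1) = alphaK K (√(normSq z.1)) / radiiProd (normSq z.1) := by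
    have hs := one_lt_normSq z
    have h2 := (radiiProd_pos hs).ne'
    have h3 := (alphaDenom_pos hs).ne'
    have h4 := (hK _ hs).trans (AK_profile K hs).symm
    exact mul_right_cancel₀ (mul_ne_zero h2 h3) h4
  rw [hA.2, (isTemporal_AK K).2, h1]

theorem setOf_instanton_eq_range : {A | A ∈ Ainv ∧ IsSpin7Instanton A} = Set.range AK := by
  ext A
  constructor
  · rintro ⟨⟨α, hα, hA⟩, hI⟩
    obtain ⟨K, rfl⟩ := (isTemporal_of_smul_theta hα hA).eq_AK hI
    exact ⟨K, rfl⟩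
  · rintro ⟨K, rfl⟩
    exact ⟨AK_mem_Ainv K, isSpin7Instanton_AK K⟩

theorem AK_zero : AK 0 = 0 := by
  funext z
  simp [AK, alphaK]

/-! ### The curvature of `A_K` -/

theorem coframe_apply (r : Ioi (1 : ℝ)) (i : Fin 8) (v : T (p r)) :
    coframe r i ![v] = coframeFun r i v.1 := rfl

theorem pullback_d_AK (K : ℝ) (r : Ioi (1 : ℝ)) (g : SO5) :
    pullback g (d (AK K)) (p r) =
      (Complex.I * K) •
        ((-(9 / 2 : ℝ) * (r * (r ^ 2 + 1) / ((r ^ 2 + 2) ^ (7 / 4 : ℝ) *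
            (r + 1) ^ (5 / 2 : ℝ) * (r - 1) ^ (5 / 2 : ℝ))) : ℝ) •
          wedge (coframe r 0) (coframe r 1) +
        (1 / ((r ^ 2 + 2) ^ (3 / 4 : ℝ) *
            (r + 1) ^ (3 / 2 : ℝ) * (r - 1) ^ (3 / 2 : ℝ)) : ℝ) •
          (wedge (coframe r 2) (coframe r 5) + wedge (coframe r 3) (coframe r 6) +
            wedge (coframe r 4) (coframe r 7))) := by
  have hr : (1 : ℝ) < r := r.2
  have hs := one_lt_sq r
  have ha := Rp_pos (r : ℝ)
  have hb := Rm_pos r.2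
  have ha2 := Rp_sq (r : ℝ)
  have hb2 := Rm_sq r.2
  set a := Rp (r : ℝ)
  set b := Rm (r : ℝ)
  have hw := alphaDenom_pos hs
  -- both denominators in terms of `r²`
  have hW := alphaDenom_sq hr
  have hW' : ((r : ℝ) ^ 2 + 2) ^ (7 / 4 : ℝ) * (r + 1) ^ (5 / 2 : ℝ) * (r - 1) ^ (5 / 2 : ℝ) =
      ((r : ℝ) ^ 2 + 2) * (2 * b ^ 2) * alphaDenom (r ^ 2) := by
    rw [← hW, hb2, show (7 / 4 : ℝ) = 3 / 4 + 1 by norm_num, show (5 / 2 : ℝ) = 3 / 2 + 1 by norm_num,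
      Real.rpow_add_one (by positivity), Real.rpow_add_one (by linarith),
      Real.rpow_add_one (by linarith)]
    ring
  rw [hW, hW']
  have hq : radiiProd ((r : ℝ) ^ 2) = a * b := by
    rw [radiiProd, Real.sqrt_sq (by linarith)]
  have hA := isTemporal_AK K
  obtain ⟨h, hh⟩ : ∃ h, h = fun s => alphaK K (√s) / radiiProd s := ⟨_, rfl⟩
  rw [← hh] at hA
  have h0 : h (r ^ 2) = K / (a * b * alphaDenom (r ^ 2)) := by
    rw [← hq, hh]
    dsimp only
    rw [eq_div_iff (mul_pos (radiiProd_pos hs) hw).ne', AK_profile K hs]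
  have h1 : deriv h (r ^ 2) * (4 * a ^ 2) * b ^ 2 + h (r ^ 2) * r ^ 2 =
      -(9 * a ^ 4 / (r ^ 2 + 2)) * h (r ^ 2) := by
    have h2 := (ode_iff (hA.1.differentiableOn (by simp))).2
      ⟨K, fun s hs => by rw [hh]; exact AK_profile K hs⟩ _ hs
    rw [show a ^ 4 = (a ^ 2) ^ 2 by ring, ha2]
    have h3 : 4 * ((r ^ 2 + 1) / 2) * b ^ 2 = ((r : ℝ) ^ 2) ^ 2 - 1 := by rw [hb2]; ring
    rw [mul_assoc, h3, h2]
    have h4 : (r : ℝ) ^ 2 + 2 ≠ 0 := by positivity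
    field_simp
    ring
  refine alt_two_ext fun u v => ?_
  have hp : pullback g (d (AK K)) (p r) ![u, v] =
      d (AK K) (act g (p r)) ![dActEquiv g (p r) u, dActEquiv g (p r) v] :=
    congrArg (d (AK K) (act g (p r))) (funext fun i => by fin_cases i <;> rfl)
  rw [hp, hA.isRadial.d_act, hA.isRadial.d_apply, hA.deriv_profile (one_lt_normSq _), normSq_p]
  obtain ⟨u1, u2⟩ := tangent_p r u
  obtain ⟨v1, v2⟩ := tangent_p r v
  have hu1 : (u.1 1).re = -(a * (u.1 0).im) / b := by rw [eq_div_iff hb.ne']; linarith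
  have hu2 : (u.1 1).im = a * (u.1 0).re / b := by rw [eq_div_iff hb.ne']; linarith
  have hv1 : (v.1 1).re = -(a * (v.1 0).im) / b := by rw [eq_div_iff hb.ne']; linarith
  have hv2 : (v.1 1).im = a * (v.1 0).re / b := by rw [eq_div_iff hb.ne']; linarith
  have hr0 : (r : ℝ) ≠ 0 := by linarith
  have hS : (r : ℝ) ^ 2 = a ^ 2 + b ^ 2 := by rw [ha2, hb2]; ring
  have key : 2 * deriv h (r ^ 2) * (2 * a * (u.1 0).re * (a * (v.1 0).im) -
        2 * a * (v.1 0).re * (a * (u.1 0).im)) +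
      h (r ^ 2) * (∑ j, (u.1 j).re * (v.1 j).im - ∑ j, (v.1 j).re * (u.1 j).im) =
      K * (-(9 / 2) * (r * (r ^ 2 + 1) / ((r ^ 2 + 2) * (2 * b ^ 2) * alphaDenom (r ^ 2))) *
        (2 * a / r * (u.1 0).re * ((v.1 0).im / b) - 2 * a / r * (v.1 0).re * ((u.1 0).im / b)) +
      1 / alphaDenom (r ^ 2) *
        ((-(u.1 2).re / a * (-(v.1 2).im / b) - -(v.1 2).re / a * (-(u.1 2).im / b)) +
        (-(u.1 3).re / a * (-(v.1 3).im / b) - -(v.1 3).re / a * (-(u.1 3).im / b)) +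
        (-(u.1 4).re / a * (-(v.1 4).im / b) - -(v.1 4).re / a * (-(u.1 4).im / b)))) := by
    have h2 : deriv h (r ^ 2) = (-(9 * a ^ 4 / (r ^ 2 + 2)) * h (r ^ 2) - h (r ^ 2) * r ^ 2) /
        (4 * a ^ 2 * b ^ 2) := by
      rw [eq_div_iff (by positivity)]
      linarith
    have h3 : (r : ℝ) ^ 2 + 1 = 2 * a ^ 2 := by rw [ha2]; ring
    have h4 : (r : ℝ) ^ 2 + 2 ≠ 0 := by positivity
    rw [h2, h0, h3]
    simp only [Fin.sum_univ_five, hu1, hu2, hv1, hv2]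
    generalize alphaDenom ((r : ℝ) ^ 2) = w at hw
    generalize hR : (r : ℝ) ^ 2 + 2 = R at h4
    rw [hS]
    field_simp
    ring
  simp only [AlternatingMap.smul_apply, AlternatingMap.add_apply, wedge_one_one, coframe_apply,
    eucl_p, reIm_p]
  simp only [reIm_apply]
  have hk := congrArg (fun t : ℝ => Complex.I * (t : ℂ)) key
  simp only [coframeFun, Complex.real_smul, smul_eq_mul] at hk ⊢
  push_cast at hk ⊢
  linear_combination hk

/-! ### Parallel transport along loops -/

/-- The complex circle `(cos ζ, sin ζ, 0, 0, 0)` in the quadric. -/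
def circleVec (ζ : ℂ) : Amb := ![Complex.cos ζ, Complex.sin ζ, 0, 0, 0]

theorem normSq_circleVec (φ τ : ℝ) :
    normSq (circleVec (φ + τ * Complex.I)) = Real.cosh (2 * τ) := by
  have h1 := Real.sin_sq_add_cos_sq φ
  have h2 := Real.cosh_sq τ
  simp only [normSq, Fin.sum_univ_five, ← Complex.normSq_eq_norm_sq, Complex.normSq_apply,
    circleVec]
  simp [Complex.cos_add_mul_I, Complex.sin_add_mul_I, ← Complex.ofReal_cos, ← Complex.ofReal_sin,
    ← Complex.ofReal_cosh, ← Complex.ofReal_sinh]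
  rw [Real.cosh_two_mul]
  linear_combination (Real.cosh τ ^ 2 + Real.sinh τ ^ 2) * h1

/-- A point of the complex circle, as a point of `M`. -/
def circlePt (φ τ : ℝ) (hτ : 0 < τ) : M := ⟨circleVec (φ + τ * Complex.I), by
  refine ⟨?_, ?_⟩
  · simp only [Fin.sum_univ_five, circleVec]
    simp
  · change 1 < normSq _
    rw [normSq_circleVec, Real.one_lt_cosh]
    positivity⟩

theorem hasDerivAt_circleVec (ζ : ℂ) :
    HasDerivAt circleVec ![-Complex.sin ζ, Complex.cos ζ, 0, 0, 0] ζ := by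
  rw [hasDerivAt_pi]
  intro i
  fin_cases i <;> simp [circleVec]
  · exact Complex.hasDerivAt_cos ζ
  · exact Complex.hasDerivAt_sin ζ
  all_goals exact hasDerivAt_const _ _

theorem contDiff_circleVec : ContDiff ℝ ∞ circleVec := by
  rw [contDiff_pi]
  intro i
  fin_cases i <;> simp [circleVec]
  · exact Complex.contDiff_cos.restrict_scalars ℝ
  · exact Complex.contDiff_sin.restrict_scalars ℝ
  all_goals exact contDiff_const

theorem reIm_circleVec (φ τ φ' τ' : ℝ) :
    reIm (circleVec (φ + τ * Complex.I)) (((φ' : ℂ) + τ' * Complex.I) •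
      ![-Complex.sin (φ + τ * Complex.I), Complex.cos (φ + τ * Complex.I), 0, 0, 0]) =
      ((-φ' * (Real.cosh τ * Real.sinh τ) : ℝ) : ℂ) := by
  have h1 := Real.sin_sq_add_cos_sq φ
  rw [reIm_apply]
  congr 1
  simp only [Fin.sum_univ_five, circleVec]
  simp [Complex.cos_add_mul_I, Complex.sin_add_mul_I, ← Complex.ofReal_cos, ← Complex.ofReal_sin,
    ← Complex.ofReal_cosh, ← Complex.ofReal_sinh]
  linear_combination -φ' * Real.cosh τ * Real.sinh τ * h1

theorem radiiProd_cosh {τ : ℝ} (hτ : 0 < τ) :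
    radiiProd (Real.cosh (2 * τ)) = Real.cosh τ * Real.sinh τ := by
  have h1 : 1 < Real.cosh (2 * τ) := Real.one_lt_cosh.2 (by positivity)
  have h2 : 0 < Real.sinh τ := Real.sinh_pos_iff.2 hτ
  have h3 := Real.cosh_pos τ
  refine (pow_left_inj₀ (radiiProd_pos h1).le (by positivity) two_ne_zero).1 ?_
  rw [radiiProd_sq h1, Real.cosh_sq (2 * τ), Real.sinh_two_mul]
  ring

/-- Along the complex circles and their images under `SO(5)`, the form `θ¹` is `-dφ`. -/
theorem AK_along_circle (K : ℝ) (g : SO5) {φ τ : ℝ → ℝ} (hτ : ∀ t, 0 < τ t) {φ' τ' s : ℝ}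
    (h1 : HasDerivAt φ φ' s) (h2 : HasDerivAt τ τ' s) :
    ∃ v : T (act g (circlePt (φ s) (τ s) (hτ s))),
      HasDerivAt (fun t => (act g (circlePt (φ t) (τ t) (hτ t)) : Amb)) v.1 s ∧
      AK K _ ![v] = -(Complex.I * (φ' * (K / alphaDenom (Real.cosh (2 * τ s))) : ℝ)) := by
  set ζ : ℂ := φ s + τ s * Complex.I with hζ
  set w : Amb := ((φ' : ℂ) + τ' * Complex.I) • ![-Complex.sin ζ, Complex.cos ζ, 0, 0, 0] with hw
  have h3 : HasDerivAt (fun t => (φ t : ℂ) + τ t * Complex.I) (φ' + τ' * Complex.I) s :=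
    h1.ofReal_comp.add (h2.ofReal_comp.mul_const _)
  have h4 : HasDerivAt (fun t => circleVec (φ t + τ t * Complex.I)) w s :=
    (hasDerivAt_circleVec ζ).scomp (h := fun t : ℝ => (φ t : ℂ) + τ t * Complex.I) s h3
  have hwT : w ∈ T (circlePt (φ s) (τ s) (hτ s)) := by
    rw [mem_T]
    simp only [circlePt, ← hζ, hw, Fin.sum_univ_five, circleVec]
    simp
    ring
  refine ⟨dAct g _ ⟨w, hwT⟩, ?_, ?_⟩
  · exact (rot g.1).toContinuousLinearMap.hasFDerivAt.comp_hasDerivAt s h4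
  · have h5 : AK K (act g (circlePt (φ s) (τ s) (hτ s))) ![dAct g _ ⟨w, hwT⟩] =
        AK K (circlePt (φ s) (τ s) (hτ s)) ![⟨w, hwT⟩] := by
      have := congrFun ((isTemporal_AK K).isRadial.isInvariant g) (circlePt (φ s) (τ s) (hτ s))
      rw [← this]
      exact congrArg (AK K (act g (circlePt (φ s) (τ s) (hτ s))))
        (funext fun i => by fin_cases i; rfl)
    rw [h5, (isTemporal_AK K).2]
    have h6 : reIm (circlePt (φ s) (τ s) (hτ s)).1 w = _ := reIm_circleVec (φ s) (τ s) φ' τ'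
    have h7 : normSq (circlePt (φ s) (τ s) (hτ s)).1 = Real.cosh (2 * τ s) :=
      normSq_circleVec _ _
    rw [h6, h7, ← radiiProd_cosh (hτ s)]
    have h8 : 1 < Real.cosh (2 * τ s) := Real.one_lt_cosh.2 (by have := hτ s; positivity)
    have h9 := AK_profile K h8
    have h10 := (alphaDenom_pos h8).ne'
    rw [← mul_assoc, ← eq_div_iff h10] at h9
    rw [← h9]
    push_cast
    ring

/-- On the complex circles the denominator of `α_K` takes all positive values. -/
theorem exists_alphaDenom_eq {c : ℝ} (hc : 0 < c) :
    ∃ τ : ℝ, 0 < τ ∧ alphaDenom (Real.cosh (2 * τ)) = c := by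
  have hcont : Continuous fun τ : ℝ => alphaDenom (Real.cosh (2 * τ)) := by
    have h1 : Continuous fun τ : ℝ => Real.cosh (2 * τ) :=
      Real.continuous_cosh.comp (continuous_const.mul continuous_id)
    exact ((h1.add continuous_const).rpow_const fun _ => Or.inr (by norm_num)).mul
      ((h1.sub continuous_const).rpow_const fun _ => Or.inr (by norm_num))
  have h0 : alphaDenom (Real.cosh (2 * 0)) = 0 := by
    simp [alphaDenom]
  set τ₁ := Real.arcosh (2 + c) / 2 with hτ₁
  have h1 : Real.cosh (2 * τ₁) = 2 + c := by
    rw [hτ₁, mul_div_cancel₀ _ two_ne_zero, Real.cosh_arcosh (by linarith)]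
  have h2 : c ≤ alphaDenom (Real.cosh (2 * τ₁)) := by
    rw [h1, alphaDenom]
    have h3 : (1 : ℝ) ≤ (2 + c + 2) ^ (3 / 4 : ℝ) :=
      Real.one_le_rpow (by linarith) (by norm_num)
    have h4 : 1 + c ≤ (2 + c - 1) ^ (3 / 2 : ℝ) := by
      have := Real.rpow_le_rpow_of_exponent_le (x := 2 + c - 1) (by linarith)
        (by norm_num : (1 : ℝ) ≤ 3 / 2)
      rw [Real.rpow_one] at this
      linarith
    nlinarith
  have hτ0 : 0 ≤ τ₁ := div_nonneg (Real.arcosh_nonneg (by linarith)) two_pos.le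
  obtain ⟨τ, hτ, h⟩ := intermediate_value_Icc hτ0 hcont.continuousOn
    (show c ∈ Icc _ _ from ⟨by simp only [h0]; exact hc.le, h2⟩)
  refine ⟨τ, lt_of_le_of_ne hτ.1 ?_, h⟩
  rintro rfl
  simp only [h0] at h
  exact hc.ne h

/-- Every point of `M` lies on a translate of the complex circle. -/
theorem exists_eq_act_circlePt (z : M) :
    ∃ (g : SO5) (τ : ℝ) (hτ : 0 < τ), z = act g (circlePt 0 τ hτ) := by
  obtain ⟨g, hg⟩ := exists_eq_act_p z
  generalize (⟨radius z, one_lt_radius z⟩ : Ioi (1 : ℝ)) = r at hg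
  refine ⟨g, Real.arsinh (Rm r), Real.arsinh_pos_iff.2 (Rm_pos r.2), ?_⟩
  rw [hg]
  congr 1
  refine Subtype.ext ?_
  have h1 : Real.cosh (Real.arsinh (Rm r)) = Rp r := by
    rw [Real.cosh_arsinh, ← Real.sqrt_sq (Rp_pos (r : ℝ)).le]
    congr 1
    rw [Rp_sq, Rm_sq r.2]
    ring
  ext i
  fin_cases i <;> simp [p, circlePt, circleVec, Complex.cos_mul_I, Complex.sin_mul_I,
    ← Complex.ofReal_cosh, ← Complex.ofReal_sinh, h1]
  exact mul_comm _ _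

/-- One piece of a horizontal path over a complex circle, on which `φ` and `τ` are affine. By `hκ`
the lift is `exp(iκφ)` as soon as either `φ` is constant or `κ` is the coefficient of the connection
at the constant value of `τ`. -/
theorem horizontal_piece (K : ℝ) (g : SO5) {φ τ : ℝ → ℝ} (hτ : ∀ t, 0 < τ t) (κ : ℝ)
    {x y p₀ p₁ q₀ q₁ : ℝ} (hφ : ∀ t ∈ Icc x y, φ t = p₀ + p₁ * t)
    (hτ' : ∀ t ∈ Icc x y, τ t = q₀ + q₁ * t)
    (hκ : ∀ t ∈ Icc x y, p₁ * (K / alphaDenom (Real.cosh (2 * τ t))) = κ * p₁) :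
    ContDiffOn ℝ ∞ (fun t => (act g (circlePt (φ t) (τ t) (hτ t)) : Amb)) (Icc x y) ∧
    ContDiffOn ℝ ∞ (fun t => (Circle.exp (κ * φ t) : ℂ)) (Icc x y) ∧
    ∀ s ∈ Ioo x y, ∃ v : T (act g (circlePt (φ s) (τ s) (hτ s))),
      HasDerivAt (fun t => (act g (circlePt (φ t) (τ t) (hτ t)) : Amb)) v.1 s ∧
      HasDerivAt (fun t => (Circle.exp (κ * φ t) : ℂ))
        (-(AK K _ ![v]) * Circle.exp (κ * φ s)) s := by
  have haff : ∀ a b : ℝ, ContDiff ℝ ∞ fun t : ℝ => ((a + b * t : ℝ) : ℂ) := fun a b =>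
    Complex.ofRealCLM.contDiff.comp (contDiff_const.add (contDiff_const.mul contDiff_id))
  refine ⟨?_, ?_, fun s hs => ?_⟩
  · have h1 : ContDiff ℝ ∞ fun t : ℝ => (rot g.1).toContinuousLinearMap
        (circleVec (((p₀ + p₁ * t : ℝ) : ℂ) + ((q₀ + q₁ * t : ℝ) : ℂ) * Complex.I)) :=
      (rot g.1).toContinuousLinearMap.contDiff.comp (contDiff_circleVec.comp
        ((haff p₀ p₁).add ((haff q₀ q₁).mul contDiff_const)))
    refine h1.contDiffOn.congr fun t ht => ?_
    rw [← hφ t ht, ← hτ' t ht]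
    rfl
  · have h1 : ContDiff ℝ ∞ fun t : ℝ =>
        Complex.exp ((κ : ℂ) * ((p₀ + p₁ * t : ℝ) : ℂ) * Complex.I) :=
      ((contDiff_const.mul (haff p₀ p₁)).mul contDiff_const).cexp
    refine h1.contDiffOn.congr fun t ht => ?_
    rw [← hφ t ht, Circle.coe_exp]
    push_cast
    rfl
  · have hn : Icc x y ∈ 𝓝 s := Icc_mem_nhds hs.1 hs.2
    have haffd : ∀ a b : ℝ, HasDerivAt (fun t : ℝ => a + b * t) b s := fun a b => by
      simpa using ((hasDerivAt_id s).const_mul b).const_add a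
    have h1 : HasDerivAt φ p₁ s := (haffd p₀ p₁).congr_of_eventuallyEq
      (by filter_upwards [hn] with t ht using hφ t ht)
    have h2 : HasDerivAt τ q₁ s := (haffd q₀ q₁).congr_of_eventuallyEq
      (by filter_upwards [hn] with t ht using hτ' t ht)
    obtain ⟨v, hv, hA⟩ := AK_along_circle K g hτ h1 h2
    refine ⟨v, hv, ?_⟩
    rw [hA, hκ s ⟨hs.1.le, hs.2.le⟩]
    have h3 : HasDerivAt (fun t => Complex.exp (((κ * φ t : ℝ) : ℂ) * Complex.I)) _ s :=
      (((h1.const_mul κ).ofReal_comp).mul_const Complex.I).cexp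
    simp only [Circle.coe_exp]
    refine h3.congr_deriv ?_
    ring

/-- A radial segment, a full circle of radius `√cosh 2τ₁` and the radial segment back: the radial
segments do not contribute to the holonomy. -/
theorem exp_mem_holonomy (K : ℝ) (z : M) {τ₁ : ℝ} (hτ₁ : 0 < τ₁) :
    Circle.exp (K / alphaDenom (Real.cosh (2 * τ₁)) * (2 * Real.pi)) ∈ holonomy (AK K) z := by
  obtain ⟨g, τ₀, hτ₀, rfl⟩ := exists_eq_act_circlePt z
  set κ := K / alphaDenom (Real.cosh (2 * τ₁)) with hκ
  -- `τ` moves from `τ₀` to `τ₁`, stays and moves back, while `φ` runs from `0` to `2π` in between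
  let c : ℝ → ℝ := fun t => max 0 (min 1 (min (3 * t) (3 - 3 * t)))
  let φ : ℝ → ℝ := fun t => 2 * Real.pi * max 0 (min 1 (3 * t - 1))
  let τ : ℝ → ℝ := fun t => τ₀ + (τ₁ - τ₀) * c t
  have hτ : ∀ t, 0 < τ t := by
    intro t
    have h0 : 0 ≤ c t := le_max_left _ _
    have h1 : c t ≤ 1 := max_le zero_le_one (min_le_left _ _)
    have h2 : τ t = (1 - c t) * τ₀ + c t * τ₁ := by simp only [τ]; ring
    rw [h2]
    rcases h1.lt_or_eq with h1 | h1
    · have := mul_pos (sub_pos.2 h1) hτ₀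
      have := mul_nonneg h0 hτ₁.le
      linarith
    · rw [h1]
      linarith
  have c0 : ∀ t ∈ Icc (0 : ℝ) (1 / 3), c t = 3 * t := fun t ht => by
    have h1 := ht.1
    have h2 := ht.2
    simp only [c]
    rw [min_eq_left (a := 3 * t) (by linarith), min_eq_right (by linarith),
      max_eq_right (by linarith)]
  have c1 : ∀ t ∈ Icc (1 / 3 : ℝ) (2 / 3), c t = 1 := fun t ht => by
    have h1 := ht.1
    have h2 := ht.2
    simp only [c]
    rw [min_eq_left (a := 1) (le_min (by linarith) (by linarith)), max_eq_right (by linarith)]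
  have c2 : ∀ t ∈ Icc (2 / 3 : ℝ) 1, c t = 3 - 3 * t := fun t ht => by
    have h1 := ht.1
    have h2 := ht.2
    simp only [c]
    rw [min_eq_right (a := 3 * t) (by linarith), min_eq_right (by linarith),
      max_eq_right (by linarith)]
  have φ0 : ∀ t ∈ Icc (0 : ℝ) (1 / 3), φ t = 0 + 0 * t := fun t ht => by
    have h2 := ht.2
    simp only [φ]
    rw [max_eq_left (min_le_of_right_le (by linarith))]
    ring
  have φ1 : ∀ t ∈ Icc (1 / 3 : ℝ) (2 / 3), φ t = -(2 * Real.pi) + 6 * Real.pi * t := fun t ht => by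
    have h1 := ht.1
    have h2 := ht.2
    simp only [φ]
    rw [min_eq_right (by linarith), max_eq_right (by linarith)]
    ring
  have φ2 : ∀ t ∈ Icc (2 / 3 : ℝ) 1, φ t = 2 * Real.pi + 0 * t := fun t ht => by
    have h1 := ht.1
    simp only [φ]
    rw [min_eq_left (by linarith), max_eq_right zero_le_one]
    ring
  refine ⟨fun t => act g (circlePt (φ t) (τ t) (hτ t)), fun t => Circle.exp (κ * φ t),
    ⟨3, ![0, 1 / 3, 2 / 3, 1], ?_, rfl, rfl, ?_⟩, ?_, ?_, ?_, ?_⟩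
  · rw [Fin.strictMono_iff_lt_succ]
    intro i
    fin_cases i <;> simp <;> norm_num
  · intro i
    fin_cases i
    · refine horizontal_piece K g hτ κ φ0 (q₀ := τ₀) (q₁ := (τ₁ - τ₀) * 3)
        (fun t ht => ?_) (fun t ht => by ring)
      simp only [τ]
      rw [c0 t ht]; ring
    · have hτc : ∀ t ∈ Icc (1 / 3 : ℝ) (2 / 3), τ t = τ₁ + 0 * t := fun t ht => by
        simp only [τ]
        rw [c1 t ht]; ring
      refine horizontal_piece K g hτ κ φ1 hτc (fun t ht => ?_)
      rw [hτc t ht, zero_mul, add_zero, ← hκ]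
      ring
    · refine horizontal_piece K g hτ κ φ2 (q₀ := τ₀ + 3 * (τ₁ - τ₀)) (q₁ := -3 * (τ₁ - τ₀))
        (fun t ht => ?_) (fun t ht => by ring)
      simp only [τ]
      rw [c2 t ht]; ring
  · have h1 : φ 0 = 0 := by rw [φ0 0 (by constructor <;> norm_num)]; ring
    have h2 : τ 0 = τ₀ := by simp only [τ]; rw [c0 0 (by constructor <;> norm_num)]; ring
    simp only [h1, h2]
  · have h1 : φ 1 = 2 * Real.pi := by rw [φ2 1 (by constructor <;> norm_num)]; ring
    have h2 : τ 1 = τ₀ := by simp only [τ]; rw [c2 1 (by constructor <;> norm_num)]; ring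
    simp only [h1, h2]
    congr 1
    refine Subtype.ext ?_
    change circleVec _ = circleVec _
    have h3 : ((2 * Real.pi : ℝ) : ℂ) + τ₀ * Complex.I =
        ((0 : ℝ) + τ₀ * Complex.I) + 2 * Real.pi := by push_cast; ring
    rw [h3, circleVec, Complex.cos_add_two_pi, Complex.sin_add_two_pi]
    rfl
  · have h1 : φ 0 = 0 := by rw [φ0 0 (by constructor <;> norm_num)]; ring
    simp only [h1, mul_zero, Circle.exp_zero]
  · have h1 : φ 1 = 2 * Real.pi := by rw [φ2 1 (by constructor <;> norm_num)]; ring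
    simp only [h1]

theorem isIrreducible_AK {K : ℝ} (hK : K ≠ 0) : IsIrreducible (AK K) := by
  intro z
  refine eq_univ_of_forall fun h => ?_
  obtain ⟨θ, rfl⟩ : ∃ θ, Circle.exp θ = h := ⟨_, Circle.exp_arg h⟩
  -- shift the angle so that it has the sign of `K`
  obtain ⟨n, hn⟩ : ∃ n : ℤ, 0 < K / (θ + n * (2 * Real.pi)) := by
    have hpi := Real.two_pi_pos
    rcases lt_or_gt_of_ne hK with h | h
    · obtain ⟨n, hn⟩ := exists_int_gt (θ / (2 * Real.pi))
      rw [div_lt_iff₀ hpi] at hn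
      refine ⟨-n, div_pos_of_neg_of_neg h ?_⟩
      push_cast
      linarith
    · obtain ⟨n, hn⟩ := exists_int_gt (-θ / (2 * Real.pi))
      rw [div_lt_iff₀ hpi] at hn
      exact ⟨n, div_pos h (by linarith)⟩
  have hpi := Real.two_pi_pos
  obtain ⟨τ, hτ, h⟩ := exists_alphaDenom_eq (c := K / (θ + n * (2 * Real.pi)) * (2 * Real.pi))
    (by positivity)
  have h1 := exp_mem_holonomy K z hτ
  have h2 : θ + n * (2 * Real.pi) ≠ 0 := fun h0 => by simp [h0] at hn
  have h3 : K / alphaDenom (Real.cosh (2 * τ)) * (2 * Real.pi) = θ + n * (2 * Real.pi) := by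
    rw [h]
    field_simp
  rw [h3, Circle.exp_add] at h1
  have h4 : Circle.exp (n * (2 * Real.pi)) = 1 := by
    rw [Circle.exp_eq_one]
    exact ⟨n, rfl⟩
  rwa [h4, mul_one] at h1

theorem not_isIrreducible_zero : ¬ IsIrreducible (AK 0) := by
  intro h
  have h1 : (Circle.exp Real.pi) ∈ holonomy (AK 0) (p ⟨2, by simp⟩) := by
    rw [h]; trivial
  obtain ⟨γ, u, ⟨n, t, ht, ht0, ht1, hp⟩, -, -, hu0, hu1⟩ := h1
  -- on each piece the horizontal lift `u` has zero derivative
  have hstep : ∀ i : Fin n, u (t i.succ) = u (t i.castSucc) := by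
    intro i
    obtain ⟨-, hc, hd⟩ := hp i
    have hlt : t i.castSucc < t i.succ := ht (Fin.castSucc_lt_succ)
    have h2 : ∀ s ∈ Ioo (t i.castSucc) (t i.succ), HasDerivAt (fun s => (u s : ℂ)) 0 s := by
      intro s hs
      obtain ⟨v, -, hv⟩ := hd s hs
      rw [AK_zero] at hv
      simpa using hv
    have h3 : HasDerivWithinAt (fun s => (u s : ℂ)) 0 (Ici (t i.castSucc)) (t i.castSucc) := by
      refine hasDerivWithinAt_Ici_of_tendsto_deriv (s := Ioo (t i.castSucc) (t i.succ))
        (fun s hs => (h2 s hs).differentiableAt.differentiableWithinAt)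
        ((hc.continuousOn _ (left_mem_Icc.2 hlt.le)).mono Ioo_subset_Icc_self)
        (Ioo_mem_nhdsGT hlt) (tendsto_const_nhds.congr' ?_)
      filter_upwards [Ioo_mem_nhdsGT hlt] with s hs using (h2 s hs).deriv.symm
    refine Subtype.ext (constant_of_has_deriv_right_zero hc.continuousOn (fun s hs => ?_) _
      (right_mem_Icc.2 hlt.le))
    rcases hs.1.eq_or_lt with rfl | h4
    · exact h3
    · exact (h2 s ⟨h4, hs.2⟩).hasDerivWithinAt
  have hall : ∀ i : Fin (n + 1), u (t i) = 1 := by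
    intro i
    induction i using Fin.induction with
    | zero => rw [ht0, hu0]
    | succ i ih => rw [hstep, ih]
  have h2 := hall (Fin.last n)
  rw [ht1, hu1] at h2
  have h3 := congrArg (fun c : Circle => (c : ℂ)) h2
  simp [Circle.coe_exp] at h3
  norm_num at h3

theorem isIrreducible_AK_iff (K : ℝ) : IsIrreducible (AK K) ↔ K ≠ 0 := by
  refine ⟨?_, isIrreducible_AK⟩
  rintro h rfl
  exact not_isIrreducible_zero h

/-! ### Gauge transformations -/

/-- The differential of a function in terms of a local extension. -/
theorem d_zeroForm_apply {f : M → ℂ} {z : M} {β : Amb → Amb [⋀^Fin 0]→L[ℝ] ℂ}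
    (hβ : IsLocalExtension (zeroForm f) z β) (v : T z) :
    d (zeroForm f) z ![v] = fderiv ℝ (fun w => β w fun _ => 0) z.1 v.1 := by
  rw [d_eq hβ]
  obtain ⟨U, hU, hz, hsm, -⟩ := hβ
  have h1 : DifferentiableAt ℝ β z := (hsm.contDiffAt (hU.mem_nhds hz)).differentiableAt (by simp)
  have h2 : restrict (extDeriv β) z ![v] = extDeriv β z ![v.1] :=
    congrArg (extDeriv β z) (funext fun i => by fin_cases i; rfl)
  rw [h2, extDeriv_apply h1, Fin.sum_univ_one]
  simp only [Fin.val_zero, pow_zero, one_smul]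
  have h3 : (0 : Fin 1).removeNth ![v.1] = fun _ => (0 : Amb) := Subsingleton.elim _ _
  rw [h3]
  rfl

/-- The chain rule for a smooth function along a curve in `M`. -/
theorem hasDerivAt_comp_curve {f : M → ℂ} (hf : IsSmooth (zeroForm f)) {γ : ℝ → M} {s : ℝ}
    {v : T (γ s)} (hγ : HasDerivAt (fun t => (γ t : Amb)) v.1 s) :
    HasDerivAt (fun t => f (γ t)) (d (zeroForm f) (γ s) ![v]) s := by
  obtain ⟨β, hβ⟩ := hf (γ s)
  rw [d_zeroForm_apply hβ]
  obtain ⟨U, hU, hz, hsm, he⟩ := hβ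
  have h1 : DifferentiableAt ℝ β (γ s) := (hsm.contDiffAt (hU.mem_nhds hz)).differentiableAt (by simp)
  have h2 : DifferentiableAt ℝ (fun w => β w fun _ => 0) (γ s : Amb) :=
    DifferentiableAt.comp (g := ContinuousAlternatingMap.apply ℝ Amb ℂ fun _ : Fin 0 => (0 : Amb)) _
      (ContinuousLinearMap.differentiableAt _) h1
  refine (h2.hasFDerivAt.comp_hasDerivAt s hγ).congr_of_eventuallyEq ?_
  filter_upwards [hγ.continuousAt (hU.mem_nhds hz)] with t ht
  have h5 := congrArg (fun a : Alt (γ t) 0 => a (fun _ => 0)) (he (γ t) ht)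
  exact h5.symm

/-- Around a circle on which the two connections have holonomies differing by `-1`, a gauge
transformation between them would change sign. -/
theorem not_gaugeEquivalent {K K' : ℝ} (hK : K ≠ K') : ¬ GaugeEquivalent (AK K) (AK K') := by
  rintro ⟨u, hu, hB⟩
  -- on this circle the holonomy angles differ by `±π`
  obtain ⟨τ, hτ, hc⟩ := exists_alphaDenom_eq (c := 2 * |K - K'|)
    (by have := abs_pos.2 (sub_ne_zero.2 hK); positivity)
  let γ : ℝ → M := fun t => act 1 (circlePt t τ hτ)
  set δ : ℝ := (K - K') / alphaDenom (Real.cosh (2 * τ)) with hδ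
  have hd : ∀ s, HasDerivAt (fun t => (u (γ t) : ℂ)) (-(Complex.I * δ) * u (γ s)) s := by
    intro s
    obtain ⟨v, hv, hA⟩ := AK_along_circle K 1 (φ := fun t => t) (τ := fun _ => τ) (fun _ => hτ)
      (hasDerivAt_id s) (hasDerivAt_const s τ)
    obtain ⟨v', hv', hA'⟩ := AK_along_circle K' 1 (φ := fun t => t) (τ := fun _ => τ) (fun _ => hτ)
      (hasDerivAt_id s) (hasDerivAt_const s τ)
    have hvv : v' = v := Subtype.ext (hv'.unique hv)
    rw [hvv] at hA'
    have h1 := hasDerivAt_comp_curve hu (γ := γ) hv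
    refine h1.congr_deriv ?_
    have h2 := congrArg (fun a : Alt (γ s) 1 => a ![v]) (hB (γ s))
    simp only [AlternatingMap.sub_apply, AlternatingMap.smul_apply, smul_eq_mul] at h2
    have hu0 : (u (γ s) : ℂ) ≠ 0 := Circle.coe_ne_zero _
    have h3 : d (zeroForm fun w => (u w : ℂ)) (γ s) ![v] =
        u (γ s) * (AK K (γ s) ![v] - AK K' (γ s) ![v]) := by
      rw [h2]
      push_cast
      field_simp
      ring
    rw [h3]
    change u (γ s) * (AK K (act 1 (circlePt s τ hτ)) ![v] -
      AK K' (act 1 (circlePt s τ hτ)) ![v]) = _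
    rw [hA, hA', hδ]
    push_cast
    ring
  have hconst : ∀ s, HasDerivAt (fun t : ℝ => (u (γ t) : ℂ) * Complex.exp (Complex.I * δ * t)) 0 s := by
    intro s
    have h1 : HasDerivAt (fun t : ℝ => Complex.exp (Complex.I * δ * t)) _ s :=
      ((Complex.ofRealCLM.hasDerivAt (x := s)).const_mul (Complex.I * (δ : ℂ))).cexp
    refine ((hd s).mul h1).congr_deriv ?_
    simp
    ring
  have h1 := is_const_of_deriv_eq_zero (fun s => (hconst s).differentiableAt)
    (fun s => (hconst s).deriv) 0 (2 * Real.pi)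
  have h2 : γ (2 * Real.pi) = γ 0 := by
    have : circlePt (2 * Real.pi) τ hτ = circlePt 0 τ hτ := by
      refine Subtype.ext ?_
      change circleVec _ = circleVec _
      have h3 : ((2 * Real.pi : ℝ) : ℂ) + τ * Complex.I =
          ((0 : ℝ) + τ * Complex.I) + 2 * Real.pi := by push_cast; ring
      rw [h3, circleVec, Complex.cos_add_two_pi, Complex.sin_add_two_pi]
      rfl
    exact congrArg (act 1) this
  rw [h2] at h1
  have h3 : Complex.exp (Complex.I * δ * ((2 * Real.pi : ℝ) : ℂ)) = 1 := by
    have hu0 : (u (γ 0) : ℂ) ≠ 0 := Circle.coe_ne_zero _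
    have := mul_left_cancel₀ hu0 h1
    rw [← this]
    simp
  have h4 : δ = 1 / 2 ∨ δ = -(1 / 2) := by
    rw [hδ, hc]
    have h5 := sub_ne_zero.2 hK
    rcases abs_cases (K - K') with ⟨h, -⟩ | ⟨h, -⟩ <;> rw [h]
    · left; field_simp
    · right; field_simp
  rcases h4 with h4 | h4
  · have h5 : Complex.I * δ * ((2 * Real.pi : ℝ) : ℂ) = Real.pi * Complex.I := by
      rw [h4]; push_cast; ring
    rw [h5, Complex.exp_pi_mul_I] at h3
    norm_num at h3
  · have h5 : Complex.I * δ * ((2 * Real.pi : ℝ) : ℂ) = -(Real.pi * Complex.I) := by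
      rw [h4]; push_cast; ring
    rw [h5, Complex.exp_neg, Complex.exp_pi_mul_I] at h3
    norm_num at h3

/-! ### General invariant connections -/

theorem IsInvariant.apply_eq {A : Form 1} (hA : IsInvariant A) (g : SO5) {z z' : M}
    (hz : z' = act g z) (v : T z) (w : T z') (hw : w.1 = rot g.1 v.1) :
    A z' ![w] = A z ![v] := by
  subst hz
  have h1 : w = dAct g z v := Subtype.ext hw
  rw [h1, ← congrFun (hA g) z]
  exact congrArg (A (act g z)) (funext fun i => by fin_cases i; rfl)

/-- A diagonal matrix of signs with determinant one. -/
def signFlip (ε : Fin 5 → ℝ) (h1 : ∀ i, ε i * ε i = 1) (h2 : ∏ i, ε i = 1) : SO5 :=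
  ⟨Matrix.diagonal ε, by
    rw [Matrix.mem_specialOrthogonalGroup_iff, Matrix.mem_orthogonalGroup_iff']
    refine ⟨?_, by rw [Matrix.det_diagonal, h2]⟩
    change (Matrix.diagonal ε).transpose * Matrix.diagonal ε = 1
    rw [Matrix.diagonal_transpose, Matrix.diagonal_mul_diagonal, ← Matrix.diagonal_one]
    exact congrArg _ (funext h1)⟩

theorem rot_signFlip (ε : Fin 5 → ℝ) (h1 : ∀ i, ε i * ε i = 1) (h2 : ∏ i, ε i = 1) (v : Amb)
    (j : Fin 5) : rot (signFlip ε h1 h2).1 v j = ε j * v j := by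
  change Matrix.mulVec ((Matrix.diagonal ε).map Complex.ofReal) v j = _
  rw [Matrix.diagonal_map (by simp), Matrix.mulVec_diagonal]

/-- The radial direction `(R₋, iR₊, 0, 0, 0)` at `p_r`. -/
def radialVec (r : Ioi (1 : ℝ)) : T (p r) :=
  ⟨![(Rm r : ℂ), Complex.I * Rp r, 0, 0, 0], by
    rw [mem_T]
    simp [p, Fin.sum_univ_five]
    linear_combination ((Rp r : ℂ) * Rm r) * Complex.I_mul_I⟩

/-- The image `(iR₋, -R₊, 0, 0, 0)` of the radial direction under the complex structure. -/
def angularVec (r : Ioi (1 : ℝ)) : T (p r) :=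
  ⟨![Complex.I * (Rm r : ℂ), -(Rp r : ℂ), 0, 0, 0], by
    rw [mem_T]
    simp [p, Fin.sum_univ_five]
    ring⟩

/-- The diagonal sign matrices fixing `p_r` kill all but the first two coordinates. -/
theorem IsInvariant.apply_p {A : Form 1} (hA : IsInvariant A) (r : Ioi (1 : ℝ)) (v : T (p r)) :
    A (p r) ![v] = ((v.1 0).re / Rm r : ℝ) * A (p r) ![radialVec r] +
      ((v.1 0).im / Rm r : ℝ) * A (p r) ![angularVec r] := by
  let L : T (p r) →ₗ[ℝ] ℂ := (AlternatingMap.ofSubsingleton ℝ (T (p r)) ℂ (0 : Fin 1)).symm (A (p r))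
  have hL : ∀ w, A (p r) ![w] = L w := fun w =>
    congrArg (A (p r)) (funext fun i => by fin_cases i; rfl)
  have hflip : ∀ (a b c : ℝ), a * a = 1 → b * b = 1 → c * c = 1 → a * b * c = 1 →
      ∃ w : T (p r), L w = L v ∧ w.1 = ![v.1 0, v.1 1, a * v.1 2, b * v.1 3, c * v.1 4] := by
    intro a b c ha hb hc habc
    have h1 : ∀ i, (![1, 1, a, b, c] : Fin 5 → ℝ) i * (![1, 1, a, b, c] : Fin 5 → ℝ) i = 1 := by
      intro i; fin_cases i <;> simp [ha, hb, hc]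
    have h2 : ∏ i, (![1, 1, a, b, c] : Fin 5 → ℝ) i = 1 := by
      simp [Fin.prod_univ_five, habc]
    have h3 : rot (signFlip _ h1 h2).1 v.1 = ![v.1 0, v.1 1, a * v.1 2, b * v.1 3, c * v.1 4] := by
      ext j
      rw [rot_signFlip]
      fin_cases j <;> simp
    have h4 : p r = act (signFlip _ h1 h2) (p r) := by
      refine Subtype.ext (funext fun j => ?_)
      change _ = rot (signFlip _ h1 h2).1 (p r).1 j
      rw [rot_signFlip]
      fin_cases j <;> simp [p]
    have h5 : rot (signFlip _ h1 h2).1 v.1 ∈ T (p r) :=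
      (congrArg (fun z => rot (signFlip _ h1 h2).1 v.1 ∈ T z) h4).mpr
        (dAct (signFlip _ h1 h2) (p r) v).2
    refine ⟨⟨_, h5⟩, ?_, h3⟩
    rw [← hL, ← hL]
    exact hA.apply_eq _ h4 v _ rfl
  obtain ⟨w1, e1, f1⟩ := hflip (-1) (-1) 1 (by norm_num) (by norm_num) (by norm_num) (by norm_num)
  obtain ⟨w2, e2, f2⟩ := hflip 1 (-1) (-1) (by norm_num) (by norm_num) (by norm_num) (by norm_num)
  obtain ⟨w3, e3, f3⟩ := hflip (-1) 1 (-1) (by norm_num) (by norm_num) (by norm_num) (by norm_num)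
  have hb := (Rm_pos r.2).ne'
  obtain ⟨t1, t2⟩ := tangent_p r v
  have hsum : v + w1 + w2 + w3 = (4 : ℝ) • (((v.1 0).re / Rm r) • radialVec r +
      ((v.1 0).im / Rm r) • angularVec r) := by
    refine Subtype.ext (funext fun j => ?_)
    change v.1 j + w1.1 j + w2.1 j + w3.1 j = _
    rw [f1, f2, f3]
    fin_cases j <;> apply Complex.ext <;> simp [radialVec, angularVec] <;> field_simp
    · ring
    · ring
    · linear_combination 4 * t1
    · linear_combination 4 * t2
  have h := congrArg L hsum
  simp only [map_add, map_smul, e1, e2, e3, Complex.real_smul] at h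
  rw [hL, hL, hL]
  push_cast at h ⊢
  linear_combination h / 4

/-- Smoothness of the coefficients of a smooth form along the reference points. -/
theorem IsSmooth.contDiffOn_apply {A : Form 1} (hA : IsSmooth A) {F : ℝ → ℂ}
    {V : ∀ r : Ioi (1 : ℝ), T (p r)} {W : ℝ → Amb} (hW : ContDiffOn ℝ ∞ W (Ioi 1))
    (hV : ∀ s (hs : 1 < s), (V ⟨√s, one_lt_sqrt hs⟩).1 = W s)
    (hF : ∀ s (hs : 1 < s), F s = A (p ⟨√s, one_lt_sqrt hs⟩) ![V ⟨√s, one_lt_sqrt hs⟩])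
    {c : ℝ → Amb} (hc : ContDiffOn ℝ ∞ c (Ioi 1))
    (hp : ∀ s (hs : 1 < s), (p ⟨√s, one_lt_sqrt hs⟩).1 = c s) :
    ContDiffOn ℝ ∞ F (Ioi 1) := by
  intro s hs
  obtain ⟨β, U, hU, hz, hβ, he⟩ := hA (p ⟨√s, one_lt_sqrt hs⟩)
  rw [hp s hs] at hz
  have hc' : ContDiffAt ℝ ∞ c s := hc.contDiffAt (Ioi_mem_nhds hs)
  let L : Amb → Amb →L[ℝ] ℂ := fun w => (ContinuousAlternatingMap.ofSubsingletonLIE (𝕜 := ℝ)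
    (E := Amb) (F := ℂ) (0 : Fin 1)).symm (β w)
  have hL : ContDiffAt ℝ ∞ L (c s) :=
    (ContinuousAlternatingMap.ofSubsingletonLIE (𝕜 := ℝ) (E := Amb) (F := ℂ)
      (0 : Fin 1)).symm.toContinuousLinearEquiv.contDiff.contDiffAt.comp _
      (hβ.contDiffAt (hU.mem_nhds hz))
  have h1 : ContDiffAt ℝ ∞ (fun t => L (c t) (W t)) s :=
    (hL.comp s hc').clm_apply (hW.contDiffAt (Ioi_mem_nhds hs))
  refine ContDiffAt.contDiffWithinAt (h1.congr_of_eventuallyEq ?_)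
  filter_upwards [Ioi_mem_nhds hs, hc'.continuousAt (hU.mem_nhds hz)] with t ht htU
  have htU' : (p ⟨√t, one_lt_sqrt ht⟩).1 ∈ U := by rw [hp t ht]; exact htU
  rw [hF t ht, ← he _ htU', ← hV t ht, ← hp t ht]
  exact congrArg (β (p ⟨√t, one_lt_sqrt ht⟩).1) (funext fun i => by fin_cases i; rfl)

theorem contDiffOn_Rp_sqrt : ContDiffOn ℝ ∞ (fun s : ℝ => (Rp (√s) : ℂ)) (Ioi 1) := by
  have h : ContDiffOn ℝ ∞ (fun s : ℝ => √((s + 1) / 2)) (Ioi 1) := fun s hs => by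
    have hs' : 1 < s := hs
    refine ContDiffAt.contDiffWithinAt
      (((contDiffAt_id.add contDiffAt_const).div_const 2).sqrt ?_)
    have : 0 < (s + 1) / 2 := by linarith
    exact this.ne'
  have hR : ContDiffOn ℝ ∞ (fun s : ℝ => Rp (√s)) (Ioi 1) := h.congr fun s hs => by
    rw [Rp, Real.sq_sqrt (zero_le_one.trans (le_of_lt hs))]
  exact Complex.ofRealCLM.contDiff.comp_contDiffOn hR

theorem contDiffOn_Rm_sqrt : ContDiffOn ℝ ∞ (fun s : ℝ => (Rm (√s) : ℂ)) (Ioi 1) := by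
  have h : ContDiffOn ℝ ∞ (fun s : ℝ => √((s - 1) / 2)) (Ioi 1) := fun s hs => by
    have hs' : 1 < s := hs
    refine ContDiffAt.contDiffWithinAt
      (((contDiffAt_id.sub contDiffAt_const).div_const 2).sqrt ?_)
    have : 0 < (s - 1) / 2 := by linarith
    exact this.ne'
  have hR : ContDiffOn ℝ ∞ (fun s : ℝ => Rm (√s)) (Ioi 1) := h.congr fun s hs => by
    rw [Rm, Real.sq_sqrt (zero_le_one.trans (le_of_lt hs))]
  exact Complex.ofRealCLM.contDiff.comp_contDiffOn hR

theorem contDiffOn_vec {a b : ℝ → ℂ} (ha : ContDiffOn ℝ ∞ a (Ioi 1))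
    (hb : ContDiffOn ℝ ∞ b (Ioi 1)) :
    ContDiffOn ℝ ∞ (fun s => (![a s, b s, 0, 0, 0] : Amb)) (Ioi 1) := by
  rw [contDiffOn_pi]
  intro i
  fin_cases i
  · exact ha
  · exact hb
  all_goals exact contDiffOn_const

/-- An invariant connection is `i(k(r²) d(r²) + h(r²) ∑ xⱼ dyⱼ)` with smooth real functions. -/
theorem IsInvariant.exists_profile {A : Form 1} (hA : IsInvariant A) (hC : IsConnection A) :
    ∃ k h : ℝ → ℝ, ContDiffOn ℝ ∞ k (Ioi 1) ∧ ContDiffOn ℝ ∞ h (Ioi 1) ∧ ∀ (z : M) (v : T z),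
      A z ![v] = Complex.I * (2 * k (normSq z.1) * eucl z.1 v.1 + h (normSq z.1) * reIm z.1 v.1) := by
  classical
  have ha := contDiffOn_Rp_sqrt
  have hb := contDiffOn_Rm_sqrt
  -- the form along a tangent vector field at the reference points
  let F : (∀ r : Ioi (1 : ℝ), T (p r)) → ℝ → ℂ := fun V s =>
    if hs : 1 < s then A (p ⟨√s, one_lt_sqrt hs⟩) ![V ⟨√s, one_lt_sqrt hs⟩] else 0
  have hF : ∀ V s (hs : 1 < s), F V s =
      A (p ⟨√s, one_lt_sqrt hs⟩) ![V ⟨√s, one_lt_sqrt hs⟩] := fun V s hs => dif_pos hs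
  have hFs : ∀ (V : ∀ r : Ioi (1 : ℝ), T (p r)) (W : ℝ → Amb), ContDiffOn ℝ ∞ W (Ioi 1) →
      (∀ s (hs : 1 < s), (V ⟨√s, one_lt_sqrt hs⟩).1 = W s) →
      ContDiffOn ℝ ∞ (fun s => (F V s).im) (Ioi 1) := fun V W hW hV =>
    Complex.imCLM.contDiff.comp_contDiffOn (hC.1.contDiffOn_apply hW hV (hF V)
      (contDiffOn_vec ha (contDiffOn_const.mul hb)) fun s hs => rfl)
  have h1 := hFs radialVec _ (contDiffOn_vec hb (contDiffOn_const.mul ha)) fun s hs => rfl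
  have h2 := hFs angularVec _ (contDiffOn_vec (contDiffOn_const.mul hb) ha.neg) fun s hs => rfl
  refine ⟨fun s => (F radialVec s).im / (4 * radiiProd s), fun s => (F angularVec s).im / radiiProd s,
    h1.div (contDiffOn_const.mul contDiffOn_radiiProd) fun s hs =>
      (mul_pos four_pos (radiiProd_pos hs)).ne',
    h2.div contDiffOn_radiiProd fun s hs => (radiiProd_pos hs).ne', fun z v => ?_⟩
  obtain ⟨g, hg⟩ := exists_eq_act_p z
  have h3 : ∀ V, F V (normSq z.1) = A (p ⟨radius z, one_lt_radius z⟩) ![V _] := fun V =>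
    hF V _ (one_lt_normSq z)
  have h4 : radiiProd (normSq z.1) = Rp (radius z) * Rm (radius z) := rfl
  have him : ∀ w : ℂ, w.re = 0 → w = Complex.I * w.im := fun w hw => by
    apply Complex.ext <;> simp [hw]
  simp only [h3, h4]
  clear h3 h4
  generalize hr : (⟨radius z, one_lt_radius z⟩ : Ioi (1 : ℝ)) = r at hg
  have hr' : radius z = r := congrArg Subtype.val hr
  rw [hr']
  clear hr hr'
  subst hg
  obtain ⟨u, rfl⟩ := (dAct_bijective g (p r)).2 v
  rw [hA.apply_eq g rfl u _ rfl, hA.apply_p]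
  have e1 : eucl (act g (p r)).1 (dAct g (p r) u).1 = eucl (p r).1 u.1 := eucl_rot g _ _
  have e2 : reIm (act g (p r)).1 (dAct g (p r) u).1 = reIm (p r).1 u.1 := reIm_rot g _ _
  rw [e1, e2, eucl_p, reIm_p, him _ (hC.2 _ ![radialVec r]), him _ (hC.2 _ ![angularVec r])]
  have ha0 : (Rp r : ℂ) ≠ 0 := by exact_mod_cast (Rp_pos (r : ℝ)).ne'
  have hb0 : (Rm r : ℂ) ≠ 0 := by exact_mod_cast (Rm_pos r.2).ne'
  push_cast
  simp
  field_simp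
  ring

theorem isSmooth_zeroForm_and_d_apply {f : M → ℂ} {φ : Amb → ℂ} (hφ : ContDiffOn ℝ ∞ φ outer)
    (hf : ∀ z : M, f z = φ z.1) : IsSmooth (zeroForm f) ∧
      ∀ (z : M) (v : T z), d (zeroForm f) z ![v] = fderiv ℝ φ z.1 v.1 := by
  have h : ∀ z, IsLocalExtension (zeroForm f) z
      fun w => ContinuousAlternatingMap.constOfIsEmptyLIE ℝ Amb ℂ (Fin 0) (φ w) := by
    intro z
    refine ⟨outer, isOpen_outer, coe_mem_outer z, ?_, fun w _ => ?_⟩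
    · exact (ContinuousAlternatingMap.constOfIsEmptyLIE ℝ Amb ℂ
        (Fin 0)).toContinuousLinearEquiv.contDiff.comp_contDiffOn hφ
    · ext v
      exact (hf w).symm
  exact ⟨fun z => ⟨_, h z⟩, fun z v => d_zeroForm_apply (h z) v⟩

theorem exists_primitive {k : ℝ → ℝ} (hk : ContDiffOn ℝ ∞ k (Ioi 1)) :
    ∃ Ψ : ℝ → ℝ, ContDiffOn ℝ ∞ Ψ (Ioi 1) ∧ ∀ s, 1 < s → HasDerivAt Ψ (k s) s := by
  have h : ∀ s, 1 < s → HasDerivAt (fun s => ∫ t in (2 : ℝ)..s, k t) (k s) s := by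
    intro s hs
    have hsub : uIcc 2 s ⊆ Ioi 1 := by
      intro t ht
      have h1 : min 2 s ≤ t := ht.1
      exact lt_of_lt_of_le (lt_min one_lt_two hs) h1
    refine intervalIntegral.integral_hasDerivAt_right
      (hk.continuousOn.mono hsub).intervalIntegrable ?_ ?_
    · exact hk.continuousOn.stronglyMeasurableAtFilter isOpen_Ioi s hs
    · exact hk.continuousOn.continuousAt (Ioi_mem_nhds hs)
  exact ⟨_, contDiffOn_of_hasDerivAt h hk, h⟩

/-- The gauge transformation `exp(iΨ(r²))` with `Ψ' = k` brings an invariant connection into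
temporal gauge without changing its component along `∑ xⱼ dyⱼ`. -/
theorem exists_equivariantlyGaugeEquivalent_AK {A : Form 1} (hC : IsConnection A)
    (hA : IsInvariant A) (hI : IsSpin7Instanton A) :
    ∃ K : ℝ, EquivariantlyGaugeEquivalent A (AK K) := by
  obtain ⟨k, h, hk, hh, hkh⟩ := hA.exists_profile hC
  obtain ⟨Ψ, hΨ, hΨ'⟩ := exists_primitive hk
  let u : M → Circle := fun z => Circle.exp (Ψ (normSq z.1))
  let φ : Amb → ℂ := fun w => Complex.exp (Ψ (normSq w) * Complex.I)
  have hφ : ContDiffOn ℝ ∞ φ outer :=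
    ((Complex.ofRealCLM.contDiff.comp_contDiffOn
      (hΨ.comp contDiff_normSq.contDiffOn fun w hw => hw)).mul contDiffOn_const).cexp
  obtain ⟨hu, hdu⟩ := isSmooth_zeroForm_and_d_apply hφ (f := fun z => (u z : ℂ)) fun z => Circle.coe_exp _
  have hd : ∀ (z : M) (v : T z), ((u z)⁻¹ : ℂ) * d (zeroForm fun w => (u w : ℂ)) z ![v] =
      Complex.I * (2 * k (normSq z.1) * eucl z.1 v.1) := by
    intro z v
    have h1 : HasFDerivAt φ _ z.1 := (((hΨ' _ (one_lt_normSq z)).ofReal_comp.hasFDerivAt.comp z.1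
      (hasFDerivAt_normSq z.1)).mul_const Complex.I).cexp
    have h2 : (u z : ℂ) = Complex.exp (Ψ (normSq z.1) * Complex.I) := Circle.coe_exp _
    rw [hdu, h1.fderiv, h2]
    have h3 := Complex.exp_ne_zero (Ψ (normSq z.1) * Complex.I)
    simp [ofReal_dNormSq]
    field_simp
  let B : Form 1 := fun z => A z - ((u z)⁻¹ : ℂ) • d (zeroForm fun w => (u w : ℂ)) z
  have hB : IsTemporal B h := by
    refine ⟨hh, fun z v => ?_⟩
    change A z ![v] - ((u z)⁻¹ : ℂ) * d (zeroForm fun w => (u w : ℂ)) z ![v] = _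
    rw [hd, hkh]
    ring
  have hR : IsRadial A (fun s => Complex.I * k s) (fun s => Complex.I * h s) :=
    ⟨contDiffOn_const.mul (Complex.ofRealCLM.contDiff.comp_contDiffOn hk),
      contDiffOn_const.mul (Complex.ofRealCLM.contDiff.comp_contDiffOn hh),
      fun z v => by rw [hkh]; ring⟩
  obtain ⟨K, hK⟩ := hB.eq_AK
    (hB.isRadial.isSpin7Instanton_iff.2 (hR.isSpin7Instanton_iff.1 hI))
  refine ⟨K, u, fun g z => ?_, hu, fun z => ?_⟩
  · change Circle.exp (Ψ (normSq (rot g.1 z.1))) = _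
    rw [normSq_rot]
  · rw [← hK]

end

end Stenzel

theorem mainTheorem9 :
    (∀ K : ℝ,
      AK K ∈ Ainv ∧ IsConnection (AK K) ∧ IsInvariant (AK K) ∧
      IsSpin7Instanton (AK K) ∧ IsHYM (AK K) ∧ (IsIrreducible (AK K) ↔ K ≠ 0) ∧
      ∀ (r : Set.Ioi (1 : ℝ)) (g : SO5),
        pullback g (d (AK K)) (p r) =
          (Complex.I * K) •
            ((-(9 / 2 : ℝ) * (r * (r ^ 2 + 1) / ((r ^ 2 + 2) ^ (7 / 4 : ℝ) *
                (r + 1) ^ (5 / 2 : ℝ) * (r - 1) ^ (5 / 2 : ℝ))) : ℝ) •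
              wedge (coframe r 0) (coframe r 1) +
            (1 / ((r ^ 2 + 2) ^ (3 / 4 : ℝ) *
                (r + 1) ^ (3 / 2 : ℝ) * (r - 1) ^ (3 / 2 : ℝ)) : ℝ) •
              (wedge (coframe r 2) (coframe r 5) + wedge (coframe r 3) (coframe r 6) +
                wedge (coframe r 4) (coframe r 7)))) ∧
    AK 0 = 0 ∧
    (∀ K K' : ℝ, K ≠ K' → ¬ GaugeEquivalent (AK K) (AK K')) ∧
    {A | A ∈ Ainv ∧ IsSpin7Instanton A} = Set.range AK ∧
    (∀ A : Form 1, IsConnection A → IsInvariant A → IsSpin7Instanton A →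
      ∃ K : ℝ, EquivariantlyGaugeEquivalent A (AK K)) :=
  ⟨fun K => ⟨AK_mem_Ainv K, (isTemporal_AK K).isConnection, (isTemporal_AK K).isRadial.isInvariant,
      isSpin7Instanton_AK K, (isTemporal_AK K).isRadial.isHYM (isSpin7Instanton_AK K),
      isIrreducible_AK_iff K, pullback_d_AK K⟩,
    AK_zero, fun _ _ h => not_gaugeEquivalent h, setOf_instanton_eq_range,
    fun _ hC hA hI => exists_equivariantlyGaugeEquivalent_AK hC hA hI⟩
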